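/- Let $F$ be a finite unramified extension of $\mathbb{Q}_2$ with ring of integers $A$, and let $E/F$ be a ramified quadratic extension with ring of integers $B$ and $\mathrm{Gal}(E/F)=\{1,\sigma\}$, whose lower ramification groups satisfy $G_{-1}=G_0=G_1=G_2$ and $G_3=1$. Fix a uniformizer $\pi$ of $B$ with $\sigma(\pi)=-\pi$ and $\pi^2=2\delta$, where $\delta\in A$, $\delta\equiv 1 \bmod 2$, and put $\xi=\pi\sigma(\pi)$. Let $L$ be a free $B$-module of finite rank with a hermitian form $h:L\times L\to B$ (so $h(av,bw)=\sigma(a)b\,h(v,w)$ and $h(w,v)=\sigma(h(v,w))$) such that $V=L\otimes_AF$ is nondegenerate. For a lattice $N\subseteq V$ let $N^\perp=\{x\in V: h(x,N)\subseteq B\}$. For each integer $i\ge 0$ write $i=2m$ or $i=2m-1$ and put: - $A_i=\{x\in L: h(x,L)\subseteq\pi^iB\}$; - $X_i=\{x\in A_i: h(x,A_i)\subseteq\pi^{i+1}B\}$; - $B_i=\{x\in A_i: 2^{-m}h(x,x)\equiv 0 \bmod 2\}$; - $W_i=X_i$ if $i$ is odd; if $i=2m$ is even, $W_i$ is the submodule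 of $A_i$ such that $W_i/X_i$ is spanned by the unique $e\in A_i/X_i$ with $(\xi^{-m}h(v,e))^2\equiv\xi^{-m}h(v,v) \bmod \pi$ for all $v\in A_i$; - for $i=2m$ even, $Z_i\subseteq B_i$ is the submodule such that $Z_i/\pi B_i$ is the radical of the quadratic form $2^{-(m+1)}h(x,x)\bmod 2$ on $B_i/\pi B_i$ (the zeros of this form in the radical of its polar form). For a flat commutative $A$-algebra $R$, let $\underline{M}(R)$ be the monoid of all $m\in\mathrm{End}_{B\otimes_AR}(L\otimes_AR)$ such that 1. $m$ stabilizes $A_i\otimes_A R$, $B_i\otimes_A R$, $W_i\otimes_A R$, $X_i\otimes_A R$ for all $i$, and $Z_i\otimes_A R$ for all even $i$; 2. $m$ induces the identity on $A_i\otimes_A R/B_i\otimes_A R$ for all $i$; 3. $m$ induces the identity on $W_i\otimes_A R/(X_i\cap Z_i)\otimes_A R$ for all even $i$; 4. $m$ induces the identity on $B_i^\perp\otimes_A R/A_i^\perp\otimes_A R$ for all odd $i$. Let $\underline{M}^{*}(R)$ be the group of invertible elements of $\underline{M}(R)$. Let $\underline{H}(R)$ be the set of hermitian forms $f$ on $L\otimes_AR$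 with values in $B\otimes_AR$ such that - (a) $f(L\otimes_A R,A_i\otimes_A R)\subseteq\pi^iB\otimes_AR$ for all $i$; - (b) $\xi^{-m}f(a,a)\equiv\xi^{-m}h(a,a)\bmod 2$ for $a\in A_i\otimes_A R$ and all $i=2m$ or $2m-1$; - (c) $\pi^{-i}f(a,w)\equiv\pi^{-i}h(a,w)\bmod\pi$ for $a\in A_i\otimes_A R$, $w\in W_i\otimes_A R$, $i$ even; - (d) $\xi^{-m}f(w,w)-\xi^{-m}h(w,w)\in(4)$ for $w\in W_i\otimes_A R$, $i=2m$; - (e) for $i$ odd, $f(B_i\otimes_A R,B_i^\perp\otimes_A R)\subseteq B\otimes_AR$, and $f(a,b')-h(a,b')\in B\otimes_AR$ for $a\in A_i\otimes_A R$, $b'\in B_i^\perp\otimes_A R$. **Theorem.** For every flat $A$-algebra $R$, the group $\underline{M}^{*}(R)$ acts on the right of $\underline{H}(R)$ by $f\circ m=\sigma({}^tm)\cdot f\cdot m$, that is, $(f\circ m)(x,y)=f(mx,my)$. The functors $\underline{H}$ and $\underline{M}^{*}$ on flat $A$-algebras are represented by flat affine $A$-schemes, $\underline{M}^{*}$ by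 a group scheme, and for any such representing schemes (again denoted $\underline{H}$, $\underline{M}^{*}$) the action is represented by a unique morphism of $A$-schemes $\underline{H}\times\underline{M}^{*}\to\underline{H}$, which is a right action of the group scheme $\underline{M}^{*}$ on $\underline{H}$. -/

import Mathlib

open scoped TensorProduct
open CategoryTheory AlgebraicGeometry MonoidalCategory CartesianMonoidalCategory

universe u v

noncomputable section

namespace RamifiedHermitian

/-! ### Hermitian forms -/

/-- Hermitian forms on a `C`-module `N` with values in `C`, relative to a ring endomorphism `s` of
`C`: biadditive, with `f (a x, b y) = s a * b * f (x, y)` and `f (y, x) = s (f (x, y))`. -/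
@[ext]
structure HermForm {C : Type*} [CommRing C] (s : C →+* C) (N : Type*) [AddCommGroup N]
    [Module C N] where
  form : N →ₛₗ[s] N →ₗ[C] C
  symm : ∀ x y, form y x = s (form x y)

namespace HermForm

/-- The form `f ∘ m`, `(f ∘ m)(x, y) = f (m x, m y)`.  If `f` and `m` are written as matrices with
respect to a basis, so that `f (x, y) = σ(ᵗx) · f · y`, this is the form with matrix
`σ(ᵗm) · f · m`. -/
def comp {C : Type*} [CommRing C] {s : C →+* C} {N : Type*} [AddCommGroup N]
    [Module C N] (f : HermForm s N) (m : Module.End C N) : HermForm s N where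
  form := (f.form.comp m).compl₂ m
  symm x y := f.symm (m x) (m y)

/-- For `A`-algebras `C` and `F`, the form `f` extended to `N ⊗_A F`, with values
in `C ⊗_A F`: `(x ⊗ a, y ⊗ b) ↦ f (x, y) ⊗ a b`. -/
def extend {A : Type*} [CommRing A] (F : Type*) [CommRing F] [Algebra A F]
    {C : Type*} [CommRing C] [Algebra A C] {s : C →ₐ[A] C}
    {N : Type*} [AddCommGroup N] [Module C N] [Module A N] [IsScalarTower A C N]
    (f : HermForm (s : C →+* C) N) :
    (N ⊗[A] F) →ₗ[A] (N ⊗[A] F) →ₗ[A] (C ⊗[A] F) :=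
  TensorProduct.map₂
    (LinearMap.mk₂ A (fun x y => f.form x y)
      (fun x x' y => by simp)
      (fun a x y => by
        rw [← algebraMap_smul C a x, LinearMap.map_smulₛₗ]
        simp [Algebra.smul_def])
      (fun x y y' => by simp)
      (fun a x y => by
        rw [← algebraMap_smul C a y, map_smul]
        simp [Algebra.smul_def]))
    (LinearMap.mul A F)

end HermForm

/-! ### The ramified quadratic extension -/

/-- The data fixed on the ramified quadratic extension `B / A` of rings of integers in Case 2: the
nontrivial automorphism `σ` (of order two), which acts trivially on `B / (π³)` but not on `B / (π⁴)` (so that the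
lower ramification groups satisfy `G₋₁ = G₀ = G₁ = G₂` and `G₃ = 1`), and a uniformizer `π` of
`B` with `σ π = - π` and `π² = 2 δ`, where `δ ∈ A` and `δ ≡ 1 mod 2`. -/
structure Case2 (A B : Type*) [CommRing A] [CommRing B] [Algebra A B] where
  σ : B ≃ₐ[A] B
  π : B
  δ : A
  σ_σ : ∀ b, σ (σ b) = b
  irreducible_π : Irreducible π
  π_sq : π ^ 2 = algebraMap A B (2 * δ)
  δ_mod : 2 ∣ δ - 1
  σ_π : σ π = -π
  G₂_eq : ∀ b, π ^ 3 ∣ σ b - b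
  G₃_eq : ∃ b, ¬ π ^ 4 ∣ σ b - b

section

variable {A B : Type*} [CommRing A] [CommRing B] [Algebra A B] (D : Case2 A B)

namespace Case2

/-- `ξ = π · σ(π)`. -/
def ξ : B := D.π * D.σ D.π

/-- `σ` as an `A`-algebra endomorphism of `B`. -/
def conj : B →ₐ[A] B := D.σ

@[simp] lemma conj_apply (b : B) : D.conj b = D.σ b := rfl

/-- The automorphism `b ⊗ r ↦ σ(b) ⊗ r` of `B ⊗_A R`. -/
def conjR (R : Type*) [CommRing R] [Algebra A R] : B ⊗[A] R →ₐ[A] B ⊗[A] R :=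
  Algebra.TensorProduct.map D.conj (AlgHom.id A R)

lemma two_dvd_π_sq : (2 : B) ∣ D.π ^ 2 := by
  rw [D.π_sq, map_mul, map_ofNat]; exact dvd_mul_right _ _

lemma two_dvd_trace (b : B) : (2 : B) ∣ b + D.σ b := by
  have h : (2 : B) ∣ D.σ b - b :=
    (D.two_dvd_π_sq.trans (pow_dvd_pow _ (by norm_num))).trans (D.G₂_eq b)
  have : b + D.σ b = 2 * b + (D.σ b - b) := by ring
  rw [this]; exact dvd_add (dvd_mul_right _ _) h

lemma four_dvd_trace (b : B) : (2 : B) ^ 2 ∣ D.π * b + D.σ (D.π * b) := by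
  have h : D.π * b + D.σ (D.π * b) = -(D.π * (D.σ b - b)) := by
    rw [map_mul, D.σ_π]; ring
  rw [h, dvd_neg]
  calc (2 : B) ^ 2 ∣ (D.π ^ 2) ^ 2 := pow_dvd_pow_of_dvd D.two_dvd_π_sq 2
    _ = D.π * D.π ^ 3 := by ring
    _ ∣ _ := mul_dvd_mul_left _ (D.G₂_eq b)

lemma σ_π_sq_pow (k : ℕ) : D.σ ((D.π ^ 2) ^ k) = (D.π ^ 2) ^ k := by
  rw [map_pow, map_pow, D.σ_π, neg_sq]

/-- If `i = 2 m` or `i = 2 m - 1`, traces of elements of `π ^ i B` are divisible by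
`2 ^ (m + 1)`. -/
lemma dvd_trace (i : ℕ) {c : B} (hc : D.π ^ i ∣ c) : (2 : B) ^ ((i + 1) / 2 + 1) ∣ c + D.σ c := by
  obtain ⟨b, rfl⟩ := hc
  rcases Nat.even_or_odd' i with ⟨k, rfl | rfl⟩
  · have h1 : (2 * k + 1) / 2 + 1 = k + 1 := by omega
    have h2 : D.π ^ (2 * k) * b + D.σ (D.π ^ (2 * k) * b) = (D.π ^ 2) ^ k * (b + D.σ b) := by
      rw [pow_mul, map_mul, D.σ_π_sq_pow]; ring
    rw [h1, h2, pow_succ]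
    exact mul_dvd_mul (pow_dvd_pow_of_dvd D.two_dvd_π_sq k) (D.two_dvd_trace b)
  · have h1 : (2 * k + 1 + 1) / 2 + 1 = k + 2 := by omega
    have h2 : D.π ^ (2 * k + 1) * b + D.σ (D.π ^ (2 * k + 1) * b) =
        (D.π ^ 2) ^ k * (D.π * b + D.σ (D.π * b)) := by
      rw [pow_succ, pow_mul, mul_assoc, map_mul, D.σ_π_sq_pow]; ring
    rw [h1, h2, pow_add]
    exact mul_dvd_mul (pow_dvd_pow_of_dvd D.two_dvd_π_sq k) (D.four_dvd_trace b)

end Case2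

/-! ### The lattices attached to a hermitian lattice -/

section Lattices

variable {D} {L : Type*} [AddCommGroup L] [Module B L] (h : HermForm (D.conj : B →+* B) L)

lemma form_add_self (x y : L) :
    h.form (x + y) (x + y) =
      h.form x x + h.form y y + (h.form x y + D.σ (h.form x y)) := by
  have : h.form y x = D.σ (h.form x y) := h.symm x y
  rw [← this]; simp only [map_add, LinearMap.add_apply]; ring

lemma form_smul_left (b : B) (x y : L) : h.form (b • x) y = D.σ b * h.form x y := by
  rw [LinearMap.map_smulₛₗ]; rfl

/-- `A_i = {x ∈ L | h (x, L) ⊆ π ^ i B}`. -/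
def latA (i : ℕ) : Submodule B L where
  carrier := {x | ∀ y, D.π ^ i ∣ h.form x y}
  zero_mem' y := by simp
  add_mem' hx hy z := by
    rw [map_add, LinearMap.add_apply]; exact dvd_add (hx z) (hy z)
  smul_mem' b x hx y := by
    rw [form_smul_left]; exact (hx y).mul_left _

/-- `X_i`, the sublattice of `A_i` such that `X_i / π A_i` is the radical of the form
`π ^ (-i) h mod π` on `A_i / π A_i`. -/
def latX (i : ℕ) : Submodule B L where
  carrier := {x | x ∈ latA h i ∧ ∀ y ∈ latA h i, D.π ^ (i + 1) ∣ h.form x y}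
  zero_mem' := ⟨zero_mem _, fun y _ => by simp⟩
  add_mem' hx hy := ⟨add_mem hx.1 hy.1, fun z hz => by
    rw [map_add, LinearMap.add_apply]; exact dvd_add (hx.2 z hz) (hy.2 z hz)⟩
  smul_mem' b x hx := ⟨Submodule.smul_mem _ _ hx.1, fun y hy => by
    rw [form_smul_left]; exact (hx.2 y hy).mul_left _⟩

/-- `B_i`, the sublattice of `A_i` such that `B_i / π A_i` is the kernel of the additive map
`x ↦ 2 ^ (-m) h (x, x) mod 2`, where `i = 2 m` or `i = 2 m - 1`, that is `m = (i + 1) / 2`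
(rounded down). -/
def latB (i : ℕ) : Submodule B L where
  carrier := {x | x ∈ latA h i ∧ (2 : B) ^ ((i + 1) / 2 + 1) ∣ h.form x x}
  zero_mem' := ⟨zero_mem _, by simp⟩
  add_mem' {x y} hx hy := ⟨add_mem hx.1 hy.1, by
    rw [form_add_self]
    exact dvd_add (dvd_add hx.2 hy.2) (D.dvd_trace i (hx.1 y))⟩
  smul_mem' b x hx := ⟨Submodule.smul_mem _ _ hx.1, by
    rw [form_smul_left, map_smul, smul_eq_mul]; exact (hx.2.mul_left _).mul_left _⟩

/-- For `i = 2 m`: the vector `e ∈ A_i` satisfies `(ξ ^ (-m) h (v, e))² = ξ ^ (-m) h (v, v)` mod `π`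
for all `v ∈ A_i` (a condition on its class in `A_i / X_i`, which it characterizes). -/
def IsChar (i : ℕ) (e : L) : Prop :=
  e ∈ latA h i ∧ ∀ v ∈ latA h i,
    D.ξ ^ (2 * (i / 2)) * D.π ∣ h.form v e ^ 2 - D.ξ ^ (i / 2) * h.form v v

/-- `W_i`: for even `i` the sublattice of `A_i` with `W_i / X_i` spanned by the class `e`
characterized by `IsChar`, and `W_i = X_i` for odd `i`. -/
def latW (i : ℕ) : Submodule B L :=
  latX h i ⊔ Submodule.span B {e | Even i ∧ IsChar h i e}

/-- `Z_i` for `i = 2 m`: the sublattice of `B_i` such that `Z_i / π B_i` is the radical of the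
quadratic form `Q = 2 ^ (-(m + 1)) h (x, x) mod 2` on `B_i / π B_i`, that is the set of zeros of `Q`
in the radical of its polar form `2 ^ (-(m + 1)) (h (x, y) + h (y, x)) mod 2`. (It is only used
for even `i`.) -/
def latZ (i : ℕ) : Submodule B L where
  carrier := {x | x ∈ latB h i ∧ (∀ y ∈ latB h i, (2 : B) ^ (i / 2 + 2) ∣ h.form x y + h.form y x) ∧
    (2 : B) ^ (i / 2 + 2) ∣ h.form x x}
  zero_mem' := ⟨zero_mem _, fun y _ => by simp, by simp⟩
  add_mem' {x y} hx hy := by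
    refine ⟨add_mem hx.1 hy.1, fun z hz => ?_, ?_⟩
    · have : h.form (x + y) z + h.form z (x + y) =
          (h.form x z + h.form z x) + (h.form y z + h.form z y) := by
        simp only [map_add, LinearMap.add_apply]; ring
      rw [this]; exact dvd_add (hx.2.1 z hz) (hy.2.1 z hz)
    · have : h.form (x + y) (x + y) =
          h.form x x + h.form y y + (h.form x y + h.form y x) := by
        simp only [map_add, LinearMap.add_apply]; ring
      rw [this]; exact dvd_add (dvd_add hx.2.2 hy.2.2) (hx.2.1 y hy.1)
  smul_mem' b x hx := by
    refine ⟨Submodule.smul_mem _ _ hx.1, fun y hy => ?_, ?_⟩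
    · have h1 : h.form (b • x) y = h.form x (D.σ b • y) := by
        rw [form_smul_left, map_smul, smul_eq_mul]
      have h2 : h.form y (b • x) = h.form (D.σ b • y) x := by
        rw [h.symm (b • x) y, h.symm x (D.σ b • y), h1]
      rw [h1, h2]; exact hx.2.1 _ (Submodule.smul_mem _ _ hy)
    · rw [form_smul_left, map_smul, smul_eq_mul]; exact (hx.2.2.mul_left _).mul_left _

variable [Module A L] [IsScalarTower A B L] (F : Type*) [Field F] [Algebra A F]

lemma extend_smul_left (b : B) (x y : L ⊗[A] F) :
    h.extend F (b • x) y = (D.σ b ⊗ₜ[A] (1 : F)) * h.extend F x y := by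
  induction x using TensorProduct.induction_on with
  | zero => simp
  | add x x' hx hx' => rw [smul_add, map_add, LinearMap.add_apply, hx, hx', map_add,
      LinearMap.add_apply, mul_add]
  | tmul x a =>
    induction y using TensorProduct.induction_on with
    | zero => simp
    | add y y' hy hy' => rw [map_add, hy, hy', map_add, mul_add]
    | tmul y c => simp [HermForm.extend, TensorProduct.smul_tmul']

/-- The dual `N^⊥ = {x ∈ V | h (x, N) ⊆ B}` in `V = L ⊗_A F` of a sublattice `N` of `L`; the form
`h` on `V` has values in `E = B ⊗_A F`. -/
def dualLat (N : Submodule B L) : Submodule B (L ⊗[A] F) where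
  carrier := {x | ∀ y ∈ N, ∃ c : B, h.extend F x (y ⊗ₜ[A] (1 : F)) = c ⊗ₜ[A] (1 : F)}
  zero_mem' y _ := ⟨0, by simp⟩
  add_mem' {x x'} hx hx' y hy := by
    obtain ⟨c, hc⟩ := hx y hy
    obtain ⟨c', hc'⟩ := hx' y hy
    exact ⟨c + c', by rw [map_add, LinearMap.add_apply, hc, hc', TensorProduct.add_tmul]⟩
  smul_mem' b x hx y hy := by
    obtain ⟨c, hc⟩ := hx y hy
    exact ⟨D.σ b * c, by rw [extend_smul_left, hc, Algebra.TensorProduct.tmul_mul_tmul, one_mul]⟩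

lemma dualLat_anti {N N' : Submodule B L} (hN : N ≤ N') : dualLat h F N' ≤ dualLat h F N :=
  fun _ hx y hy => hx y (hN hy)

end Lattices

/-! ### Base change to an `A`-algebra `R` -/

section BaseChange

variable {D} {L : Type*} [AddCommGroup L] [Module B L] (h : HermForm (D.conj : B →+* B) L)
variable (A) (R : Type*) [CommRing R] [Algebra A R]

/-- `L ⊗_A R` as a module over `B ⊗_A R`, that is `(B ⊗_A R) ⊗_B L`.  For a sublattice `N` of `L`,
`N ⊗_A R` is then the submodule `N.baseChange (B ⊗[A] R)`. -/
abbrev LR (B : Type*) [CommRing B] [Algebra A B] (L : Type*) [AddCommGroup L] [Module B L]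
    (R : Type*) [CommRing R] [Algebra A R] : Type _ := (B ⊗[A] R) ⊗[B] L

variable {A}

/-- Auxiliary for the base change of `h`: the linear form `d ⊗ y ↦ h (x, y) d`. -/
def formRAux (x : L) : LR A B L R →ₗ[B ⊗[A] R] B ⊗[A] R :=
  (TensorProduct.AlgebraTensorModule.rid B (B ⊗[A] R) (B ⊗[A] R)).toLinearMap ∘ₗ
    (h.form x).baseChange (B ⊗[A] R)

lemma formRAux_tmul (x : L) (d : B ⊗[A] R) (y : L) :
    formRAux h R x (d ⊗ₜ y) = h.form x y • d := by
  simp [formRAux]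

lemma conjR_smul (b : B) (c : B ⊗[A] R) : D.conjR R (b • c) = D.σ b • D.conjR R c := by
  rw [Algebra.smul_def, map_mul, Algebra.smul_def]
  exact congrArg (· * _) <| (Algebra.TensorProduct.map_tmul _ _ _ _).trans (by rw [map_one]; rfl)

lemma conjR_conjR (z : B ⊗[A] R) : D.conjR R (D.conjR R z) = z := by
  induction z with
  | zero => simp
  | add z z' hz hz' => rw [map_add, map_add, hz, hz']
  | tmul b r => simp [Case2.conjR, D.σ_σ]

/-- Auxiliary for the base change of `h`: the map `c ⊗ x ↦ (d ⊗ y ↦ σ(c) h (x, y) d)`. -/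
def formRAux₂ : LR A B L R →ₛₗ[(D.conj : B →+* B)] (LR A B L R →ₗ[B ⊗[A] R] B ⊗[A] R) :=
  TensorProduct.lift
    (LinearMap.mk₂'ₛₗ (D.conj : B →+* B) (D.conj : B →+* B)
      (fun c x => D.conjR R c • formRAux h R x)
      (fun c c' x => by rw [map_add, add_smul])
      (fun b c x => by
        rw [conjR_smul, smul_assoc]; rfl)
      (fun c x x' => by
        rw [← smul_add]; congr 1
        refine TensorProduct.AlgebraTensorModule.ext fun d y => ?_
        simp [formRAux_tmul, add_smul])
      (fun b c x => by
        rw [smul_comm]; congr 1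
        refine TensorProduct.AlgebraTensorModule.ext fun d y => ?_
        simp [formRAux_tmul, mul_smul]))

lemma formRAux₂_tmul (c d : B ⊗[A] R) (x y : L) :
    formRAux₂ h R (c ⊗ₜ x) (d ⊗ₜ y) = D.conjR R c * (h.form x y • d) := by
  simp [formRAux₂, formRAux_tmul]

/-- The base change of `h`: the hermitian form on `L ⊗_A R` with values in `B ⊗_A R` with
`h (c ⊗ x, d ⊗ y) = σ(c) h (x, y) d`. -/
def formR : HermForm (D.conjR R : B ⊗[A] R →+* B ⊗[A] R) (LR A B L R) where
  form :=
    { toFun := formRAux₂ h R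
      map_add' := map_add _
      map_smul' := fun c x => by
        induction x using TensorProduct.induction_on with
        | zero => simp
        | add x x' hx hx' => rw [smul_add, map_add, hx, hx', map_add, smul_add]
        | tmul c' x =>
          refine TensorProduct.AlgebraTensorModule.ext fun d y => ?_
          rw [TensorProduct.smul_tmul', formRAux₂_tmul, LinearMap.smul_apply, formRAux₂_tmul]
          simp [mul_assoc] }
  symm x y := by
    change formRAux₂ h R y x = D.conjR R (formRAux₂ h R x y)
    induction x using TensorProduct.induction_on with
    | zero => simp
    | add x x' hx hx' => rw [map_add, hx, hx', map_add, LinearMap.add_apply, map_add]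
    | tmul c x =>
      induction y using TensorProduct.induction_on with
      | zero => simp
      | add y y' hy hy' => rw [map_add, LinearMap.add_apply, hy, hy', map_add, map_add]
      | tmul d y =>
        rw [formRAux₂_tmul, formRAux₂_tmul, map_mul, conjR_smul, conjR_conjR, h.symm x y]
        simp only [Algebra.smul_def]
        change _ * (algebraMap _ _ (D.σ _) * _) = _
        ring

lemma formR_tmul (c d : B ⊗[A] R) (x y : L) :
    (formR h R).form (c ⊗ₜ x) (d ⊗ₜ y) = D.conjR R c * (h.form x y • d) :=
  formRAux₂_tmul h R c d x y

end BaseChange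

/-! ### The functors `M`, `M*` and `H` -/

set_option linter.unusedSectionVars false

section Functors

variable {D} {L : Type*} [AddCommGroup L] [Module B L] (h : HermForm (D.conj : B →+* B) L)
variable [Module A L] [IsScalarTower A B L] (F : Type*) [Field F] [Algebra A F]
variable (R : Type*) [CommRing R] [Algebra A R]

/-- The image of `N ⊗_A R` in `V ⊗_A R = (L ⊗_A R) ⊗_A F`, for a lattice `N` in `V = L ⊗_A F`: the
`B ⊗_A R`-submodule generated by the image of `N` under the map `l ⊗ a ↦ (1 ⊗ l) ⊗ a`. -/
def latVR (N : Submodule B (L ⊗[A] F)) : Submodule (B ⊗[A] R) (LR A B L R ⊗[A] F) :=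
  Submodule.span (B ⊗[A] R)
    (LinearMap.rTensor F ((TensorProduct.mk B (B ⊗[A] R) L 1).restrictScalars A) '' N)

/-- The extension to `V ⊗_A R = (L ⊗_A R) ⊗_A F` of an endomorphism `m` of `L ⊗_A R`. -/
def endV (m : Module.End (B ⊗[A] R) (LR A B L R)) :
    Module.End (B ⊗[A] R) (LR A B L R ⊗[A] F) :=
  TensorProduct.AlgebraTensorModule.map m LinearMap.id

/-- The conditions defining `M(R)`, for an endomorphism `m` of the `B ⊗_A R`-module `L ⊗_A R`. -/
structure MCond (m : Module.End (B ⊗[A] R) (LR A B L R)) : Prop where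
  stabA : ∀ i, ∀ x ∈ (latA h i).baseChange (B ⊗[A] R), m x ∈ (latA h i).baseChange (B ⊗[A] R)
  stabB : ∀ i, ∀ x ∈ (latB h i).baseChange (B ⊗[A] R), m x ∈ (latB h i).baseChange (B ⊗[A] R)
  stabW : ∀ i, ∀ x ∈ (latW h i).baseChange (B ⊗[A] R), m x ∈ (latW h i).baseChange (B ⊗[A] R)
  stabX : ∀ i, ∀ x ∈ (latX h i).baseChange (B ⊗[A] R), m x ∈ (latX h i).baseChange (B ⊗[A] R)
  stabZ : ∀ i, Even i →
    ∀ x ∈ (latZ h i).baseChange (B ⊗[A] R), m x ∈ (latZ h i).baseChange (B ⊗[A] R)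
  /-- `m` induces the identity on `A_i / B_i`. -/
  idAB : ∀ i, ∀ x ∈ (latA h i).baseChange (B ⊗[A] R),
    m x - x ∈ (latB h i).baseChange (B ⊗[A] R)
  /-- `m` induces the identity on `W_i / (X_i ∩ Z_i)` for even `i`. -/
  idWXZ : ∀ i, Even i → ∀ x ∈ (latW h i).baseChange (B ⊗[A] R),
    m x - x ∈ (latX h i ⊓ latZ h i).baseChange (B ⊗[A] R)
  /-- `m` induces the identity on `B_i^⊥ / A_i^⊥` for odd `i`. -/
  idDual : ∀ i, Odd i → ∀ x ∈ latVR F R (dualLat h F (latB h i)),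
    endV F R m x - x ∈ latVR F R (dualLat h F (latA h i))

lemma id_on_quotient_mul {C N : Type*} [CommRing C] [AddCommGroup N] [Module C N]
    (g g' : Module.End C N) (P Q : Submodule C N) (hQP : Q ≤ P)
    (hg : ∀ x ∈ P, g x - x ∈ Q) (hg' : ∀ x ∈ P, g' x - x ∈ Q) :
    ∀ x ∈ P, (g * g') x - x ∈ Q := by
  intro x hx
  have h1 : g' x ∈ P := by
    have := P.add_mem (hQP (hg' x hx)) hx
    rwa [sub_add_cancel] at this
  have := Q.add_mem (hg _ h1) (hg' x hx)
  rwa [sub_add_sub_cancel] at this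

lemma baseChange_mono {P Q : Submodule B L} (hPQ : P ≤ Q) :
    P.baseChange (B ⊗[A] R) ≤ Q.baseChange (B ⊗[A] R) := by
  rw [Submodule.baseChange_eq_span, Submodule.baseChange_eq_span]
  exact Submodule.span_mono (Submodule.map_mono hPQ)

lemma latVR_mono {P Q : Submodule B (L ⊗[A] F)} (hPQ : P ≤ Q) : latVR F R P ≤ latVR F R Q :=
  Submodule.span_mono (Set.image_mono hPQ)

lemma endV_one : endV F R (1 : Module.End (B ⊗[A] R) (LR A B L R)) = 1 :=
  TensorProduct.AlgebraTensorModule.map_id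

lemma endV_mul (m m' : Module.End (B ⊗[A] R) (LR A B L R)) :
    endV F R (m * m') = endV F R m * endV F R m' :=
  TensorProduct.AlgebraTensorModule.map_mul m m' LinearMap.id LinearMap.id

lemma latB_le_latA (i : ℕ) : latB h i ≤ latA h i := fun _ hx => hx.1

lemma inf_le_latW (i : ℕ) : latX h i ⊓ latZ h i ≤ latW h i := inf_le_left.trans le_sup_left

lemma MCond.one : MCond h F R 1 where
  stabA _ _ hx := hx
  stabB _ _ hx := hx
  stabW _ _ hx := hx
  stabX _ _ hx := hx
  stabZ _ _ _ hx := hx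
  idAB _ x _ := by rw [Module.End.one_apply, sub_self]; exact zero_mem _
  idWXZ _ _ x _ := by rw [Module.End.one_apply, sub_self]; exact zero_mem _
  idDual _ _ x _ := by rw [endV_one, Module.End.one_apply, sub_self]; exact zero_mem _

lemma MCond.mul {m m' : Module.End (B ⊗[A] R) (LR A B L R)} (hm : MCond h F R m)
    (hm' : MCond h F R m') : MCond h F R (m * m') where
  stabA i x hx := by
    rw [Module.End.mul_apply]; exact hm.stabA i _ (hm'.stabA i x hx)
  stabB i x hx := by
    rw [Module.End.mul_apply]; exact hm.stabB i _ (hm'.stabB i x hx)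
  stabW i x hx := by
    rw [Module.End.mul_apply]; exact hm.stabW i _ (hm'.stabW i x hx)
  stabX i x hx := by
    rw [Module.End.mul_apply]; exact hm.stabX i _ (hm'.stabX i x hx)
  stabZ i hi x hx := by
    rw [Module.End.mul_apply]; exact hm.stabZ i hi _ (hm'.stabZ i hi x hx)
  idAB i := id_on_quotient_mul m m' _ _ (baseChange_mono R (latB_le_latA h i))
    (hm.idAB i) (hm'.idAB i)
  idWXZ i hi := id_on_quotient_mul m m' _ _ (baseChange_mono R (inf_le_latW h i))
    (hm.idWXZ i hi) (hm'.idWXZ i hi)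
  idDual i hi := by
    intro x hx
    have h1 := id_on_quotient_mul (C := B ⊗[A] R) (N := LR A B L R ⊗[A] F) _ _ _ _
      (latVR_mono F R (dualLat_anti h F (latB_le_latA h i))) (hm.idDual i hi) (hm'.idDual i hi)
      x hx
    rw [endV_mul F R m m']
    exact h1

/-- The monoid `M(R)`. -/
def M : Submonoid (Module.End (B ⊗[A] R) (LR A B L R)) where
  carrier := {m | MCond h F R m}
  one_mem' := MCond.one h F R
  mul_mem' hm hm' := hm.mul h F R hm'

/-- The group `M*(R)` of invertible elements of the monoid `M(R)`. -/
abbrev MStar : Type _ := (M h F R)ˣ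

/-- The conditions defining `H(R)`, for a hermitian form `f` on `L ⊗_A R` with values in
`B ⊗_A R`.  Here `m = (i + 1) / 2` (rounded down), that is `i = 2 m` or `i = 2 m - 1`.  In (e) the
forms are extended to `V ⊗_A R`, with values in `E ⊗_A R = (B ⊗_A R) ⊗_A F`. -/
structure HCond (f : HermForm (D.conjR R : B ⊗[A] R →+* B ⊗[A] R) (LR A B L R)) : Prop where
  /-- (a) `f (L, A_i) ⊆ (π ^ i)`. -/
  condA : ∀ i, ∀ x, ∀ a ∈ (latA h i).baseChange (B ⊗[A] R),
    (D.π ^ i) ⊗ₜ[A] (1 : R) ∣ f.form x a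
  /-- (b) `ξ ^ (-m) f (a, a) ≡ ξ ^ (-m) h (a, a) mod 2` for `a ∈ A_i`. -/
  condB : ∀ i, ∀ a ∈ (latA h i).baseChange (B ⊗[A] R),
    (D.ξ ^ ((i + 1) / 2) * 2) ⊗ₜ[A] (1 : R) ∣ f.form a a - (formR h R).form a a
  /-- (c) `π ^ (-i) f (a, w) ≡ π ^ (-i) h (a, w) mod π` for `a ∈ A_i`, `w ∈ W_i`, `i` even. -/
  condC : ∀ i, Even i → ∀ a ∈ (latA h i).baseChange (B ⊗[A] R),
    ∀ w ∈ (latW h i).baseChange (B ⊗[A] R),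
      (D.π ^ (i + 1)) ⊗ₜ[A] (1 : R) ∣ f.form a w - (formR h R).form a w
  /-- (d) `ξ ^ (-m) f (w, w) - ξ ^ (-m) h (w, w) ∈ (4)` for `w ∈ W_i`, `i = 2 m`. -/
  condD : ∀ i, Even i → ∀ w ∈ (latW h i).baseChange (B ⊗[A] R),
    (D.ξ ^ (i / 2) * 4) ⊗ₜ[A] (1 : R) ∣ f.form w w - (formR h R).form w w
  /-- (e), first part: `f (B_i, B_i^⊥) ⊆ B ⊗ R` for odd `i`. -/
  condE₁ : ∀ i, Odd i → ∀ b ∈ (latB h i).baseChange (B ⊗[A] R),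
    ∀ b' ∈ latVR F R (dualLat h F (latB h i)),
      ∃ c : B ⊗[A] R, f.extend F (b ⊗ₜ[A] (1 : F)) b' = c ⊗ₜ[A] (1 : F)
  /-- (e), second part: `f (a, b') - h (a, b') ∈ B ⊗ R` for `a ∈ A_i`, `b' ∈ B_i^⊥`, `i` odd. -/
  condE₂ : ∀ i, Odd i → ∀ a ∈ (latA h i).baseChange (B ⊗[A] R),
    ∀ b' ∈ latVR F R (dualLat h F (latB h i)),
      ∃ c : B ⊗[A] R, f.extend F (a ⊗ₜ[A] (1 : F)) b' -
        (formR h R).extend F (a ⊗ₜ[A] (1 : F)) b' = c ⊗ₜ[A] (1 : F)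

/-- The set `H(R)`. -/
def H : Type _ :=
  {f : HermForm (D.conjR R : B ⊗[A] R →+* B ⊗[A] R) (LR A B L R) // HCond h F R f}

variable {R} {R' : Type*} [CommRing R'] [Algebra A R']

variable (B L) in
/-- The map `L ⊗_A R → L ⊗_A R'` induced by `φ : R → R'`. -/
def mapLR (φ : R →ₐ[A] R') : LR A B L R →ₗ[B] LR A B L R' :=
  LinearMap.rTensor L (Algebra.TensorProduct.map (AlgHom.id B B) φ).toLinearMap

/-- `m'` is the image of `m` under `M*(R) → M*(R')`: it restricts to `m` on `L ⊗_A R`. -/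
def MStarRes (φ : R →ₐ[A] R') (m : MStar h F R) (m' : MStar h F R') : Prop :=
  ∀ x, m'.1.1 (mapLR B L φ x) = mapLR B L φ (m.1.1 x)

/-- `f'` is the image of `f` under `H(R) → H(R')`: it restricts to `f` on `L ⊗_A R`. -/
def HRes (φ : R →ₐ[A] R') (f : H h F R) (f' : H h F R') : Prop :=
  ∀ x y, f'.1.form (mapLR B L φ x) (mapLR B L φ y) =
    Algebra.TensorProduct.map (AlgHom.id A B) φ (f.1.form x y)

end Functors

end

/-! ### Flat affine schemes representing functors on flat algebras -/

section Schemes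

variable (A : Type u) [CommRing A]

/-- `Spec R` as a scheme over `Spec A`. -/
def specOver (R : Type u) [CommRing R] [Algebra A R] : Over (Spec (.of A)) :=
  Over.mk (Spec.map (CommRingCat.ofHom (algebraMap A R)))

variable {A} in
/-- The morphism `Spec R' → Spec R` over `Spec A` given by `φ : R → R'`. -/
def specOverMap {R R' : Type u} [CommRing R] [Algebra A R] [CommRing R'] [Algebra A R']
    (φ : R →ₐ[A] R') : specOver A R' ⟶ specOver A R :=
  Over.homMk (Spec.map (CommRingCat.ofHom φ.toRingHom)) (by
    simp only [specOver, Over.mk_hom, ← Spec.map_comp, ← CommRingCat.ofHom_comp]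
    congr 2
    exact φ.comp_algebraMap)

/-- A flat affine `A`-scheme `X` representing a functor `P` on flat `A`-algebras, with
bijections `X(R) ≃ P(R)` natural in the flat `A`-algebra `R`.  The functoriality of `P` is given by
the relation `res φ p p'`, meaning that `p'` is the image of `p` under `φ`. -/
structure FlatModel (P : ∀ (R : Type u) [CommRing R] [Algebra A R], Type v)
    (res : ∀ {R R' : Type u} [CommRing R] [Algebra A R] [CommRing R'] [Algebra A R'],
      (R →ₐ[A] R') → P R → P R' → Prop) where
  X : Over (Spec (.of A))
  affine : IsAffine X.left
  flat : Flat X.hom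
  pts : ∀ (R : Type u) [CommRing R] [Algebra A R] [Module.Flat A R], (specOver A R ⟶ X) ≃ P R
  natural : ∀ {R R' : Type u} [CommRing R] [Algebra A R] [Module.Flat A R]
    [CommRing R'] [Algebra A R'] [Module.Flat A R'] (φ : R →ₐ[A] R') (p : specOver A R ⟶ X),
    res φ (pts R p) (pts R' (specOverMap φ ≫ p))

end Schemes

section

variable {A : Type u} {B : Type*} [CommRing A] [CommRing B] [Algebra A B] {D : Case2 A B}
variable {L : Type*} [AddCommGroup L] [Module B L] (h : HermForm (D.conj : B →+* B) L)
variable [Module A L] [IsScalarTower A B L] (F : Type*) [Field F] [Algebra A F]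

/-- Flat affine `A`-schemes representing the functor `M*`. -/
abbrev MStarModel := FlatModel A (fun R _ _ => MStar h F R) (MStarRes h F)

/-- Flat affine `A`-schemes representing the functor `H`. -/
abbrev HModel := FlatModel A (fun R _ _ => H h F R) (HRes h F)

end

end RamifiedHermitian
end

set_option linter.unusedSectionVars false

namespace RamifiedHermitian

/-! ### Submodules under flat base change -/

section FlatBaseChange

variable {A : Type*} [CommRing A] {E T : Type*} [AddCommGroup E] [Module A E]
  [AddCommGroup T] [Module A T] (R : Type*) [CommRing R] [Algebra A R]

/-! The action. Let `f` lie in `H(R)` and `m` in `M(R)`. In a congruence for `f ∘ m`, the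
corresponding condition on `f` at `mx` and `my` (which stay in the same lattices) replaces `f(mx,
my)` by `h(mx, my)`. The remaining difference `h(mx, my) - h(x, y)` is small because `m - 1` carries
`A_i` into `B_i`, `W_i` into `X_i ∩ Z_i` for even `i`, and `B_i^⊥` into `A_i^⊥` for odd `i`. Two
facts measure it: traces from `π^i B` gain powers of 2 (`Case2.dvd_trace`, where the ramification
enters), and for even `i` the lattices `B_i` and `W_i` pair into `π^(i+1) B`
(`π_pow_dvd_form_latB_latW`). The result is `HCond.comp`.

Representability. The conditions are linear in `n = m - 1` and, once they are tested on generators,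
linear in `g = f - h`. Over `A` they cut out a submodule `S` of `End_B L`, and a submodule `S'` of
the module of Gram matrices. Flat base change commutes with preimages and with finite intersections.
The infinitely many conditions reduce to finitely many: nondegeneracy gives `d ≠ 0` in `A` such that
every `4d²` multiple satisfies all of them except hermitian symmetry, and a finite module modulo
`4d²` is Artinian. Hence `M(R) = 1 + S ⊗ R` and `H(R) = h + S' ⊗ R` for flat `R` (`endCond_iff`,
`gramCond_iff`). As `A` is a principal ideal domain, `S` and `S'` are free. So `H` is an affine
space, and `M*` is the open part of an affine space where the determinant of left multiplication by
`1 + x` on `S ⊗ R` is invertible (`exists_inverse_iff_isUnit`).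

Group scheme and action. Products of flat affine schemes are flat affine, so the multiplication and
the action can be read off from universal points on `G × G` and `H × G`, and their identities hold
because they hold for universal points (`FlatModel.exists_grpObj_action`). -/

lemma map_mkQ_baseChange_eq_zero (Q : Submodule A T) {y : R ⊗[A] T} (hy : y ∈ Q.baseChange R) :
    Q.mkQ.lTensor R y = 0 := by
  obtain ⟨z, rfl⟩ := hy
  rw [LinearMap.baseChange_eq_ltensor, ← LinearMap.comp_apply, ← LinearMap.lTensor_comp]
  have : Q.mkQ ∘ₗ Q.subtype = 0 := by ext x; simp
  rw [this, LinearMap.lTensor_zero, LinearMap.zero_apply]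

/-- Preimages of submodules commute with flat base change. -/
lemma mem_baseChange_comap [Module.Flat A R] (φ : E →ₗ[A] T) (Q : Submodule A T) {y : R ⊗[A] E}
    (hy : φ.lTensor R y ∈ Q.baseChange R) : y ∈ (Q.comap φ).baseChange R := by
  -- The preimage of `Q` is the kernel of `E → T → T/Q`, and flatness preserves this exact sequence.
  have hex : Function.Exact (Q.comap φ).subtype (Q.mkQ ∘ₗ φ) := by
    intro x
    simp
  have h := Module.Flat.lTensor_exact R hex
  have h0 : (Q.mkQ ∘ₗ φ).lTensor R y = 0 := by
    rw [LinearMap.lTensor_comp, LinearMap.comp_apply]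
    exact map_mkQ_baseChange_eq_zero R Q hy
  obtain ⟨z, hz⟩ := (h y).1 h0
  exact ⟨z, by rw [LinearMap.baseChange_eq_ltensor, hz]⟩

lemma lTensor_mem_baseChange (φ : E →ₗ[A] T) {P : Submodule A E} {Q : Submodule A T}
    (hPQ : ∀ x ∈ P, φ x ∈ Q) {y : R ⊗[A] E} (hy : y ∈ P.baseChange R) :
    φ.lTensor R y ∈ Q.baseChange R := by
  obtain ⟨z, rfl⟩ := hy
  refine ⟨(φ.restrict hPQ).lTensor R z, ?_⟩
  rw [LinearMap.baseChange_eq_ltensor, LinearMap.baseChange_eq_ltensor, ← LinearMap.comp_apply,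
    ← LinearMap.comp_apply, ← LinearMap.lTensor_comp, ← LinearMap.lTensor_comp]
  rfl

/-- The intersection is the preimage of `S'` under the inclusion of `S`, so this is an instance of
the compatibility with preimages. -/
lemma mem_baseChange_inf [Module.Flat A R] {S S' : Submodule A E} {y : R ⊗[A] E}
    (hy : y ∈ S.baseChange R) (hy' : y ∈ S'.baseChange R) : y ∈ (S ⊓ S').baseChange R := by
  obtain ⟨z, rfl⟩ := hy
  have hz : z ∈ (S'.comap S.subtype).baseChange R := by
    refine mem_baseChange_comap R S.subtype S' ?_
    rwa [LinearMap.baseChange_eq_ltensor] at hy'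
  have := lTensor_mem_baseChange R S.subtype (Q := S ⊓ S') (fun x hx => ⟨x.2, hx⟩) hz
  rwa [LinearMap.baseChange_eq_ltensor]

lemma mem_baseChange_finset_inf [Module.Flat A R] {ι : Type*} (t : Finset ι)
    (S : ι → Submodule A E) {y : R ⊗[A] E} (hy : ∀ i, y ∈ (S i).baseChange R) :
    y ∈ (t.inf S).baseChange R := by
  classical
  induction t using Finset.induction_on with
  | empty => simp
  | insert a t ha ih =>
    rw [Finset.inf_insert]
    exact mem_baseChange_inf R (hy a) ih

variable [IsDomain A] [IsPrincipalIdealRing A] [Module.Finite A E]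

/-- Over a principal ideal domain, if all members of a family of submodules contain `c E` for some
`c ≠ 0`, their intersection is already the intersection of finitely many of them. -/
lemma exists_finset_inf_eq {ι : Type*} (S : ι → Submodule A E) {c : A} (hc : c ≠ 0)
    (hS : ∀ i x, c • x ∈ S i) : ∃ t : Finset ι, t.inf S = ⨅ i, S i := by
  let N : Submodule A E := LinearMap.range (LinearMap.lsmul A E c)
  have hN : ∀ i, N ≤ S i := by
    rintro i _ ⟨x, rfl⟩
    exact hS i x
  -- `E/cE` is a quotient of a finite power of `A/c`, which has finite length because `c ≠ 0`. In an
  -- Artinian module every intersection is already a finite one.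
  have hArt : IsArtinian A (E ⧸ N) := by
    have h1 := (isFiniteLength_iff_isNoetherian_isArtinian.1
      (isFiniteLength_quotient_span_singleton A (mem_nonZeroDivisors_of_ne_zero hc))).2
    obtain ⟨n, f, hf⟩ := Module.Finite.exists_fin' A (E ⧸ N)
    let I : Ideal A := Ideal.span {c}
    let g : (Fin n → A ⧸ I) →ₗ[A] E ⧸ N :=
      (LinearMap.lsum A (fun _ => A ⧸ I) A) fun i =>
        Submodule.liftQ I (LinearMap.toSpanSingleton A _ (f (Pi.single i 1))) (by
          rw [Ideal.span_le, Set.singleton_subset_iff]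
          change c • f (Pi.single i 1) = 0
          obtain ⟨x, hx⟩ := N.mkQ_surjective (f (Pi.single i 1))
          rw [← hx, ← map_smul]
          exact (Submodule.Quotient.mk_eq_zero N).2 ⟨x, rfl⟩)
    have hg : Function.Surjective g := by
      intro y
      obtain ⟨v, rfl⟩ := hf y
      refine ⟨fun i => I.mkQ (v i), ?_⟩
      conv_rhs => rw [pi_eq_sum_univ' v, map_sum]
      simp only [g, LinearMap.lsum_apply, LinearMap.sum_apply, LinearMap.comp_apply,
        LinearMap.proj_apply]
      refine Finset.sum_congr rfl fun i _ => ?_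
      rw [map_smul]
      rfl
    exact isArtinian_of_surjective _ g hg
  obtain ⟨t, ht⟩ := Finset.exists_inf_eq_iInf (fun i => (S i).map N.mkQ)
  -- Membership in `S i` can be tested modulo `N = cE`, since `N` lies in `S i`.
  refine ⟨t, le_antisymm (le_iInf fun i x hx => ?_) ?_⟩
  · have h1 : N.mkQ x ∈ t.inf fun i => (S i).map N.mkQ := by
      rw [Finset.inf_eq_iInf]
      simp only [Submodule.mem_iInf]
      intro j hj
      exact Submodule.mem_map_of_mem ((Finset.inf_le hj : t.inf S ≤ S j) hx)
    rw [ht, Submodule.mem_iInf] at h1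
    obtain ⟨z, hz, hzx⟩ := h1 i
    have : x - z ∈ N := (Submodule.Quotient.eq N).1 hzx.symm
    have := (S i).add_mem (hN i this) hz
    rwa [sub_add_cancel] at this
  · exact Finset.le_inf fun i _ => iInf_le S i

/-- Intersections commute with flat base change, if all but one of the submodules contain a common
`c E` with `c ≠ 0`. -/
lemma mem_baseChange_inf_iInf [Module.Flat A R] {ι : Type*} (S₀ : Submodule A E)
    (S : ι → Submodule A E) {c : A} (hc : c ≠ 0) (hS : ∀ i x, c • x ∈ S i) {y : R ⊗[A] E}
    (hy₀ : y ∈ S₀.baseChange R) (hy : ∀ i, y ∈ (S i).baseChange R) :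
    y ∈ (S₀ ⊓ ⨅ i, S i).baseChange R := by
  obtain ⟨t, ht⟩ := exists_finset_inf_eq S hc hS
  rw [← ht]
  exact mem_baseChange_inf R hy₀ (mem_baseChange_finset_inf R t S hy)

end FlatBaseChange

noncomputable section

/-! ### Spectra and flat affine schemes over `Spec A` -/

section SpecOver

variable {A : Type u} [CommRing A]

lemma exists_specOverMap {R S : Type u} [CommRing R] [Algebra A R] [CommRing S] [Algebra A S]
    (p : specOver A R ⟶ specOver A S) : ∃ φ : S →ₐ[A] R, specOverMap φ = p := by
  obtain ⟨f, hf⟩ := Spec.map_surjective p.left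
  have hw := Over.w p
  simp only [specOver, Over.mk_hom, ← hf, ← Spec.map_comp] at hw
  have hw' := Spec.map_injective hw
  refine ⟨{ f.hom with commutes' := fun a => ?_ }, ?_⟩
  · exact congr($(hw').hom a)
  · ext1
    exact hf

lemma specOverMap_injective {R S : Type u} [CommRing R] [Algebra A R] [CommRing S] [Algebra A S] :
    Function.Injective (specOverMap : (S →ₐ[A] R) → (specOver A R ⟶ specOver A S)) := by
  intro φ ψ h
  have h1 := congrArg CommaMorphism.left h
  have h2 := Spec.map_injective h1
  ext x
  exact congr($(h2).hom x)

lemma specOverMap_comp {R R' S : Type u} [CommRing R] [Algebra A R] [CommRing R'] [Algebra A R']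
    [CommRing S] [Algebra A S] (φ : R →ₐ[A] R') (ψ : S →ₐ[A] R) :
    specOverMap (φ.comp ψ) = specOverMap φ ≫ specOverMap ψ := by
  ext1
  exact Spec.map_comp (CommRingCat.ofHom ψ.toRingHom) (CommRingCat.ofHom φ.toRingHom)

/-- Morphisms between spectra over `Spec A` are homomorphisms of `A`-algebras. -/
def specOverEquiv (R S : Type u) [CommRing R] [Algebra A R] [CommRing S] [Algebra A S] :
    (S →ₐ[A] R) ≃ (specOver A R ⟶ specOver A S) :=
  Equiv.ofBijective specOverMap ⟨specOverMap_injective, exists_specOverMap⟩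

variable (A) in
lemma flat_specOver (R : Type u) [CommRing R] [Algebra A R] [Module.Flat A R] :
    Flat (specOver A R).hom := by
  exact Flat.SpecMap_iff.2 (RingHom.flat_algebraMap_iff.2 ‹_›)

/-- The spectrum of a flat `A`-algebra `S` as a `FlatModel`, from natural bijections between
`S →ₐ[A] R` and `P R` for flat `R`. -/
def FlatModel.ofAlgHomEquiv {P : ∀ (R : Type u) [CommRing R] [Algebra A R], Type v}
    {res : ∀ {R R' : Type u} [CommRing R] [Algebra A R] [CommRing R'] [Algebra A R'],
      (R →ₐ[A] R') → P R → P R' → Prop} (S : Type u) [CommRing S] [Algebra A S] [Module.Flat A S]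
    (e : ∀ (R : Type u) [CommRing R] [Algebra A R] [Module.Flat A R], (S →ₐ[A] R) ≃ P R)
    (he : ∀ {R R' : Type u} [CommRing R] [Algebra A R] [Module.Flat A R]
      [CommRing R'] [Algebra A R'] [Module.Flat A R'] (φ : R →ₐ[A] R') (g : S →ₐ[A] R),
      res φ (e R g) (e R' (φ.comp g))) : FlatModel A P res where
  X := specOver A S
  affine := inferInstanceAs (IsAffine (Spec _))
  flat := flat_specOver A S
  pts R _ _ _ := (specOverEquiv R S).symm.trans (e R)
  natural φ p := by
    obtain ⟨g, rfl⟩ := (specOverEquiv _ S).surjective p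
    have : specOverMap φ ≫ (specOverEquiv _ S) g = specOverEquiv _ S (φ.comp g) :=
      (specOverMap_comp φ g).symm
    simp only [this, Equiv.trans_apply, Equiv.symm_apply_apply]
    exact he φ g

/-- Flat affine schemes over `Spec A`. -/
class IsFlatAffine (T : Over (Spec (.of A))) : Prop where
  affine : IsAffine T.left
  flat : Flat T.hom

instance (R : Type u) [CommRing R] [Algebra A R] [Module.Flat A R] :
    IsFlatAffine (specOver A R) :=
  ⟨inferInstanceAs (IsAffine (Spec _)), flat_specOver A R⟩

/-- This closure property lets universal pairs and triples of points serve as test objects, although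
the functors are only controlled on flat algebras. -/
instance (T T' : Over (Spec (.of A))) [hT : IsFlatAffine T] [hT' : IsFlatAffine T'] :
    IsFlatAffine (T ⊗ T') := by
  have := hT.affine
  have := hT'.affine
  have := hT.flat
  have := hT'.flat
  refine ⟨?_, ?_⟩
  · change IsAffine (Limits.pullback T.hom T'.hom)
    infer_instance
  · change Flat (Limits.pullback.fst T.hom T'.hom ≫ T.hom)
    infer_instance

instance : IsFlatAffine (𝟙_ (Over (Spec (.of A)))) := by
  refine ⟨?_, ?_⟩
  · change IsAffine (Spec (.of A))
    infer_instance
  · change Flat (𝟙 (Spec (.of A)))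
    infer_instance

/-- The ring is that of global sections, with the `A`-algebra structure given by the structure
morphism. -/
lemma IsFlatAffine.exists_iso (T : Over (Spec (.of A))) [hT : IsFlatAffine T] :
    ∃ (R : Type u) (_ : CommRing R) (_ : Algebra A R) (_ : Module.Flat A R),
      Nonempty (specOver A R ≅ T) := by
  have := hT.affine
  have inv_flat : Flat T.left.isoSpec.inv := inferInstance
  obtain ⟨f, hf⟩ := Spec.map_surjective (T.left.isoSpec.inv ≫ T.hom)
  let R : Type u := Γ(T.left, ⊤)
  let alg : Algebra A R := f.hom.toAlgebra
  have hs : (specOver A R).hom = T.left.isoSpec.inv ≫ T.hom := hf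
  have hflat : Flat (specOver A R).hom := by
    rw [hs]
    exact Flat.comp (hf := inv_flat) (hg := hT.flat) _ _
  refine ⟨R, inferInstance, alg, ?_, ⟨Over.isoMk T.left.isoSpec.symm hs.symm⟩⟩
  exact RingHom.flat_algebraMap_iff.1 (Flat.SpecMap_iff.1 hflat)

end SpecOver

/-! ### Group schemes from functorial groups of points -/

section GroupObject

variable {A : Type u} [CommRing A]

/-- Group structures, functorial in `T`, on the sets of morphisms `T ⟶ G` from flat affine
schemes `T` over `Spec A`. -/
class HomGroup (G : Over (Spec (.of A))) where
  group : ∀ (T : Over (Spec (.of A))) [IsFlatAffine T], Group (T ⟶ G)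
  comp_mul : ∀ {T T' : Over (Spec (.of A))} [IsFlatAffine T] [IsFlatAffine T'] (φ : T' ⟶ T)
    (p q : T ⟶ G), φ ≫ (p * q) = (φ ≫ p) * (φ ≫ q)

attribute [reducible, instance] HomGroup.group

variable (G : Over (Spec (.of A))) [HomGroup G]

variable {G} in
-- The pullback of 1 is idempotent, and the only idempotent of a group is 1.
lemma comp_one_of_comp_mul {T T' : Over (Spec (.of A))} [IsFlatAffine T] [IsFlatAffine T']
    (φ : T' ⟶ T) : φ ≫ (1 : T ⟶ G) = (1 : T' ⟶ G) := by
  have := HomGroup.comp_mul φ (1 : T ⟶ G) 1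
  rw [mul_one] at this
  exact (mul_eq_left.1 this.symm)

variable {G} in
lemma lift_comp_mul [IsFlatAffine G] {T : Over (Spec (.of A))} [IsFlatAffine T] (p q : T ⟶ G) :
    lift p q ≫ (fst G G * snd G G) = p * q := by
  rw [HomGroup.comp_mul, lift_fst, lift_snd]

variable [IsFlatAffine G]

/-- A flat affine scheme over `Spec A` whose sets of points in flat affine schemes are functorially
groups is a group scheme. -/
@[reducible]
def grpObjOfFlatAffine : GrpObj G where
  one := (1 : 𝟙_ _ ⟶ G)
  mul := fst G G * snd G G
  inv := (𝟙 G)⁻¹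
  one_mul := by
    -- Every axiom becomes a group identity among points in a product of copies of `G`, once the
    -- whiskerings are written as `lift`s.
    have : (1 : 𝟙_ _ ⟶ G) ▷ G = lift 1 (snd _ _) := by
      ext1
      · rw [whiskerRight_fst, lift_fst, comp_one_of_comp_mul]
      · rw [whiskerRight_snd, lift_snd]
    rw [this, lift_comp_mul, one_mul, leftUnitor_hom]
  mul_one := by
    have : G ◁ (1 : 𝟙_ _ ⟶ G) = lift (fst _ _) 1 := by
      ext1
      · rw [whiskerLeft_fst, lift_fst]
      · rw [whiskerLeft_snd, lift_snd, comp_one_of_comp_mul]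
    rw [this, lift_comp_mul, mul_one, rightUnitor_hom]
  mul_assoc := by
    have h1 : (fst G G * snd G G) ▷ G =
        lift ((fst _ _ ≫ fst _ _) * (fst _ _ ≫ snd _ _)) (snd _ _) := by
      ext1
      · rw [whiskerRight_fst, lift_fst, HomGroup.comp_mul]
      · rw [whiskerRight_snd, lift_snd]
    have h2 : (α_ G G G).hom ≫ G ◁ (fst G G * snd G G) =
        lift (fst _ _ ≫ fst _ _) ((fst _ _ ≫ snd _ _) * (snd _ _)) := by
      ext1
      · simp
      · rw [Category.assoc, whiskerLeft_snd, lift_snd, HomGroup.comp_mul, HomGroup.comp_mul]; simp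
    rw [h1, reassoc_of% h2, lift_comp_mul, lift_comp_mul, mul_assoc]
  left_inv := by
    rw [lift_comp_mul, inv_mul_cancel, comp_one_of_comp_mul]
  right_inv := by
    rw [lift_comp_mul, mul_inv_cancel, comp_one_of_comp_mul]

end GroupObject

end

noncomputable section

/-! ### Actions on representing schemes through universal points -/

section Action

variable {A : Type u} [CommRing A]

/-- The ring of a flat affine scheme over `Spec A`. -/
def coordRing (T : Over (Spec (.of A))) [IsFlatAffine T] : Type u :=
  (IsFlatAffine.exists_iso T).choose

variable (T : Over (Spec (.of A))) [IsFlatAffine T]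

instance : CommRing (coordRing T) := (IsFlatAffine.exists_iso T).choose_spec.choose

instance : Algebra A (coordRing T) := (IsFlatAffine.exists_iso T).choose_spec.choose_spec.choose

instance : Module.Flat A (coordRing T) :=
  (IsFlatAffine.exists_iso T).choose_spec.choose_spec.choose_spec.choose

/-- A flat affine scheme is the spectrum of its ring. -/
def coordIso : specOver A (coordRing T) ≅ T :=
  (IsFlatAffine.exists_iso T).choose_spec.choose_spec.choose_spec.choose_spec.some

namespace FlatModel

section Points

variable {P : ∀ (R : Type u) [CommRing R] [Algebra A R], Type v}
  {res : ∀ {R R' : Type u} [CommRing R] [Algebra A R] [CommRing R'] [Algebra A R'],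
    (R →ₐ[A] R') → P R → P R' → Prop} (X : FlatModel A P res)

instance : IsFlatAffine X.X := ⟨X.affine, X.flat⟩

/-- The points of a `FlatModel` in a flat affine scheme. -/
def points : (T ⟶ X.X) ≃ P (coordRing T) :=
  (coordIso T).symm.homFromEquiv.trans (X.pts (coordRing T))

lemma points_apply (p : T ⟶ X.X) : X.points T p = X.pts _ ((coordIso T).hom ≫ p) := by
  simp [points]

variable {T} in
lemma exists_specOverMap_comp {R : Type u} [CommRing R] [Algebra A R]
    (φ : specOver A R ⟶ T) :
    ∃ f : coordRing T →ₐ[A] R, specOverMap f ≫ (coordIso T).hom = φ := by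
  obtain ⟨f, hf⟩ := exists_specOverMap (φ ≫ (coordIso T).inv)
  exact ⟨f, by rw [hf, Category.assoc, Iso.inv_hom_id, Category.comp_id]⟩

variable {T} in
-- The naturality of a `FlatModel` concerns spectra only; the coordinate isomorphism carries it over
-- to any flat affine `T`.
lemma res_points {R : Type u} [CommRing R] [Algebra A R] [Module.Flat A R]
    {φ : specOver A R ⟶ T} {f : coordRing T →ₐ[A] R} (hf : specOverMap f ≫ (coordIso T).hom = φ)
    (p : T ⟶ X.X) : res f (X.points T p) (X.pts R (φ ≫ p)) := by
  rw [← hf, Category.assoc, points_apply]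
  exact X.natural f _

end Points

variable {P : ∀ (R : Type u) [CommRing R] [Algebra A R], Type v}
  [∀ (R : Type u) [CommRing R] [Algebra A R], Group (P R)]
  {resP : ∀ {R R' : Type u} [CommRing R] [Algebra A R] [CommRing R'] [Algebra A R'],
    (R →ₐ[A] R') → P R → P R' → Prop} (G : FlatModel A P resP)
  (resP_unique : ∀ {R R' : Type u} [CommRing R] [Algebra A R] [CommRing R'] [Algebra A R']
    (φ : R →ₐ[A] R') (m : P R) (m' m'' : P R'), resP φ m m' → resP φ m m'' → m' = m'')
  (resP_mul : ∀ {R R' : Type u} [CommRing R] [Algebra A R] [CommRing R'] [Algebra A R']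
    (φ : R →ₐ[A] R') (m n : P R) (m' n' : P R'), resP φ m m' → resP φ n n' →
      resP φ (m * n) (m' * n'))

variable {T}

include resP_unique resP_mul in
-- Both sides are restrictions of the same element along `f`. Functoriality is only given as a
-- relation, so the equality has to come from uniqueness of restrictions.
lemma pts_comp_mul {R : Type u} [CommRing R] [Algebra A R] [Module.Flat A R]
    (φ : specOver A R ⟶ T) (p q r : T ⟶ G.X) (h : G.points T r = G.points T p * G.points T q) :
    G.pts R (φ ≫ r) = G.pts R (φ ≫ p) * G.pts R (φ ≫ q) := by
  obtain ⟨f, hf⟩ := exists_specOverMap_comp φ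
  refine resP_unique f (G.points T r) _ _ (G.res_points hf r) ?_
  rw [h]
  exact resP_mul f _ _ _ _ (G.res_points hf p) (G.res_points hf q)

/-- A representing scheme of a functor in groups has functorial groups of points. -/
@[reducible]
def homGroup : HomGroup G.X where
  group T _ := (G.points T).group
  comp_mul {T T'} _ _ φ p q := by
    let := (G.points T).group
    let := (G.points T').group
    refine (G.points T').injective ?_
    rw [Equiv.mul_def (G.points T'), Equiv.apply_symm_apply, points_apply, points_apply,
      points_apply, ← Category.assoc, ← Category.assoc, ← Category.assoc]
    refine G.pts_comp_mul resP_unique resP_mul _ p q _ ?_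
    rw [Equiv.mul_def (G.points T), Equiv.apply_symm_apply]

variable {Q : ∀ (R : Type u) [CommRing R] [Algebra A R], Type*}
  {resQ : ∀ {R R' : Type u} [CommRing R] [Algebra A R] [CommRing R'] [Algebra A R'],
    (R →ₐ[A] R') → Q R → Q R' → Prop} (H : FlatModel A Q resQ)
  (resQ_unique : ∀ {R R' : Type u} [CommRing R] [Algebra A R] [CommRing R'] [Algebra A R']
    (φ : R →ₐ[A] R') (f : Q R) (f' f'' : Q R'), resQ φ f f' → resQ φ f f'' → f' = f'')
  (act : ∀ (R : Type u) [CommRing R] [Algebra A R], Q R → P R → Q R)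
  (res_act : ∀ {R R' : Type u} [CommRing R] [Algebra A R] [CommRing R'] [Algebra A R']
    (φ : R →ₐ[A] R') (f : Q R) (m : P R) (f' : Q R') (m' : P R'), resQ φ f f' → resP φ m m' →
      resQ φ (act R f m) (act R' f' m'))
  (act_mul : ∀ (R : Type u) [CommRing R] [Algebra A R] (f : Q R) (m m' : P R),
    act R (act R f m) m' = act R f (m * m'))
  (act_one : ∀ (R : Type u) [CommRing R] [Algebra A R] (f : Q R), act R f 1 = f)

include resQ_unique res_act in
lemma pts_comp_act {R : Type u} [CommRing R] [Algebra A R] [Module.Flat A R]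
    (φ : specOver A R ⟶ T) (p : T ⟶ H.X) (g : T ⟶ G.X) (r : T ⟶ H.X)
    (h : H.points T r = act _ (H.points T p) (G.points T g)) :
    H.pts R (φ ≫ r) = act R (H.pts R (φ ≫ p)) (G.pts R (φ ≫ g)) := by
  obtain ⟨f, hf⟩ := exists_specOverMap_comp φ
  refine resQ_unique f (H.points T r) _ _ (H.res_points hf r) ?_
  rw [h]
  exact res_act f _ _ _ _ (H.res_points hf p) (G.res_points hf g)

include resP_unique resP_mul resQ_unique res_act act_mul act_one in
/-- If a functor in groups `P` on flat `A`-algebras acts on a functor `Q` from the right, then every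
flat affine scheme representing `P` is a group scheme acting on every one representing `Q`. -/
theorem exists_grpObj_action :
    ∃ grp : GrpObj G.X,
      (∀ (R : Type u) [CommRing R] [Algebra A R] [Module.Flat A R] (g g' : specOver A R ⟶ G.X),
        G.pts R (lift g g' ≫ grp.mul) = G.pts R g * G.pts R g') ∧
      ∃ a : H.X ⊗ G.X ⟶ H.X,
        (∀ (T : Over (Spec (.of A))) (p : T ⟶ H.X) (g g' : T ⟶ G.X),
          lift (lift p g ≫ a) g' ≫ a = lift p (lift g g' ≫ grp.mul) ≫ a) ∧
        (∀ (T : Over (Spec (.of A))) (p : T ⟶ H.X), lift p (toUnit T ≫ grp.one) ≫ a = p) ∧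
        (∀ (R : Type u) [CommRing R] [Algebra A R] [Module.Flat A R]
          (p : specOver A R ⟶ H.X) (g : specOver A R ⟶ G.X),
          H.pts R (lift p g ≫ a) = act R (H.pts R p) (G.pts R g)) ∧
        ∀ a' : H.X ⊗ G.X ⟶ H.X,
          (∀ (R : Type u) [CommRing R] [Algebra A R] [Module.Flat A R]
            (p : specOver A R ⟶ H.X) (g : specOver A R ⟶ G.X),
            H.pts R (lift p g ≫ a') = act R (H.pts R p) (G.pts R g)) → a' = a := by
  let := G.homGroup resP_unique resP_mul
  have hmul (R : Type u) [CommRing R] [Algebra A R] [Module.Flat A R]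
      (g g' : specOver A R ⟶ G.X) :
      G.pts R (lift g g' ≫ (fst G.X G.X * snd G.X G.X)) = G.pts R g * G.pts R g' := by
    rw [G.pts_comp_mul resP_unique resP_mul (lift g g') (fst _ _) (snd _ _), lift_fst, lift_snd]
    rw [Equiv.mul_def (G.points _), Equiv.apply_symm_apply]
  -- The morphism is the result of letting the universal point of `G` act on the universal point of
  -- `H`.
  let a : H.X ⊗ G.X ⟶ H.X := (H.points _).symm (act _ (H.points _ (fst _ _)) (G.points _ (snd _ _)))
  have ha (R : Type u) [CommRing R] [Algebra A R] [Module.Flat A R]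
      (p : specOver A R ⟶ H.X) (g : specOver A R ⟶ G.X) :
      H.pts R (lift p g ≫ a) = act R (H.pts R p) (G.pts R g) := by
    rw [pts_comp_act G H resQ_unique act res_act (lift p g) (fst _ _) (snd _ _), lift_fst, lift_snd]
    rw [Equiv.apply_symm_apply]
  have hone (R : Type u) [CommRing R] [Algebra A R] [Module.Flat A R] :
      G.pts R (1 : specOver A R ⟶ G.X) = 1 := by
    have := hmul R 1 1
    rw [lift_comp_mul, mul_one] at this
    exact mul_eq_left.1 this.symm
  -- A morphism out of a flat affine `T` is determined by its value on the tautological point of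
  -- `T`.
  have hext {T : Over (Spec (.of A))} [IsFlatAffine T] {p q : T ⟶ H.X}
      (h : H.pts _ ((coordIso T).hom ≫ p) = H.pts _ ((coordIso T).hom ≫ q)) : p = q := by
    refine (H.points T).injective ?_
    rw [points_apply, points_apply, h]
  refine ⟨grpObjOfFlatAffine G.X, hmul, a, fun T p g g' => ?_, fun T p => ?_, ha,
    fun a' ha' => ?_⟩
  -- Associativity is checked for the universal triple on `H × (G × G)`. Pulling it back along `(p,
  -- (g, g'))` then covers every `T`, flat affine or not.
  · have key : lift (lift (fst H.X (G.X ⊗ G.X)) (snd _ _ ≫ fst _ _) ≫ a) (snd _ _ ≫ snd _ _) ≫ a =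
        lift (fst H.X (G.X ⊗ G.X)) (lift (snd _ _ ≫ fst _ _) (snd _ _ ≫ snd _ _) ≫
          (fst G.X G.X * snd G.X G.X)) ≫ a := by
      refine hext ?_
      simp only [comp_lift_assoc, ha, hmul, act_mul]
    have := congrArg (lift p (lift g g') ≫ ·) key
    simp only [comp_lift_assoc, lift_fst, lift_snd, lift_snd_assoc] at this
    exact this
  · have key : lift (𝟙 H.X) (1 : H.X ⟶ G.X) ≫ a = 𝟙 H.X := by
      refine hext ?_
      rw [comp_lift_assoc, ha, comp_one_of_comp_mul, hone, act_one, Category.comp_id]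
    have := congrArg (p ≫ ·) key
    have h1 : toUnit H.X ≫ (1 : 𝟙_ _ ⟶ G.X) = 1 := comp_one_of_comp_mul _
    rw [← h1] at this
    simp only [comp_lift_assoc, Category.comp_id, comp_toUnit_assoc] at this
    exact this
  · refine hext ?_
    -- The tautological point of `H × G` is a pair of points, to which the assumption on `a'`
    -- applies.
    have h0 : (coordIso (H.X ⊗ G.X)).hom = lift ((coordIso _).hom ≫ fst _ _)
        ((coordIso _).hom ≫ snd _ _) := by
      ext1 <;> simp
    rw [h0, ha, ha']

end FlatModel

end Action

end

noncomputable section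

/-! ### Representability by coordinates -/

section Coordinates

open MvPolynomial in
/-- A functor on flat `A`-algebras which is, in suitable coordinates, the nonvanishing locus of a
polynomial, is represented by a flat affine scheme. -/
theorem FlatModel.nonempty_of_coord {A : Type u} [CommRing A]
    {P : ∀ (R : Type u) [CommRing R] [Algebra A R], Type v}
    {res : ∀ {R R' : Type u} [CommRing R] [Algebra A R] [CommRing R'] [Algebra A R'],
      (R →ₐ[A] R') → P R → P R' → Prop} {n : ℕ} (d : MvPolynomial (Fin n) A)
    (c : ∀ (R : Type u) [CommRing R] [Algebra A R] [Module.Flat A R], P R → Fin n → R)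
    (c_inj : ∀ (R : Type u) [CommRing R] [Algebra A R] [Module.Flat A R],
      Function.Injective (c R))
    (c_range : ∀ (R : Type u) [CommRing R] [Algebra A R] [Module.Flat A R] (x : Fin n → R),
      (∃ p, c R p = x) ↔ IsUnit (aeval x d))
    (c_res : ∀ {R R' : Type u} [CommRing R] [Algebra A R] [Module.Flat A R]
      [CommRing R'] [Algebra A R'] [Module.Flat A R'] (φ : R →ₐ[A] R') (p : P R) (p' : P R'),
      (∀ k, c R' p' k = φ (c R p k)) → res φ p p') :
    Nonempty (FlatModel A P res) := by
  -- The representing ring is `A[x₁, …, x_n]` with `d` inverted. It is flat over the polynomial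
  -- ring, hence over `A`.
  let S := Localization.Away d
  let x {R : Type u} [CommRing R] [Algebra A R] (g : S →ₐ[A] R) (k : Fin n) : R :=
    g (algebraMap (MvPolynomial (Fin n) A) S (MvPolynomial.X k))
  have hx {R : Type u} [CommRing R] [Algebra A R] (g : S →ₐ[A] R) (q : MvPolynomial (Fin n) A) :
      aeval (x g) q = g (algebraMap _ S q) := by
    have : aeval (x g) = g.comp (IsScalarTower.toAlgHom A (MvPolynomial (Fin n) A) S) := by
      ext k
      simp [x]
    rw [this]
    rfl
  have hu (R : Type u) [CommRing R] [Algebra A R] [Module.Flat A R] (g : S →ₐ[A] R) :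
      ∃ p, c R p = x g := by
    rw [c_range, hx]
    exact (IsLocalization.Away.algebraMap_isUnit d).map g
  choose p hp using hu
  have hinj (R : Type u) [CommRing R] [Algebra A R] [Module.Flat A R] :
      Function.Injective (p R) := by
    intro g g' h
    have h1 : x g = x g' := by rw [← hp, ← hp, h]
    refine IsLocalization.algHom_ext (W := Submonoid.powers d) (AlgHom.ext fun q => ?_)
    exact (hx g q).symm.trans ((congrArg (fun y => aeval y q) h1).trans (hx g' q))
  have hsurj (R : Type u) [CommRing R] [Algebra A R] [Module.Flat A R] :
      Function.Surjective (p R) := by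
    intro q
    have hq : IsUnit (aeval (c R q) d) := (c_range R _).1 ⟨q, rfl⟩
    let g : S →ₐ[A] R := IsLocalization.liftAlgHom (M := Submonoid.powers d) (f := aeval (c R q))
      (by rintro ⟨_, k, rfl⟩; rw [map_pow]; exact hq.pow k)
    refine ⟨g, c_inj R ?_⟩
    rw [hp]
    ext k
    simp [x, g]
  have : Module.Flat (MvPolynomial (Fin n) A) S := IsLocalization.flat S (Submonoid.powers d)
  have : Module.Flat A S := Module.Flat.trans A (MvPolynomial (Fin n) A) S
  refine ⟨FlatModel.ofAlgHomEquiv S (fun R _ _ _ => Equiv.ofBijective (p R) ⟨hinj R, hsurj R⟩) ?_⟩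
  intro R R' _ _ _ _ _ _ φ g
  refine c_res φ _ _ fun k => ?_
  exact (congrFun (hp R' (φ.comp g)) k).trans (congrArg φ (congrFun (hp R g) k)).symm

variable {A : Type*} [CommRing A] {E : Type*} [AddCommGroup E] [Module A E]
  {S : Submodule A E} {n : ℕ} (s : Module.Basis (Fin n) A S)

section

variable (R : Type*) [CommRing R] [Algebra A R]

/-- The element of `R ⊗ E` with given coordinates with respect to a basis of a submodule of `E`. -/
def tensorCoord : (Fin n → R) →ₗ[R] R ⊗[A] E :=
  Fintype.linearCombination R (fun k => (1 : R) ⊗ₜ[A] (s k : E))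

lemma tensorCoord_apply (x : Fin n → R) : tensorCoord s R x = ∑ k, x k ⊗ₜ[A] (s k : E) := by
  simp [tensorCoord, Fintype.linearCombination_apply, TensorProduct.smul_tmul']

lemma tensorCoord_eq (x : Fin n → R) :
    tensorCoord s R x = S.subtype.baseChange R ((s.baseChange R).equivFun.symm x) := by
  rw [Module.Basis.equivFun_symm_apply, tensorCoord_apply, map_sum]
  refine Finset.sum_congr rfl fun k _ => ?_
  rw [map_smul, Module.Basis.baseChange_apply, LinearMap.baseChange_tmul,
    TensorProduct.smul_tmul', smul_eq_mul, mul_one]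
  rfl

/-- Flatness keeps `S ⊗ R → E ⊗ R` injective, so coordinates in `S ⊗ R` can be recovered inside `E ⊗
R`. -/
lemma tensorCoord_injective [Module.Flat A R] : Function.Injective (tensorCoord s R) := by
  intro x y h
  rw [tensorCoord_eq, tensorCoord_eq] at h
  exact (s.baseChange R).equivFun.symm.injective
    (Module.Flat.lTensor_preserves_injective_linearMap S.subtype S.injective_subtype h)

lemma mem_baseChange_iff_tensorCoord (y : R ⊗[A] E) :
    y ∈ S.baseChange R ↔ ∃ x, tensorCoord s R x = y := by
  constructor
  · rintro ⟨z, rfl⟩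
    exact ⟨(s.baseChange R).equivFun z, by rw [tensorCoord_eq, LinearEquiv.symm_apply_apply]⟩
  · rintro ⟨x, rfl⟩
    rw [tensorCoord_eq]
    exact ⟨_, rfl⟩

end

lemma rTensor_tensorCoord {R R' : Type*} [CommRing R] [Algebra A R] [CommRing R'] [Algebra A R']
    (φ : R →ₐ[A] R') (x : Fin n → R) :
    φ.toLinearMap.rTensor E (tensorCoord s R x) = tensorCoord s R' (fun k => φ (x k)) := by
  simp [tensorCoord_apply]

end Coordinates

/-! ### Units of the form `1 + x` with `x` in a multiplicatively closed submodule -/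

section Units

variable {A : Type*} [CommRing A] {Λ : Type*} [Ring Λ] [Algebra A Λ]
  {S : Submodule A Λ} {n : ℕ} (s : Module.Basis (Fin n) A S)
  (hS : ∀ x ∈ S, ∀ y ∈ S, x * y ∈ S)

/-- The matrix, with respect to a basis of `S`, of left multiplication by `x ∈ S`. -/
def mulMatrix (k : Fin n) : Matrix (Fin n) (Fin n) A :=
  Matrix.of fun i j => s.repr ⟨s k * s j, hS _ (s k).2 _ (s j).2⟩ i

/-- The determinant of left multiplication on `S` by `1` plus the generic element of `S`. -/
def unitDet : MvPolynomial (Fin n) A :=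
  (1 + ∑ k, (MvPolynomial.X k : MvPolynomial (Fin n) A) •
    (mulMatrix s hS k).map (MvPolynomial.C)).det

variable (R : Type*) [CommRing R] [Algebra A R]

/-- The matrix of left multiplication by `1 + x` for `x ∈ S ⊗ R`. -/
def unitMatrix (x : Fin n → R) : Matrix (Fin n) (Fin n) R :=
  1 + ∑ k, x k • (mulMatrix s hS k).map (algebraMap A R)

lemma aeval_unitDet (x : Fin n → R) :
    MvPolynomial.aeval x (unitDet s hS) = (unitMatrix s hS R x).det := by
  rw [unitDet, AlgHom.map_det]
  congr 1
  ext i j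
  simp [unitMatrix, Matrix.one_apply, Matrix.sum_apply, apply_ite (MvPolynomial.aeval x)]

/-- As `S` is closed under multiplication, left multiplication by `1 + x` preserves `S ⊗ R` even if
`S` does not contain 1. Its matrix is affine-linear in the coordinates of `x`, which makes its
determinant a polynomial in them. -/
lemma mul_tensorCoord (x y : Fin n → R) :
    (1 + tensorCoord s R x) * tensorCoord s R y =
      tensorCoord s R ((unitMatrix s hS R x).mulVec y) := by
  have hk (k j : Fin n) : (s k : Λ) * s j = ∑ i, mulMatrix s hS k i j • (s i : Λ) := by
    have := congrArg S.subtype (s.sum_repr ⟨s k * s j, hS _ (s k).2 _ (s j).2⟩)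
    rw [map_sum] at this
    exact this.symm
  have h2 (k : Fin n) : ((1 : R) ⊗ₜ[A] (s k : Λ)) * tensorCoord s R y =
      tensorCoord s R (((mulMatrix s hS k).map (algebraMap A R)).mulVec y) := by
    simp only [tensorCoord_apply, Finset.mul_sum, Algebra.TensorProduct.tmul_mul_tmul, one_mul, hk,
      TensorProduct.tmul_sum, Matrix.mulVec, dotProduct, TensorProduct.sum_tmul, Matrix.map_apply]
    rw [Finset.sum_comm]
    refine Finset.sum_congr rfl fun i _ => Finset.sum_congr rfl fun j _ => ?_
    rw [TensorProduct.tmul_smul, TensorProduct.smul_tmul', Algebra.smul_def]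
  have h3 : tensorCoord s R x = ∑ k, x k • ((1 : R) ⊗ₜ[A] (s k : Λ)) := by
    simp [tensorCoord_apply, TensorProduct.smul_tmul']
  rw [add_mul, one_mul, h3, Finset.sum_mul, unitMatrix, Matrix.add_mulVec, Matrix.one_mulVec,
    map_add, Matrix.sum_mulVec, map_sum]
  congr 1
  refine Finset.sum_congr rfl fun k _ => ?_
  rw [smul_mul_assoc, h2, Matrix.smul_mulVec, map_smul]

/-- In an algebra which is finite as a module, one-sided inverses are two-sided. -/
lemma mul_eq_one_comm_of_finite {C : Type*} [Ring C] [Algebra R C] [Module.Finite R C] {a b : C}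
    (h : a * b = 1) : b * a = 1 := by
  have hs : Function.Surjective (LinearMap.mulLeft R a) := fun c => ⟨b * c, by
    rw [LinearMap.mulLeft_apply, ← mul_assoc, h, one_mul]⟩
  -- A surjective endomorphism of a finite module is injective, and left multiplication by `a` sends
  -- both `b * a` and 1 to `a`.
  refine OrzechProperty.injective_of_surjective_endomorphism _ hs ?_
  rw [LinearMap.mulLeft_apply, LinearMap.mulLeft_apply, ← mul_assoc, h, one_mul, mul_one]

/-- An element `1 + x` with `x ∈ S ⊗ R` has an inverse of the same form if and only if the
determinant of left multiplication by `1 + x` on `S ⊗ R` is invertible. -/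
lemma exists_inverse_iff_isUnit [Module.Flat A R] [Module.Finite A Λ] (x : Fin n → R) :
    (∃ y ∈ S.baseChange R, (1 + tensorCoord s R x) * (1 + y) = 1 ∧
      (1 + y) * (1 + tensorCoord s R x) = 1) ↔
    IsUnit (MvPolynomial.aeval x (unitDet s hS)) := by
  rw [aeval_unitDet]
  constructor
  · rintro ⟨y, hy, hxy, -⟩
    obtain ⟨y, rfl⟩ := (mem_baseChange_iff_tensorCoord s R y).1 hy
    have h1 : unitMatrix s hS R x * unitMatrix s hS R y = 1 := by
      refine Matrix.toLin'.injective (LinearMap.ext fun z => tensorCoord_injective s R ?_)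
      rw [Matrix.toLin'_apply, Matrix.toLin'_apply, ← Matrix.mulVec_mulVec, ← mul_tensorCoord,
        ← mul_tensorCoord, ← mul_assoc, hxy, one_mul, Matrix.one_mulVec]
    exact (Matrix.isUnit_iff_isUnit_det _).1 (IsUnit.of_mul_eq_one _ h1)
  · intro hu
    -- Solving `(1 + x) y = -x` inside `S ⊗ R` gives `(1 + x)(1 + y) = (1 + x) - x = 1`.
    let y := (unitMatrix s hS R x)⁻¹.mulVec (-x)
    have hy : (unitMatrix s hS R x).mulVec y = -x := by
      rw [Matrix.mulVec_mulVec, Matrix.mul_nonsing_inv _ hu, Matrix.one_mulVec]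
    have h1 : (1 + tensorCoord s R x) * (1 + tensorCoord s R y) = 1 := by
      rw [mul_add, mul_tensorCoord s hS, hy, map_neg, mul_one, add_neg_cancel_right]
    exact ⟨tensorCoord s R y, (mem_baseChange_iff_tensorCoord s R _).2 ⟨y, rfl⟩, h1,
      mul_eq_one_comm_of_finite R h1⟩

end Units

end

/-! ### Affine spaces and unit groups as flat models -/

section Representability

variable {A : Type u} [CommRing A]
  {P : ∀ (R : Type u) [CommRing R] [Algebra A R], Type v}
  {res : ∀ {R R' : Type u} [CommRing R] [Algebra A R] [CommRing R'] [Algebra A R'],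
    (R →ₐ[A] R') → P R → P R' → Prop}

lemma FlatModel.nonempty_of_tensorCoord {E : Type*} [AddCommGroup E] [Module A E]
    {S : Submodule A E} {n : ℕ} (s : Module.Basis (Fin n) A S) (d : MvPolynomial (Fin n) A)
    (c : ∀ (R : Type u) [CommRing R] [Algebra A R] [Module.Flat A R], P R → R ⊗[A] E)
    (c_inj : ∀ (R : Type u) [CommRing R] [Algebra A R] [Module.Flat A R],
      Function.Injective (c R))
    (c_range : ∀ (R : Type u) [CommRing R] [Algebra A R] [Module.Flat A R] (y : R ⊗[A] E),
      (∃ p, c R p = y) ↔ ∃ x, tensorCoord s R x = y ∧ IsUnit (MvPolynomial.aeval x d))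
    (c_res : ∀ {R R' : Type u} [CommRing R] [Algebra A R] [Module.Flat A R]
      [CommRing R'] [Algebra A R'] [Module.Flat A R'] (φ : R →ₐ[A] R') (p : P R) (p' : P R'),
      c R' p' = φ.toLinearMap.rTensor E (c R p) → res φ p p') :
    Nonempty (FlatModel A P res) := by
  have hx (R : Type u) [CommRing R] [Algebra A R] [Module.Flat A R] (p : P R) :=
    (c_range R (c R p)).1 ⟨p, rfl⟩
  choose x hx hxu using hx
  refine FlatModel.nonempty_of_coord d x ?_ ?_ ?_
  · intro R _ _ _ p q h
    refine c_inj R ?_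
    rw [← hx, ← hx, h]
  · intro R _ _ _ z
    constructor
    · rintro ⟨p, rfl⟩
      exact hxu R p
    · intro hz
      obtain ⟨p, hp⟩ := (c_range R (tensorCoord s R z)).2 ⟨z, rfl, hz⟩
      exact ⟨p, tensorCoord_injective s R (by rw [hx, hp])⟩
  · intro R R' _ _ _ _ _ _ φ p p' h
    refine c_res φ p p' ?_
    rw [← hx, ← hx, rTensor_tensorCoord]
    congr 1
    exact funext h

variable [IsDomain A] [IsPrincipalIdealRing A]

/-- A functor of the form `R ↦ S ⊗ R`, for a submodule `S` of a finite free module, is represented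
by an affine space. -/
theorem FlatModel.nonempty_of_submodule {E : Type*} [AddCommGroup E] [Module A E]
    [Module.Free A E] [Module.Finite A E] (S : Submodule A E)
    (c : ∀ (R : Type u) [CommRing R] [Algebra A R] [Module.Flat A R], P R → R ⊗[A] E)
    (c_inj : ∀ (R : Type u) [CommRing R] [Algebra A R] [Module.Flat A R],
      Function.Injective (c R))
    (c_range : ∀ (R : Type u) [CommRing R] [Algebra A R] [Module.Flat A R] (y : R ⊗[A] E),
      (∃ p, c R p = y) ↔ y ∈ S.baseChange R)
    (c_res : ∀ {R R' : Type u} [CommRing R] [Algebra A R] [Module.Flat A R]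
      [CommRing R'] [Algebra A R'] [Module.Flat A R'] (φ : R →ₐ[A] R') (p : P R) (p' : P R'),
      c R' p' = φ.toLinearMap.rTensor E (c R p) → res φ p p') :
    Nonempty (FlatModel A P res) := by
  -- A submodule of a finite free module over a principal ideal domain is finite free. With the
  -- polynomial 1 nothing is removed from the affine space.
  refine FlatModel.nonempty_of_tensorCoord (Module.finBasis A S) 1 c c_inj (fun R _ _ _ y => ?_)
    c_res
  simp [c_range, mem_baseChange_iff_tensorCoord (Module.finBasis A S)]

/-- The functor of invertible elements of `1 + S ⊗ R`, for a multiplicatively closed submodule `S`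
of an algebra which is a finite free module, is represented by a flat affine scheme. -/
theorem FlatModel.nonempty_of_units {Λ : Type*} [Ring Λ] [Algebra A Λ]
    [Module.Free A Λ] [Module.Finite A Λ] (S : Submodule A Λ)
    (hS : ∀ x ∈ S, ∀ y ∈ S, x * y ∈ S)
    (c : ∀ (R : Type u) [CommRing R] [Algebra A R] [Module.Flat A R], P R → R ⊗[A] Λ)
    (c_inj : ∀ (R : Type u) [CommRing R] [Algebra A R] [Module.Flat A R],
      Function.Injective (c R))
    (c_range : ∀ (R : Type u) [CommRing R] [Algebra A R] [Module.Flat A R] (y : R ⊗[A] Λ),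
      (∃ p, c R p = y) ↔ y ∈ S.baseChange R ∧
        ∃ y' ∈ S.baseChange R, (1 + y) * (1 + y') = 1 ∧ (1 + y') * (1 + y) = 1)
    (c_res : ∀ {R R' : Type u} [CommRing R] [Algebra A R] [Module.Flat A R]
      [CommRing R'] [Algebra A R'] [Module.Flat A R'] (φ : R →ₐ[A] R') (p : P R) (p' : P R'),
      c R' p' = φ.toLinearMap.rTensor Λ (c R p) → res φ p p') :
    Nonempty (FlatModel A P res) := by
  let s := Module.finBasis A S
  refine FlatModel.nonempty_of_tensorCoord s (unitDet s hS) c c_inj (fun R _ _ _ y => ?_) c_res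
  rw [c_range, mem_baseChange_iff_tensorCoord s]
  constructor
  · rintro ⟨⟨x, rfl⟩, h⟩
    exact ⟨x, rfl, (exists_inverse_iff_isUnit s hS R x).1 h⟩
  · rintro ⟨x, rfl, h⟩
    exact ⟨⟨x, rfl⟩, (exists_inverse_iff_isUnit s hS R x).2 h⟩

end Representability

/-! ### Arithmetic of the rings of integers -/

section Arithmetic

/-- A finite extension has finitely many primes above each prime. This makes `A` and `B` semilocal,
and a Dedekind domain with finitely many primes is principal. -/
lemma finite_primes_of_finite {R C : Type*} [CommRing R] [CommRing C] [Algebra R C]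
    [Module.Finite R C] (h : {I : Ideal R | I.IsPrime}.Finite) :
    {I : Ideal C | I.IsPrime}.Finite := by
  refine (h.biUnion fun p _ => Algebra.QuasiFinite.finite_primesOver (S := C) p).subset ?_
  intro I hI
  have : I.IsPrime := hI
  exact Set.mem_biUnion (x := I.comap (algebraMap R C)) (Ideal.IsPrime.comap _)
    ⟨hI, ⟨rfl⟩⟩

lemma finite_primes_padicInt : {I : Ideal ℤ_[2] | I.IsPrime}.Finite := by
  refine (Set.toFinite {⊥, IsLocalRing.maximalIdeal ℤ_[2]}).subset fun I hI => ?_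
  by_cases h : I = ⊥
  · exact Or.inl h
  · exact Or.inr (IsLocalRing.eq_maximalIdeal (Ring.DimensionLEOne.maximalOfPrime h hI))

lemma two_mem_of_isMaximal {C : Type*} [CommRing C] [Algebra ℤ_[2] C] [Module.Finite ℤ_[2] C]
    (I : Ideal C) [I.IsMaximal] : (2 : C) ∈ I := by
  have h : I.comap (algebraMap ℤ_[2] C) = IsLocalRing.maximalIdeal _ :=
    IsLocalRing.eq_maximalIdeal (Ideal.isMaximal_comap_of_isIntegral_of_isMaximal I)
  have h2 : (2 : ℤ_[2]) ∈ IsLocalRing.maximalIdeal ℤ_[2] := by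
    rw [PadicInt.maximalIdeal_eq_span_p]
    exact Ideal.mem_span_singleton_self _
  rw [← h, Ideal.mem_comap, map_ofNat] at h2
  exact h2

/-- By integrality over `ℤ_[2]`, 2 lies in every maximal ideal of `C`, so an element congruent to 1
modulo 2 lies in none. -/
lemma isUnit_of_two_dvd_sub_one {C : Type*} [CommRing C] [Algebra ℤ_[2] C]
    [Module.Finite ℤ_[2] C] {d : C} (hd : 2 ∣ d - 1) : IsUnit d := by
  by_contra h
  obtain ⟨I, hI, hdI⟩ := exists_max_ideal_of_mem_nonunits h
  refine hI.ne_top ((Ideal.eq_top_iff_one I).2 ?_)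
  have := I.sub_mem hdI (I.mem_of_dvd hd (two_mem_of_isMaximal I))
  rwa [sub_sub_cancel] at this

variable {A : Type*} {F : Type*} [CommRing A] [Field F] [Algebra ℚ_[2] F]
  [FiniteDimensional ℚ_[2] F]
  [Algebra ℤ_[2] F] [IsScalarTower ℤ_[2] ℚ_[2] F] [Algebra ℤ_[2] A] [Algebra A F]
  [IsScalarTower ℤ_[2] A F] [IsIntegralClosure A ℤ_[2] F]

variable (A F) in
lemma integers_facts : IsDomain A ∧ IsPrincipalIdealRing A ∧ Module.Finite ℤ_[2] A ∧
    IsFractionRing A F := by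
  have h1 : IsDomain A := (IsIntegralClosure.algebraMap_injective A ℤ_[2] F).isDomain _
  have : CharZero F := charZero_of_injective_algebraMap (algebraMap ℚ_[2] F).injective
  have h2 : Module.Finite ℤ_[2] A := IsIntegralClosure.finite ℤ_[2] ℚ_[2] F A
  have : IsDedekindDomain A := IsIntegralClosure.isDedekindDomain ℤ_[2] ℚ_[2] F A
  refine ⟨h1, ?_, h2, IsIntegralClosure.isFractionRing_of_finite_extension ℤ_[2] ℚ_[2] F A⟩
  exact IsPrincipalIdealRing.of_finite_primes (finite_primes_of_finite finite_primes_padicInt)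

variable {B : Type*} {E : Type*} [CommRing B] [Field E] [Algebra F E] [Algebra A E]
  [IsScalarTower A F E] [Algebra A B] [Algebra B E] [IsScalarTower A B E]
  [IsIntegralClosure B A E]

variable (A F B E) in
lemma extension_facts [FiniteDimensional F E] :
    IsDomain B ∧ IsPrincipalIdealRing B ∧ Module.Finite A B ∧ Module.Free A B ∧
      Function.Injective (algebraMap A B) := by
  obtain ⟨_, _, _, _⟩ := integers_facts A F
  have h1 : IsDomain B := (IsIntegralClosure.algebraMap_injective B A E).isDomain _
  have : CharZero F := charZero_of_injective_algebraMap (algebraMap ℚ_[2] F).injective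
  have h2 : Module.Finite A B := IsIntegralClosure.finite A F E B
  have : IsDedekindDomain B := IsIntegralClosure.isDedekindDomain A F E B
  have hAF : Function.Injective (algebraMap A F) := IsFractionRing.injective A F
  have hAE : Function.Injective (algebraMap A E) := by
    rw [IsScalarTower.algebraMap_eq A F E]
    exact (algebraMap F E).injective.comp hAF
  have hAB : Function.Injective (algebraMap A B) := by
    rw [IsScalarTower.algebraMap_eq A B E] at hAE
    exact Function.Injective.of_comp hAE
  have : FaithfulSMul A B := (faithfulSMul_iff_algebraMap_injective A B).2 hAB
  refine ⟨h1, ?_, h2, inferInstance, hAB⟩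
  exact IsPrincipalIdealRing.of_finite_primes
    (finite_primes_of_finite (R := A) (finite_primes_of_finite finite_primes_padicInt))

end Arithmetic

noncomputable section

/-! ### Comparing base change over `B` with base change over `A` -/

section BaseChangeEquiv

variable (A B L R F : Type*) [CommRing A] [CommRing B] [Algebra A B] [AddCommGroup L] [Module B L]
  [Module A L] [IsScalarTower A B L] [CommRing R] [Algebra A R] [Field F] [Algebra A F]

/-- The isomorphism `r ⊗ l ↦ (1 ⊗ r) ⊗ l`. -/
def equivLR : R ⊗[A] L ≃ₗ[A] LR A B L R :=
  ((((TensorProduct.comm B (B ⊗[A] R) L) ≪≫ₗ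
    TensorProduct.AlgebraTensorModule.cancelBaseChange A B B L R).restrictScalars A) ≪≫ₗ
    TensorProduct.comm A L R).symm

variable {A B L R F}

lemma equivLR_symm_tmul (b : B) (r : R) (l : L) :
    (equivLR A B L R).symm ((b ⊗ₜ[A] r) ⊗ₜ[B] l) = r ⊗ₜ[A] (b • l) := by
  simp [equivLR]

lemma equivLR_tmul (r : R) (l : L) :
    equivLR A B L R (r ⊗ₜ[A] l) = ((1 : B) ⊗ₜ[A] r) ⊗ₜ[B] l := by
  rw [← LinearEquiv.eq_symm_apply, equivLR_symm_tmul, one_smul]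

/-- The functors are defined with lattices base changed along `B → B ⊗ R`, while the flatness
arguments concern `A`-modules tensored with `R`. This is the dictionary between the two for
sublattices of `L`. -/
lemma equivLR_mem_baseChange (Q : Submodule B L) (y : R ⊗[A] L) :
    equivLR A B L R y ∈ Q.baseChange (B ⊗[A] R) ↔ y ∈ (Q.restrictScalars A).baseChange R := by
  constructor
  · intro h
    rw [← (equivLR A B L R).symm_apply_apply y]
    obtain ⟨z, hz⟩ := h
    rw [← hz]
    clear hz
    induction z with
    | zero => simp
    | add z z' h h' =>
      rw [map_add, map_add]
      exact add_mem h h'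
    | tmul c q =>
      rw [LinearMap.baseChange_tmul]
      induction c with
      | zero => simp
      | add c c' h h' =>
        rw [TensorProduct.add_tmul, map_add]
        exact add_mem h h'
      | tmul b r =>
        rw [equivLR_symm_tmul]
        exact Submodule.tmul_mem_baseChange_of_mem _
          ((Submodule.restrictScalars_mem A Q _).2 (Q.smul_mem b q.2))
  · rintro ⟨z, rfl⟩
    induction z with
    | zero => simp
    | add z z' h h' =>
      rw [map_add, map_add]
      exact add_mem h h'
    | tmul r q =>
      rw [LinearMap.baseChange_tmul, equivLR_tmul]
      exact Submodule.tmul_mem_baseChange_of_mem _ q.2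

variable (A B L R F) in
/-- The isomorphism `r ⊗ (l ⊗ a) ↦ ((1 ⊗ r) ⊗ l) ⊗ a`. -/
def equivVR : R ⊗[A] (L ⊗[A] F) ≃ₗ[A] LR A B L R ⊗[A] F :=
  (TensorProduct.assoc A R L F).symm ≪≫ₗ
    TensorProduct.congr (equivLR A B L R) (LinearEquiv.refl A F)

lemma equivVR_tmul_tmul (r : R) (l : L) (a : F) :
    equivVR A B L R F (r ⊗ₜ[A] (l ⊗ₜ[A] a)) = (((1 : B) ⊗ₜ[A] r) ⊗ₜ[B] l) ⊗ₜ[A] a := by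
  simp [equivVR, equivLR_tmul]

variable (A B L R F) in
/-- The map `l ⊗ a ↦ (1 ⊗ l) ⊗ a` from `V` to its base change. -/
abbrev inclVR : L ⊗[A] F →ₗ[A] LR A B L R ⊗[A] F :=
  LinearMap.rTensor F ((TensorProduct.mk B (B ⊗[A] R) L 1).restrictScalars A)

lemma tmul_smul_inclVR (b : B) (r : R) (x : L ⊗[A] F) :
    (b ⊗ₜ[A] r : B ⊗[A] R) • inclVR A B L R F x = equivVR A B L R F (r ⊗ₜ[A] (b • x)) := by
  induction x with
  | zero => simp
  | add x x' h h' => rw [map_add, smul_add, h, h', smul_add, TensorProduct.tmul_add, map_add]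
  | tmul l a =>
    rw [TensorProduct.smul_tmul', equivVR_tmul_tmul, LinearMap.rTensor_tmul]
    simp only [LinearMap.coe_restrictScalars, TensorProduct.mk_apply, TensorProduct.smul_tmul',
      smul_eq_mul, mul_one, TensorProduct.tmul_smul]

/-- The same dictionary for lattices in `V`, whose base change is defined as a span. -/
lemma equivVR_mem_latVR (Q : Submodule B (L ⊗[A] F)) (y : R ⊗[A] (L ⊗[A] F)) :
    equivVR A B L R F y ∈ latVR F R Q ↔ y ∈ (Q.restrictScalars A).baseChange R := by
  constructor
  · intro h
    rw [← (equivVR A B L R F).symm_apply_apply y]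
    generalize equivVR A B L R F y = x at h
    -- The span is the additive closure of the scalar multiples of its generators, so only elements
    -- `c • q` with `q` a generator have to be treated.
    induction h using Submodule.closure_induction with
    | zero => simp
    | add x x' _ _ h h' =>
      rw [map_add]
      exact add_mem h h'
    | smul_mem c x hx =>
      obtain ⟨q, hq, rfl⟩ := hx
      induction c with
      | zero => simp
      | add c c' h h' =>
        rw [add_smul, map_add]
        exact add_mem h h'
      | tmul b r =>
        rw [tmul_smul_inclVR, LinearEquiv.symm_apply_apply]
        exact Submodule.tmul_mem_baseChange_of_mem _
          ((Submodule.restrictScalars_mem A Q _).2 (Q.smul_mem b hq))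
  · rintro ⟨z, rfl⟩
    induction z with
    | zero => simp
    | add z z' h h' =>
      rw [map_add, map_add]
      exact add_mem h h'
    | tmul r q =>
      rw [LinearMap.baseChange_tmul]
      have := tmul_smul_inclVR (1 : B) r (q : L ⊗[A] F)
      rw [one_smul] at this
      rw [Submodule.subtype_apply, ← this]
      exact Submodule.smul_mem _ _ (Submodule.subset_span ⟨q, q.2, rfl⟩)

end BaseChangeEquiv

/-! ### Lattices of endomorphisms and their base change -/

section Endomorphisms

variable (A B L R F : Type*) [CommRing A] [CommRing B] [Algebra A B] [AddCommGroup L] [Module B L]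
  [Module A L] [IsScalarTower A B L] [CommRing R] [Algebra A R] [Field F] [Algebra A F]

/-- The algebra homomorphism `R ⊗ End_B L → End (L ⊗ R)`. -/
def endBaseChange : R ⊗[A] Module.End B L →ₐ[A] Module.End (B ⊗[A] R) (LR A B L R) :=
  Algebra.TensorProduct.lift
    ((IsScalarTower.toAlgHom A (B ⊗[A] R) (Module.End (B ⊗[A] R) (LR A B L R))).comp
      Algebra.TensorProduct.includeRight)
    ((Module.End.baseChangeHom B (B ⊗[A] R) L).restrictScalars A)
    (fun r n => by
      rw [AlgHom.comp_apply, IsScalarTower.coe_toAlgHom']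
      exact Algebra.commutes _ _)

variable {A B L R F}

lemma endBaseChange_tmul (r : R) (n : Module.End B L) :
    endBaseChange A B L R (r ⊗ₜ[A] n) = ((1 : B) ⊗ₜ[A] r) • n.baseChange (B ⊗[A] R) := by
  rw [endBaseChange, Algebra.TensorProduct.lift_tmul, Algebra.smul_def]
  rfl

/-- Evaluation at a vector of `L` commutes with base change. The condition that `p` be sent into `Q`
thereby becomes a preimage under an `A`-linear map. -/
lemma endBaseChange_apply_tmul (y : R ⊗[A] Module.End B L) (p : L) :
    endBaseChange A B L R y ((1 : B ⊗[A] R) ⊗ₜ[B] p) =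
      equivLR A B L R ((LinearMap.applyₗ' A p).lTensor R y) := by
  induction y with
  | zero => simp
  | add y y' h h' => rw [map_add, LinearMap.add_apply, h, h', map_add, map_add]
  | tmul r n =>
    rw [endBaseChange_tmul, LinearMap.lTensor_tmul, equivLR_tmul, LinearMap.smul_apply,
      LinearMap.baseChange_tmul, TensorProduct.smul_tmul', smul_eq_mul, mul_one]
    rfl

/-- Evaluation at `x ∈ V` of the extension of an endomorphism of `L` to `V`. -/
def evalV (x : L ⊗[A] F) : Module.End B L →ₗ[A] L ⊗[A] F where
  toFun n := (n.restrictScalars A).rTensor F x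
  map_add' n n' := by
    rw [LinearMap.restrictScalars_add, LinearMap.rTensor_add, LinearMap.add_apply]
  map_smul' a n := by
    have : (a • n).restrictScalars A = a • n.restrictScalars A := rfl
    rw [this, LinearMap.rTensor_smul, LinearMap.smul_apply]
    rfl

lemma evalV_apply (x : L ⊗[A] F) (n : Module.End B L) :
    evalV x n = (n.restrictScalars A).rTensor F x := rfl

lemma endV_endBaseChange (y : R ⊗[A] Module.End B L) (x : L ⊗[A] F) :
    endV F R (endBaseChange A B L R y) (inclVR A B L R F x) =
      equivVR A B L R F ((evalV x).lTensor R y) := by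
  induction y with
  | zero =>
    have : endV F R (0 : Module.End (B ⊗[A] R) (LR A B L R)) = 0 :=
      TensorProduct.AlgebraTensorModule.ext fun _ _ => by simp [endV]
    simp [this]
  | add y y' h h' =>
    rw [map_add, map_add, map_add, ← h, ← h', endV, TensorProduct.AlgebraTensorModule.map_add_left]
    rfl
  | tmul r n =>
    rw [LinearMap.lTensor_tmul]
    induction x with
    | zero => rw [evalV_apply, map_zero, map_zero, map_zero, TensorProduct.tmul_zero, map_zero]
    | add x x' h h' =>
      rw [map_add, map_add, h, h', ← map_add, ← TensorProduct.tmul_add, evalV_apply, evalV_apply,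
        evalV_apply, map_add]
    | tmul l a =>
      rw [evalV_apply, LinearMap.rTensor_tmul, LinearMap.rTensor_tmul, equivVR_tmul_tmul,
        endBaseChange_tmul, endV, TensorProduct.AlgebraTensorModule.map_tmul]
      simp only [LinearMap.coe_restrictScalars, TensorProduct.mk_apply, LinearMap.smul_apply,
        LinearMap.baseChange_tmul, TensorProduct.smul_tmul', smul_eq_mul, mul_one, LinearMap.id_apply]

variable (A B L R) in
-- An endomorphism is determined by the images of a basis of `L`, so both sides are finite products
-- of copies of `L ⊗ R`.
lemma endBaseChange_bijective [Module.Free B L] [Module.Finite B L] :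
    Function.Bijective (endBaseChange A B L R) := by
  let b := Module.Free.chooseBasis B L
  let ι := Module.Free.ChooseBasisIndex B L
  let e : R ⊗[A] Module.End B L ≃ₗ[A] Module.End (B ⊗[A] R) (LR A B L R) :=
    LinearEquiv.lTensor R (b.constr A).symm ≪≫ₗ
    TensorProduct.piRight A A R (fun _ : ι => L) ≪≫ₗ
    LinearEquiv.piCongrRight (fun _ => equivLR A B L R) ≪≫ₗ
    ((b.baseChange (B ⊗[A] R)).constr A)
  have he : (endBaseChange A B L R).toLinearMap = e.toLinearMap := by
    refine TensorProduct.ext' fun r n => (b.baseChange (B ⊗[A] R)).ext fun i => ?_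
    simp only [e, LinearEquiv.coe_coe, LinearEquiv.trans_apply, Module.Basis.constr_basis]
    rw [AlgHom.toLinearMap_apply, Module.Basis.baseChange_apply, endBaseChange_apply_tmul]
    simp [Module.Basis.constr]
  have : ⇑(endBaseChange A B L R) = ⇑e := by
    ext1 y
    exact congr($he y)
  rw [this]
  exact e.bijective

section Lattice

variable (PL : Set (Submodule B L × Submodule B L))
  (PV : Set (Submodule B (L ⊗[A] F) × Submodule B (L ⊗[A] F)))

/-- The endomorphisms of `L` mapping `P` to `Q`, for given pairs `(P, Q)` of sublattices of `L`
and of lattices in `V`. -/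
def endLattice : Submodule A (Module.End B L) where
  carrier := {n | (∀ pq ∈ PL, ∀ x ∈ pq.1, n x ∈ pq.2) ∧
    ∀ pq ∈ PV, ∀ x ∈ pq.1, evalV x n ∈ pq.2}
  zero_mem' := ⟨fun pq _ x _ => zero_mem _, fun pq _ x _ => by rw [map_zero]; exact zero_mem _⟩
  add_mem' h h' := ⟨fun pq hpq x hx => add_mem (h.1 pq hpq x hx) (h'.1 pq hpq x hx),
    fun pq hpq x hx => by rw [map_add]; exact add_mem (h.2 pq hpq x hx) (h'.2 pq hpq x hx)⟩
  smul_mem' a n h := ⟨fun pq hpq x hx => by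
      rw [LinearMap.smul_apply, ← algebraMap_smul B a]
      exact Submodule.smul_mem _ _ (h.1 pq hpq x hx),
    fun pq hpq x hx => by
      rw [map_smul, ← algebraMap_smul B a]
      exact Submodule.smul_mem _ _ (h.2 pq hpq x hx)⟩

/-- For each pair, `n'` maps `P` into `Q`, which lies in `P`, and `n` maps it again into `Q`. -/
lemma mul_mem_endLattice (hPL : ∀ pq ∈ PL, pq.2 ≤ pq.1) (hPV : ∀ pq ∈ PV, pq.2 ≤ pq.1)
    {n n' : Module.End B L} (hn : n ∈ endLattice PL PV) (hn' : n' ∈ endLattice PL PV) :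
    n * n' ∈ endLattice PL PV := by
  refine ⟨fun pq hpq x hx => ?_, fun pq hpq x hx => ?_⟩
  · exact hn.1 pq hpq _ (hPL pq hpq (hn'.1 pq hpq x hx))
  · have := hn.2 pq hpq _ (hPV pq hpq (hn'.2 pq hpq x hx))
    rw [evalV_apply, evalV_apply, ← LinearMap.comp_apply, ← LinearMap.rTensor_comp] at this
    exact this

/-- The condition defining the base change of `endLattice`. -/
structure EndCond (n : Module.End (B ⊗[A] R) (LR A B L R)) : Prop where
  map_mem : ∀ pq ∈ PL, ∀ x ∈ pq.1.baseChange (B ⊗[A] R), n x ∈ pq.2.baseChange (B ⊗[A] R)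
  endV_mem : ∀ pq ∈ PV, ∀ x ∈ latVR F R pq.1, endV F R n x ∈ latVR F R pq.2

variable [IsDomain A] [IsPrincipalIdealRing A] [Module.Finite A (Module.End B L)]

/-- Each condition at one vector is a preimage under an evaluation map, and flat base change
commutes with preimages. The vectors form an infinite family; the multiplier `c` makes their
intersection finite. The converse needs only generators of the base changed lattices. -/
lemma endCond_iff [Module.Flat A R] {c : A} (hc : c ≠ 0)
    (hcn : ∀ n : Module.End B L, c • n ∈ endLattice PL PV) (y : R ⊗[A] Module.End B L) :
    EndCond PL PV (endBaseChange A B L R y) ↔ y ∈ (endLattice PL PV).baseChange R := by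
  constructor
  · intro h
    let S : ((Σ pq : PL, pq.1.1) ⊕ (Σ pq : PV, pq.1.1)) → Submodule A (Module.End B L) :=
      Sum.elim (fun j => (j.1.1.2.restrictScalars A).comap (LinearMap.applyₗ' A j.2.1))
        (fun j => (j.1.1.2.restrictScalars A).comap (evalV j.2.1))
    have hS : ∀ j x, c • x ∈ S j := by
      rintro (⟨pq, p⟩ | ⟨pq, p⟩) n
      · exact (hcn n).1 pq pq.2 p p.2
      · exact (hcn n).2 pq pq.2 p p.2
    have := mem_baseChange_inf_iInf R ⊤ S hc hS (y := y) (by simp) ?_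
    · have hle : (⊤ ⊓ ⨅ j, S j) ≤ endLattice PL PV := by
        intro n hn
        rw [Submodule.mem_inf, Submodule.mem_iInf] at hn
        exact ⟨fun pq hpq x hx => hn.2 (.inl ⟨⟨pq, hpq⟩, ⟨x, hx⟩⟩),
          fun pq hpq x hx => hn.2 (.inr ⟨⟨pq, hpq⟩, ⟨x, hx⟩⟩)⟩
      exact Submodule.baseChange_mono R hle this
    · rintro (⟨pq, p⟩ | ⟨pq, p⟩)
      · refine mem_baseChange_comap R _ _ ?_
        rw [← equivLR_mem_baseChange, ← endBaseChange_apply_tmul]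
        exact h.map_mem pq pq.2 _ (Submodule.tmul_mem_baseChange_of_mem _ p.2)
      · refine mem_baseChange_comap R _ _ ?_
        rw [← equivVR_mem_latVR, ← endV_endBaseChange]
        exact h.endV_mem pq pq.2 _ (Submodule.subset_span ⟨p, p.2, rfl⟩)
  · intro h
    refine ⟨fun pq hpq x hx => ?_, fun pq hpq x hx => ?_⟩
    · obtain ⟨z, rfl⟩ := hx
      induction z with
      | zero => simp
      | add z z' h h' =>
        rw [map_add, map_add]
        exact add_mem h h'
      | tmul d p =>
        have : (d ⊗ₜ[B] (p : L) : LR A B L R) = d • ((1 : B ⊗[A] R) ⊗ₜ[B] (p : L)) := by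
          rw [TensorProduct.smul_tmul', smul_eq_mul, mul_one]
        rw [LinearMap.baseChange_tmul, Submodule.subtype_apply, this, map_smul,
          endBaseChange_apply_tmul]
        refine Submodule.smul_mem _ _ ((equivLR_mem_baseChange _ _).2 ?_)
        exact lTensor_mem_baseChange R _ (P := endLattice PL PV) (fun n hn => hn.1 pq hpq p p.2) h
    · induction hx using Submodule.closure_induction with
      | zero => simp
      | add x x' _ _ h h' =>
        rw [map_add]
        exact add_mem h h'
      | smul_mem d x hx =>
        obtain ⟨p, hp, rfl⟩ := hx
        rw [map_smul, endV_endBaseChange]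
        refine Submodule.smul_mem _ _ ((equivVR_mem_latVR _ _).2 ?_)
        exact lTensor_mem_baseChange R _ (P := endLattice PL PV) (fun n hn => hn.2 pq hpq p hp) h

end Lattice

end Endomorphisms

end

/-! ### Divisibility for the lattices `A_i`, `B_i`, `W_i`, `X_i`, `Z_i` -/

section CaseTwo

variable {A B : Type*} [CommRing A] [CommRing B] [Algebra A B] (D : Case2 A B)

namespace Case2

lemma ξ_eq : D.ξ = -D.π ^ 2 := by
  rw [ξ, D.σ_π]
  ring

lemma σ_π_pow (i : ℕ) : D.σ (D.π ^ i) = (-1) ^ i * D.π ^ i := by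
  rw [map_pow, D.σ_π, neg_pow]

lemma σ_π_pow_mul (i : ℕ) : D.σ (D.π ^ i) * D.π ^ i = D.ξ ^ i := by
  rw [map_pow, ← mul_pow, ξ, mul_comm]

lemma π_pow_dvd_σ {i : ℕ} {b : B} (hb : D.π ^ i ∣ b) : D.π ^ i ∣ D.σ b := by
  obtain ⟨c, rfl⟩ := hb
  rw [map_mul, D.σ_π_pow]
  exact ((dvd_refl _).mul_left _).mul_right _

/-- `ξ = -π² = -2δ` with `δ` a unit, so `ξ` and 2 are associates. -/
lemma ξ_dvd_two (hδ : IsUnit D.δ) : D.ξ ∣ 2 := by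
  rw [ξ_eq, D.π_sq, map_mul, map_ofNat, neg_dvd]
  exact ((hδ.map (algebraMap A B)).mul_right_dvd).2 dvd_rfl

lemma ξ_pow_mul_two_dvd (hδ : IsUnit D.δ) (m : ℕ) : D.ξ ^ m * 2 ∣ 2 ^ (m + 1) := by
  rw [pow_succ]
  exact mul_dvd_mul_right (pow_dvd_pow_of_dvd (D.ξ_dvd_two hδ) m) 2

lemma ξ_pow_mul_four_dvd (hδ : IsUnit D.δ) (m : ℕ) : D.ξ ^ m * 4 ∣ 2 ^ (m + 2) := by
  rw [pow_add, show (2 : B) ^ 2 = 4 by norm_num]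
  exact mul_dvd_mul_right (pow_dvd_pow_of_dvd (D.ξ_dvd_two hδ) m) 4

lemma π_dvd_two (hδ : IsUnit D.δ) : D.π ∣ 2 := by
  refine dvd_trans ?_ (D.ξ_dvd_two hδ)
  exact Dvd.intro _ rfl

end Case2

variable {D} {L : Type*} [AddCommGroup L] [Module B L] (h : HermForm (D.conj : B →+* B) L)

lemma form_symm (x y : L) : h.form y x = D.σ (h.form x y) := h.symm x y

lemma π_pow_dvd_form_left {i : ℕ} {x : L} (hx : x ∈ latA h i) (y : L) :
    D.π ^ i ∣ h.form y x := by
  rw [form_symm h x y]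
  exact D.π_pow_dvd_σ (hx y)

lemma π_pow_smul_mem_latA (i : ℕ) (z : L) : D.π ^ i • z ∈ latA h i := by
  intro y
  rw [form_smul_left, D.σ_π_pow]
  exact ((dvd_refl _).mul_left _).mul_right _

/-- `h(x, x)` is fixed by `σ`, so its double is its trace. -/
lemma two_pow_dvd_two_mul_form {i : ℕ} {x : L} (hx : x ∈ latA h i) :
    (2 : B) ^ ((i + 1) / 2 + 1) ∣ 2 * h.form x x := by
  have := D.dvd_trace i (hx x)
  rwa [← form_symm h x x, ← two_mul] at this

lemma latW_le_latA (i : ℕ) : latW h i ≤ latA h i := by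
  refine sup_le (fun x hx => hx.1) (Submodule.span_le.2 ?_)
  rintro e ⟨-, he⟩
  exact he.1

lemma latX_le_latA (i : ℕ) : latX h i ≤ latA h i := fun _ hx => hx.1

lemma latZ_le_latB (i : ℕ) : latZ h i ≤ latB h i := fun _ hx => hx.1

lemma latX_le_latW (i : ℕ) : latX h i ≤ latW h i := le_sup_left

lemma form_four_smul (x y : L) : h.form ((4 : B) • x) y = 4 * h.form x y := by
  rw [form_smul_left, map_ofNat]

/-- This is the source of the factor 4 in the constant `4d²` that bounds all the conditions. -/
lemma four_smul_mem (hδ : IsUnit D.δ) {i : ℕ} {x : L} (hx : x ∈ latA h i) :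
    (4 : B) • x ∈ latB h i ⊓ latX h i ⊓ latZ h i := by
  have hA : (4 : B) • x ∈ latA h i := Submodule.smul_mem _ _ hx
  have h4 : (4 : B) = 2 * 2 := by norm_num
  have hxx : h.form ((4 : B) • x) ((4 : B) • x) = 2 * (2 * 2) * (2 * h.form x x) := by
    rw [form_four_smul, map_smul, smul_eq_mul]
    ring
  have hB : (4 : B) • x ∈ latB h i := by
    refine ⟨hA, ?_⟩
    rw [hxx]
    exact (two_pow_dvd_two_mul_form h hx).mul_left _
  refine ⟨⟨hB, hA, fun y _ => ?_⟩, hB, fun y _ => ?_, ?_⟩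
  · rw [form_four_smul, h4, pow_succ, mul_comm (D.π ^ i)]
    exact mul_dvd_mul ((D.π_dvd_two hδ).mul_right _) (hx y)
  · have : h.form ((4 : B) • x) y + h.form y ((4 : B) • x) =
        2 * (2 * (h.form x y + D.σ (h.form x y))) := by
      rw [form_four_smul, map_smul, smul_eq_mul, form_symm h x y]
      ring
    rw [this, show i / 2 + 2 = (i / 2 + 1) + 1 by rfl, pow_succ']
    refine mul_dvd_mul_left _ (dvd_mul_of_dvd_right ?_ _)
    -- The exponent in `latZ` is built from `i / 2`, that of the trace bound from `(i + 1) / 2`,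
    -- which is at least as large.
    exact (pow_dvd_pow _ (by omega)).trans (D.dvd_trace i (hx y))
  · rw [hxx, mul_assoc, show i / 2 + 2 = (i / 2 + 1) + 1 by rfl, pow_succ']
    refine mul_dvd_mul_left _ (dvd_mul_of_dvd_right ?_ _)
    exact (pow_dvd_pow _ (by omega)).trans (two_pow_dvd_two_mul_form h hx)

/-- For even `i`, the pairing of `B_i` and `W_i` is divisible by `π ^ (i + 1)`. -/
lemma π_pow_dvd_form_latB_latW [IsDomain B] [IsPrincipalIdealRing B] (hδ : IsUnit D.δ)
    {i : ℕ} (hi : Even i) {b w : L} (hb : b ∈ latB h i) (hw : w ∈ latW h i) :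
    D.π ^ (i + 1) ∣ h.form b w := by
  have hπ : Prime D.π := D.irreducible_π.prime
  obtain ⟨m, rfl⟩ := even_iff_two_dvd.1 hi
  let K : Submodule B L :=
    { carrier := {w | D.π ^ (2 * m + 1) ∣ h.form b w}
      zero_mem' := by simp
      add_mem' := fun hx hy => by
        simp only [Set.mem_ofPred_eq, map_add] at *
        exact dvd_add hx hy
      smul_mem' := fun c x hx => by
        simp only [Set.mem_ofPred_eq, map_smul, smul_eq_mul] at *
        exact hx.mul_left c }
  suffices latW h (2 * m) ≤ K from this hw
  refine sup_le (fun x hx => ?_) (Submodule.span_le.2 ?_)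
  -- For vectors of `X_i` the bound is the definition, conjugated.
  · have : h.form b x = D.σ (h.form x b) := h.symm x b
    change _ ∣ h.form b x
    rw [this]
    exact D.π_pow_dvd_σ (hx.2 b hb.1)
  · rintro e ⟨-, he⟩
    change _ ∣ h.form b e
    obtain ⟨u, hu⟩ := hb.1 e
    have hm : 2 * m / 2 = m := by omega
    have h1 := he.2 b hb.1
    have h2 := hb.2
    rw [hm] at h1
    rw [show (2 * m + 1) / 2 + 1 = m + 1 by omega] at h2
    have hπ2 : D.π ^ 2 ∣ 2 := by
      have := D.ξ_dvd_two hδ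
      rwa [D.ξ_eq, neg_dvd] at this
    have hξ : ∀ k, (D.π ^ 2) ^ k ∣ D.ξ ^ k := fun k =>
      pow_dvd_pow_of_dvd (by rw [D.ξ_eq, dvd_neg]) k
    -- For a characteristic vector `e`, `h(b, e)²` is congruent to `ξ^m h(b, b)` modulo `π^(4m+1)`.
    -- That term vanishes there since `2^(m+1)` divides `h(b, b)` and `π²` divides 2. With `h(b, e)
    -- = π^(2m) u` it follows that `π` divides `u²`, hence `u`.
    have h3 : (D.π ^ 2) ^ (2 * m) * D.π ∣ D.ξ ^ m * h.form b b := by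
      calc (D.π ^ 2) ^ (2 * m) * D.π ∣ (D.π ^ 2) ^ m * (D.π ^ 2) ^ (m + 1) :=
            ⟨D.π, by ring⟩
        _ ∣ D.ξ ^ m * h.form b b :=
            mul_dvd_mul (hξ m) ((pow_dvd_pow_of_dvd hπ2 (m + 1)).trans h2)
    have h4 : (D.π ^ 2) ^ (2 * m) * D.π ∣ (D.π ^ 2) ^ (2 * m) * u ^ 2 := by
      have h5 := dvd_add ((mul_dvd_mul_right (hξ (2 * m)) D.π).trans h1) h3
      rw [sub_add_cancel, hu] at h5
      convert h5 using 1
      ring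
    have h6 : D.π ∣ u ^ 2 := (mul_dvd_mul_iff_left (pow_ne_zero _ (pow_ne_zero 2 hπ.ne_zero))).1 h4
    rw [hu, pow_succ]
    exact mul_dvd_mul_left _ (hπ.dvd_of_dvd_pow h6)

end CaseTwo

/-! ### Bounding the dual lattice by nondegeneracy -/

section Bound

variable {A B : Type*} [CommRing A] [CommRing B] [Algebra A B] {D : Case2 A B}
  {L : Type*} [AddCommGroup L] [Module B L] (h : HermForm (D.conj : B →+* B) L)
  [Module A L] [IsScalarTower A B L]

/-- `d ≠ 0` bounds the index of `L` in its dual: if `t` divides `h (x, L)`, then `d x` is divisible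
by the conjugate of `t`. -/
structure IsDualBound (d : A) : Prop where
  ne_zero : d ≠ 0
  exists_smul : ∀ (t : B) (x : L), (∀ y, t ∣ h.form x y) → ∃ z, d • x = D.σ t • z

variable (F : Type*) [Field F] [Algebra A F]

lemma extend_tmul_tmul (x y : L) (a b : F) :
    h.extend F (x ⊗ₜ a) (y ⊗ₜ b) = h.form x y ⊗ₜ[A] (a * b) := by
  simp [HermForm.extend]

variable [IsDomain A] [IsDomain B] [Module.Finite A B] [Module.Free A B]
  [Module.Finite B L] [Module.Free B L]

/-- A vector in the kernel of the Gram matrix gives a nonzero element of `L` orthogonal to `L`. It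
stays nonzero in `V` because `L` is flat over `A`, contradicting nondegeneracy. -/
lemma gram_det_ne_zero (hAF : Function.Injective (algebraMap A F))
    (nondegenerate : ∀ x : L ⊗[A] F, (∀ y, h.extend F x y = 0) → x = 0)
    {ι : Type*} [Fintype ι] [DecidableEq ι] (e : Module.Basis ι B L) :
    (Matrix.of fun i j => h.form (e i) (e j)).det ≠ 0 := by
  intro hdet
  obtain ⟨v, hv, hv0⟩ := Matrix.exists_vecMul_eq_zero_iff.2 hdet
  -- The form is `σ`-linear in its first variable, so the coordinates have to be conjugated.
  let x : L := ∑ i, D.σ (v i) • e i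
  have hx : h.form x = 0 := by
    refine e.ext fun j => ?_
    have := congrFun hv0 j
    simp only [x, map_sum, LinearMap.sum_apply, form_smul_left, D.σ_σ]
    exact this
  have hx1 : x ⊗ₜ[A] (1 : F) = 0 := by
    refine nondegenerate _ fun y => ?_
    induction y with
    | zero => simp
    | add y y' hy hy' => rw [map_add, hy, hy', add_zero]
    | tmul y a => rw [extend_tmul_tmul, hx, LinearMap.zero_apply, TensorProduct.zero_tmul]
  have : FaithfulSMul A F := (faithfulSMul_iff_algebraMap_injective A F).2 hAF
  have : Module.Free A L := Module.Free.trans (S := B)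
  have hx0 : x = 0 := by
    refine Module.Flat.tensorProduct_mk_injective (R := A) (S := F) L ?_
    have := congrArg (TensorProduct.comm A L F) hx1
    rw [TensorProduct.comm_tmul, map_zero] at this
    rw [TensorProduct.mk_apply, this, map_zero]
  refine hv (funext fun i => ?_)
  have h1 := Fintype.linearIndependent_iff.1 e.linearIndependent _ hx0 i
  rw [← D.σ_σ (v i), h1, map_zero, Pi.zero_apply]

lemma exists_isDualBound (hAF : Function.Injective (algebraMap A F))
    (nondegenerate : ∀ x : L ⊗[A] F, (∀ y, h.extend F x y = 0) → x = 0) :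
    ∃ d : A, IsDualBound h d := by
  classical
  let e := Module.Free.chooseBasis B L
  let G := Matrix.of fun i j => h.form (e i) (e j)
  have hG : D.σ G.det ≠ 0 := by
    rw [Ne, EmbeddingLike.map_eq_zero_iff]
    exact gram_det_ne_zero h F hAF nondegenerate e
  -- `B` is integral over `A`, so some multiple of `σ(det G)` is a nonzero element `d` of `A`.
  have hI : (Ideal.span {D.σ G.det}).comap (algebraMap A B) ≠ ⊥ :=
    Ideal.comap_ne_bot_of_integral_mem hG (Ideal.mem_span_singleton_self _)
      (Algebra.IsIntegral.isIntegral _)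
  obtain ⟨d, hd, hd0⟩ := Submodule.exists_mem_ne_zero_of_ne_bot hI
  rw [Ideal.mem_comap, Ideal.mem_span_singleton] at hd
  obtain ⟨q, hq⟩ := hd
  refine ⟨d, hd0, fun t x hx => ?_⟩
  choose c hc using fun j => hx (e j)
  have h1 : Matrix.vecMul (fun i => D.σ (e.repr x i)) G = t • c := by
    ext j
    rw [Pi.smul_apply, smul_eq_mul, ← hc j]
    conv_rhs => rw [← e.sum_repr x]
    simp only [map_sum, LinearMap.sum_apply, form_smul_left]
    rfl
  -- Cramer's rule: the adjugate turns divisibility of `h(x, e_j)` by `t` into divisibility of `det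
  -- G` times the conjugated coordinates of `x`.
  have h2 : ∀ i, D.σ (e.repr x i) * G.det = t * Matrix.vecMul c G.adjugate i := by
    intro i
    have := congrArg (fun v => Matrix.vecMul v G.adjugate i) h1
    simp only [Matrix.vecMul_vecMul, Matrix.mul_adjugate, Matrix.smul_vecMul, Matrix.vecMul_smul,
      Matrix.vecMul_one, Pi.smul_apply, smul_eq_mul] at this
    rw [mul_comm, this]
  -- Conjugating the Cramer identity and multiplying by `q`, where `d = σ(det G) q`, gives these
  -- coordinates.
  refine ⟨∑ i, (q * D.σ (Matrix.vecMul c G.adjugate i)) • e i, ?_⟩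
  conv_lhs => rw [← e.sum_repr x]
  rw [Finset.smul_sum, Finset.smul_sum]
  refine Finset.sum_congr rfl fun i _ => ?_
  rw [← algebraMap_smul B d, hq, smul_smul, smul_smul]
  congr 1
  have := congrArg D.σ (h2 i)
  rw [map_mul, map_mul, D.σ_σ] at this
  linear_combination q * this

end Bound

/-! ### A common multiplier for the conditions on endomorphisms -/

section Bound

variable {A B : Type*} [CommRing A] [CommRing B] [Algebra A B] {D : Case2 A B}
  {L : Type*} [AddCommGroup L] [Module B L] (h : HermForm (D.conj : B →+* B) L)
  [Module A L] [IsScalarTower A B L] (F : Type*) [Field F] [Algebra A F]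

lemma extend_smul_right (b : B) (x y : L ⊗[A] F) :
    h.extend F x (b • y) = (b ⊗ₜ[A] (1 : F)) * h.extend F x y := by
  induction y with
  | zero => simp
  | add y y' hy hy' => rw [smul_add, map_add, hy, hy', map_add, mul_add]
  | tmul y c =>
    induction x with
    | zero => simp
    | add x x' hx hx' => rw [map_add, LinearMap.add_apply, hx, hx', LinearMap.add_apply, mul_add]
    | tmul x a => simp [HermForm.extend, TensorProduct.smul_tmul']

lemma extend_smul_comm (b : B) (x y : L ⊗[A] F) :
    h.extend F (b • x) y = h.extend F x (D.σ b • y) := by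
  rw [extend_smul_left, extend_smul_right]

lemma evalV_smul (b : B) (x : L ⊗[A] F) (n : Module.End B L) :
    evalV (b • x) n = b • evalV x n := by
  rw [evalV_apply, evalV_apply]
  induction x with
  | zero => simp
  | add x x' hx hx' => rw [smul_add, map_add, hx, hx', map_add, smul_add]
  | tmul x a => simp [TensorProduct.smul_tmul']

lemma evalV_tmul (x : L) (a : F) (n : Module.End B L) :
    evalV (x ⊗ₜ[A] a) n = n x ⊗ₜ[A] a := rfl

variable {h} {d : A}

lemma IsDualBound.exists_of_mem_latA (hd : IsDualBound h d) {i : ℕ} {x : L}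
    (hx : x ∈ latA h i) : ∃ z, d • x = D.σ (D.π ^ i) • z :=
  hd.exists_smul _ x hx

lemma σ_π_pow_smul_mem_latA (h : HermForm (D.conj : B →+* B) L) (i : ℕ) (z : L) :
    D.σ (D.π ^ i) • z ∈ latA h i := by
  rw [D.σ_π_pow, mul_smul]
  exact Submodule.smul_mem _ _ (π_pow_smul_mem_latA h i z)

/-- `d A_i` lies in `π^i L`, which `n` preserves and which is contained in `A_i`; then 4 carries
`A_i` into the smaller lattices. The second factor `d` is slack, kept so that the same constant
serves for lattices in `V`. -/
lemma IsDualBound.smul_apply_mem (hd : IsDualBound h d) (hδ : IsUnit D.δ) {i : ℕ}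
    (n : Module.End B L) {x : L} (hx : x ∈ latA h i) :
    ((4 * d ^ 2) • n) x ∈ latB h i ⊓ latX h i ⊓ latZ h i := by
  obtain ⟨z, hz⟩ := hd.exists_of_mem_latA hx
  have h1 : d • n x ∈ latA h i := by
    rw [← algebraMap_smul B d, ← map_smul, algebraMap_smul, hz, map_smul]
    exact σ_π_pow_smul_mem_latA h i _
  have h2 : ((4 * d ^ 2) • n) x = algebraMap A B d • (4 : B) • (d • n x) := by
    rw [LinearMap.smul_apply, ← algebraMap_smul B (4 * d ^ 2), ← algebraMap_smul B d, smul_smul,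
      smul_smul]
    congr 1
    rw [map_mul, map_pow, map_ofNat]
    ring
  rw [h2]
  exact Submodule.smul_mem _ _ (four_smul_mem h hδ h1)

variable [IsDomain A] [IsFractionRing A F]

omit [Module B L] [IsScalarTower A B L] in
variable (A) in
lemma exists_smul_eq_tmul_one (x : L ⊗[A] F) :
    ∃ s : A, s ≠ 0 ∧ ∃ x₀ : L, s • x = x₀ ⊗ₜ[A] (1 : F) := by
  induction x with
  | zero => exact ⟨1, one_ne_zero, 0, by simp⟩
  | add x x' hx hx' =>
    obtain ⟨s, hs, y, hy⟩ := hx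
    obtain ⟨s', hs', y', hy'⟩ := hx'
    refine ⟨s * s', mul_ne_zero hs hs', s' • y + s • y', ?_⟩
    rw [smul_add, TensorProduct.add_tmul, mul_comm s, mul_smul, hy, mul_comm s', mul_smul, hy',
      TensorProduct.smul_tmul', TensorProduct.smul_tmul']
  | tmul l a =>
    obtain ⟨⟨s, hs⟩, r, hr⟩ := IsLocalization.exists_integer_multiple (nonZeroDivisors A) a
    refine ⟨s, nonZeroDivisors.ne_zero hs, r • l, ?_⟩
    rw [TensorProduct.smul_tmul, ← TensorProduct.tmul_smul]
    congr 1
    rw [← Algebra.algebraMap_eq_smul_one, hr]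

variable [IsDomain B] [Module.Finite A B] [Module.Free A B] [Module.Free B L]

/-- Elements of the dual of `B_i` have bounded denominators. -/
lemma IsDualBound.exists_of_mem_dualLat (hd : IsDualBound h d) (hδ : IsUnit D.δ) {i : ℕ}
    {x : L ⊗[A] F} (hx : x ∈ dualLat h F (latB h i)) :
    ∃ y : L, (algebraMap A B (4 * d) * D.π ^ i) • x = y ⊗ₜ[A] (1 : F) := by
  obtain ⟨s, hs, x₀, hx₀⟩ := exists_smul_eq_tmul_one A F x
  have hinj : Function.Injective fun b : B => b ⊗ₜ[A] (1 : F) :=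
    Algebra.TensorProduct.includeLeft_injective (S := A) (IsFractionRing.injective A F)
  -- The vector `4 σ(π^i) y` lies in `B_i`, so its pairing with `x = x₀/s` is integral. Moving the
  -- scalar to the first variable makes `s` divide `h(4 π^i x₀, y)`.
  have hdiv : ∀ y, algebraMap A B s ∣ h.form (((4 : B) * D.π ^ i) • x₀) y := by
    intro y
    have hy : (4 : B) • D.σ (D.π ^ i) • y ∈ latB h i :=
      (four_smul_mem h hδ (σ_π_pow_smul_mem_latA h i y)).1.1
    obtain ⟨c, hc⟩ := hx _ hy
    refine ⟨c, hinj ?_⟩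
    have h1 := congrArg (s • ·) hc
    rw [← LinearMap.smul_apply, ← map_smul, hx₀, extend_tmul_tmul, TensorProduct.smul_tmul',
      Algebra.smul_def] at h1
    simp only [← h1, mul_one]
    congr 1
    rw [form_smul_left, map_smul, map_smul, map_mul, map_ofNat]
    simp only [smul_eq_mul]
    ring
  obtain ⟨z, hz⟩ := hd.exists_smul _ _ hdiv
  rw [AlgEquiv.commutes, algebraMap_smul] at hz
  refine ⟨z, ?_⟩
  have : Module.Flat A F := IsLocalization.flat F (nonZeroDivisors A)
  have : Module.Free A L := Module.Free.trans (S := B)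
  have : Module.IsTorsionFree A (L ⊗[A] F) := inferInstance
  -- The dual bound gives `4d π^i x₀ = s z`; the denominator `s` cancels because `V` is torsion-free
  -- over `A`.
  refine smul_right_injective _ hs ?_
  simp only
  rw [TensorProduct.smul_tmul', ← hz, smul_comm, hx₀, TensorProduct.smul_tmul',
    ← algebraMap_smul B d, smul_smul, map_mul, map_ofNat]
  congr 2
  ring

/-- One `d`, together with `4 π^i`, clears the denominators of `x`; the other `d` makes `y`
divisible by `σ(π^i)`. Moving this scalar across the form supplies the power of `π` that `x` needs.
-/
lemma IsDualBound.smul_evalV_mem (hd : IsDualBound h d) (hδ : IsUnit D.δ) {i : ℕ}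
    (n : Module.End B L) {x : L ⊗[A] F} (hx : x ∈ dualLat h F (latB h i)) :
    evalV x ((4 * d ^ 2) • n) ∈ dualLat h F (latA h i) := by
  intro y hy
  obtain ⟨x', hx'⟩ := hd.exists_of_mem_dualLat F hδ hx
  obtain ⟨z, hz⟩ := hd.exists_of_mem_latA hy
  refine ⟨h.form (n x') z, ?_⟩
  have h1 : h.extend F (evalV x ((4 * d ^ 2) • n)) (y ⊗ₜ[A] (1 : F)) =
      h.extend F (algebraMap A B (4 * d) • evalV x n) ((d • y) ⊗ₜ[A] (1 : F)) := by
    rw [map_smul, map_smul, algebraMap_smul, map_smul, ← TensorProduct.smul_tmul', map_smul,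
      LinearMap.smul_apply, LinearMap.smul_apply, smul_smul]
    congr 1
    ring
  rw [h1, hz, ← TensorProduct.smul_tmul', ← extend_smul_comm, smul_smul, mul_comm (D.π ^ i),
    ← evalV_smul, hx', evalV_tmul, extend_tmul_tmul, mul_one]

end Bound

/-! ### The conditions defining `M(R)` as linear conditions on `m - 1` -/

section RepresentM

variable {A B : Type*} [CommRing A] [CommRing B] [Algebra A B] {D : Case2 A B}
  {L : Type*} [AddCommGroup L] [Module B L] (h : HermForm (D.conj : B →+* B) L)
  [Module A L] [IsScalarTower A B L] (F : Type*) [Field F] [Algebra A F]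
  {R : Type*} [CommRing R] [Algebra A R]

/-- The pairs of sublattices `(P, Q)` of `L` such that `m - 1` has to map `P` to `Q`. -/
inductive MPair : Submodule B L × Submodule B L → Prop
  | AA (i : ℕ) : MPair (latA h i, latA h i)
  | BB (i : ℕ) : MPair (latB h i, latB h i)
  | WW (i : ℕ) : MPair (latW h i, latW h i)
  | XX (i : ℕ) : MPair (latX h i, latX h i)
  | ZZ (i : ℕ) (hi : Even i) : MPair (latZ h i, latZ h i)
  | AB (i : ℕ) : MPair (latA h i, latB h i)
  | WXZ (i : ℕ) (hi : Even i) : MPair (latW h i, latX h i ⊓ latZ h i)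

/-- The pairs of lattices `(P, Q)` in `V` such that `m - 1` has to map `P` to `Q`. -/
inductive MPairV : Submodule B (L ⊗[A] F) × Submodule B (L ⊗[A] F) → Prop
  | dual (i : ℕ) (hi : Odd i) : MPairV (dualLat h F (latB h i), dualLat h F (latA h i))

lemma endV_sub_one (m : Module.End (B ⊗[A] R) (LR A B L R)) (x : LR A B L R ⊗[A] F) :
    endV F R (m - 1) x = endV F R m x - x := by
  induction x with
  | zero => simp
  | add x x' hx hx' =>
    rw [map_add, map_add, hx, hx']
    abel
  | tmul l a =>
    rw [endV, endV, TensorProduct.AlgebraTensorModule.map_tmul,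
      TensorProduct.AlgebraTensorModule.map_tmul, LinearMap.sub_apply, TensorProduct.sub_tmul]
    rfl

lemma one_add_sub_one (n : Module.End (B ⊗[A] R) (LR A B L R)) : 1 + n - 1 = n :=
  LinearMap.ext fun x => by
    rw [LinearMap.sub_apply, LinearMap.add_apply, add_sub_cancel_left]

/-- As 1 preserves every lattice, stability of `P` under `m` means that `m - 1` maps `P` to `P`. All
conditions thus become inclusions, linear in `m - 1`. -/
lemma mCond_iff (m : Module.End (B ⊗[A] R) (LR A B L R)) :
    MCond h F R m ↔ EndCond {pq | MPair h pq} {pq | MPairV h F pq} (m - 1) := by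
  constructor
  · intro hm
    refine ⟨?_, ?_⟩
    · rintro _ (i | i | i | i | ⟨i, hi⟩ | i | ⟨i, hi⟩) x hx
      · exact sub_mem (hm.stabA i x hx) hx
      · exact sub_mem (hm.stabB i x hx) hx
      · exact sub_mem (hm.stabW i x hx) hx
      · exact sub_mem (hm.stabX i x hx) hx
      · exact sub_mem (hm.stabZ i hi x hx) hx
      · exact hm.idAB i x hx
      · exact hm.idWXZ i hi x hx
    · rintro _ ⟨i, hi⟩ x hx
      rw [endV_sub_one]
      exact hm.idDual i hi x hx
  · intro hm
    have stab (P : Submodule B L) (hP : MPair h (P, P)) (x : LR A B L R)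
        (hx : x ∈ P.baseChange (B ⊗[A] R)) : m x ∈ P.baseChange (B ⊗[A] R) := by
      have := add_mem (hm.map_mem _ hP x hx) hx
      rwa [LinearMap.sub_apply, Module.End.one_apply, sub_add_cancel] at this
    exact
      { stabA := fun i => stab _ (.AA i)
        stabB := fun i => stab _ (.BB i)
        stabW := fun i => stab _ (.WW i)
        stabX := fun i => stab _ (.XX i)
        stabZ := fun i hi => stab _ (.ZZ i hi)
        idAB := fun i x hx => hm.map_mem (latA h i, latB h i) (.AB i) x hx
        idWXZ := fun i hi x hx => hm.map_mem (latW h i, latX h i ⊓ latZ h i) (.WXZ i hi) x hx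
        idDual := fun i hi x hx => by
          rw [← endV_sub_one]
          exact hm.endV_mem _ (.dual i hi) x hx }

variable {h} in
lemma IsDualBound.smul_mem_endLattice [IsDomain A] [IsFractionRing A F] [IsDomain B]
    [Module.Finite A B] [Module.Free A B] [Module.Free B L] {d : A} (hd : IsDualBound h d)
    (hδ : IsUnit D.δ) (n : Module.End B L) :
    (4 * d ^ 2) • n ∈ endLattice {pq | MPair h pq} {pq | MPairV h F pq} := by
  refine ⟨?_, ?_⟩
  · have key {i : ℕ} {x : L} (hx : x ∈ latA h i) := hd.smul_apply_mem hδ n hx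
    rintro _ (i | i | i | i | ⟨i, hi⟩ | i | ⟨i, hi⟩) x hx
    · exact latB_le_latA h i (key hx).1.1
    · exact (key (latB_le_latA h i hx)).1.1
    · exact latX_le_latW h i (key (latW_le_latA h i hx)).1.2
    · exact (key (latX_le_latA h i hx)).1.2
    · exact (key (latB_le_latA h i (latZ_le_latB h i hx))).2
    · exact (key hx).1.1
    · exact ⟨(key (latW_le_latA h i hx)).1.2, (key (latW_le_latA h i hx)).2⟩
  · rintro _ ⟨i, hi⟩ x hx
    exact hd.smul_evalV_mem F hδ n hx

end RepresentM

/-! ### Representability of `M*` -/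

section MStar

variable {A : Type u} {B : Type*} [CommRing A] [CommRing B] [Algebra A B] {D : Case2 A B}
  {L : Type*} [AddCommGroup L] [Module B L] (h : HermForm (D.conj : B →+* B) L)
  [Module A L] [IsScalarTower A B L] (F : Type*) [Field F] [Algebra A F]

lemma mapLR_tmul {R R' : Type*} [CommRing R] [Algebra A R] [CommRing R'] [Algebra A R']
    (φ : R →ₐ[A] R') (c : B ⊗[A] R) (l : L) :
    mapLR B L φ (c ⊗ₜ[B] l) = Algebra.TensorProduct.map (AlgHom.id B B) φ c ⊗ₜ[B] l := rfl

lemma endBaseChange_rTensor {R R' : Type*} [CommRing R] [Algebra A R] [CommRing R'] [Algebra A R']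
    (φ : R →ₐ[A] R') (y : R ⊗[A] Module.End B L) (x : LR A B L R) :
    endBaseChange A B L R' (φ.toLinearMap.rTensor _ y) (mapLR B L φ x) =
      mapLR B L φ (endBaseChange A B L R y x) := by
  induction y with
  | zero => simp
  | add y y' hy hy' => rw [map_add, map_add, map_add, LinearMap.add_apply, LinearMap.add_apply,
      map_add, hy, hy']
  | tmul r n =>
    rw [LinearMap.rTensor_tmul, endBaseChange_tmul, endBaseChange_tmul]
    induction x using TensorProduct.induction_on with
    | zero => simp
    | add x x' hx hx' => rw [map_add, map_add, hx, hx', map_add, map_add]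
    | tmul c l =>
      simp only [mapLR_tmul, LinearMap.smul_apply, LinearMap.baseChange_tmul,
        TensorProduct.smul_tmul', smul_eq_mul, map_mul]
      rfl

/-- The coordinate of `m` is `m - 1`, which ranges over `S ⊗ R` for a lattice `S` of endomorphisms.
`S` is closed under products because each target lattice lies in its source, so the criterion for
units applies. -/
theorem nonempty_mStarModel [IsDomain A] [IsPrincipalIdealRing A] [IsFractionRing A F] [IsDomain B]
    [Module.Finite A B] [Module.Free A B] [Module.Free B L] [Module.Finite B L]
    {d : A} (hd : IsDualBound h d) (hδ : IsUnit D.δ) (h4 : (4 : A) ≠ 0) :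
    Nonempty (MStarModel h F) := by
  have : Module.Free A (Module.End B L) := Module.Free.trans (S := B)
  have : Module.Finite A (Module.End B L) := Module.Finite.trans B _
  let ψ (R : Type u) [CommRing R] [Algebra A R] :=
    AlgEquiv.ofBijective _ (endBaseChange_bijective A B L R)
  have hc : 4 * d ^ 2 ≠ 0 := mul_ne_zero h4 (pow_ne_zero 2 hd.ne_zero)
  let S := endLattice {pq | MPair h pq} {pq | MPairV h F pq}
  have hψ (R : Type u) [CommRing R] [Algebra A R] [Module.Flat A R] (y : R ⊗[A] Module.End B L) :
      MCond h F R (ψ R (1 + y)) ↔ y ∈ S.baseChange R := by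
    rw [mCond_iff, map_add, map_one, one_add_sub_one]
    exact endCond_iff _ _ hc (hd.smul_mem_endLattice F hδ) y
  refine FlatModel.nonempty_of_units S ?_ (fun R _ _ _ m => (ψ R).symm m.1.1 - 1) ?_ ?_ ?_
  · intro x hx y hy
    refine mul_mem_endLattice _ _ ?_ ?_ hx hy
    · rintro _ (i | i | i | i | ⟨i, hi⟩ | i | ⟨i, hi⟩)
      · exact le_rfl
      · exact le_rfl
      · exact le_rfl
      · exact le_rfl
      · exact le_rfl
      · exact latB_le_latA h i
      · exact inf_le_latW h i
    · rintro _ ⟨i, hi⟩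
      exact dualLat_anti h F (latB_le_latA h i)
  · intro R _ _ _ m m' hmm
    exact Units.ext (Subtype.ext ((ψ R).symm.injective (sub_left_injective hmm)))
  · intro R _ _ _ y
    have hmem (m : M h F R) : (ψ R).symm m.1 - 1 ∈ S.baseChange R := by
      rw [← hψ, add_sub_cancel, AlgEquiv.apply_symm_apply]
      exact m.2
    constructor
    · rintro ⟨m, rfl⟩
      refine ⟨hmem m.1, _, hmem m.2, ?_, ?_⟩
      · rw [add_sub_cancel, add_sub_cancel, ← map_mul]
        exact (congrArg (ψ R).symm (congrArg Subtype.val m.3)).trans (map_one _)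
      · rw [add_sub_cancel, add_sub_cancel, ← map_mul]
        exact (congrArg (ψ R).symm (congrArg Subtype.val m.4)).trans (map_one _)
    · rintro ⟨hy, y', hy', h1, h2⟩
      refine ⟨⟨⟨ψ R (1 + y), (hψ R y).2 hy⟩, ⟨ψ R (1 + y'), (hψ R y').2 hy'⟩,
        Subtype.ext ?_, Subtype.ext ?_⟩, ?_⟩
      · change ψ R (1 + y) * ψ R (1 + y') = 1
        rw [← map_mul, h1, map_one]
      · change ψ R (1 + y') * ψ R (1 + y) = 1
        rw [← map_mul, h2, map_one]
      · simp
  · intro R R' _ _ _ _ _ _ φ m m' hmm x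
    have h1 : (ψ R').symm m'.1.1 = φ.toLinearMap.rTensor _ ((ψ R).symm m.1.1) := by
      have h2 : φ.toLinearMap.rTensor (Module.End B L) 1 = 1 := by
        rw [Algebra.TensorProduct.one_def, LinearMap.rTensor_tmul, AlgHom.toLinearMap_apply,
          map_one, Algebra.TensorProduct.one_def]
      have h3 := hmm
      rw [map_sub, h2] at h3
      exact sub_left_injective h3
    have h4 := endBaseChange_rTensor φ ((ψ R).symm m.1.1) x
    rw [← h1] at h4
    change ψ R' _ _ = mapLR B L φ (ψ R _ _) at h4
    rwa [AlgEquiv.apply_symm_apply, AlgEquiv.apply_symm_apply] at h4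

end MStar

noncomputable section

/-! ### Sesquilinear forms and Gram matrices -/

section Gram

variable {C : Type*} [CommRing C] {s : C →+* C} {N : Type*} [AddCommGroup N] [Module C N]
  {ι : Type*} [Fintype ι] (e : Module.Basis ι C N)

/-- The sesquilinear form with given Gram matrix with respect to a basis. -/
def gramForm (s : C →+* C) (G : ι × ι → C) : N →ₛₗ[s] N →ₗ[C] C :=
  LinearMap.mk₂'ₛₗ s (RingHom.id C)
    (fun x y => ∑ i, ∑ j, s (e.repr x i) * G (i, j) * e.repr y j)
    (fun x x' y => by
      simp only [map_add, Finsupp.add_apply, add_mul, Finset.sum_add_distrib])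
    (fun c x y => by
      simp only [map_smul, Finsupp.smul_apply, smul_eq_mul, map_mul, Finset.mul_sum, mul_assoc])
    (fun x y y' => by
      simp only [map_add, Finsupp.add_apply, mul_add, Finset.sum_add_distrib])
    (fun c x y => by
      simp only [map_smul, Finsupp.smul_apply, smul_eq_mul, Finset.mul_sum, RingHom.id_apply]
      exact Finset.sum_congr rfl fun i _ => Finset.sum_congr rfl fun j _ => by ring)

lemma gramForm_apply (G : ι × ι → C) (x y : N) :
    gramForm e s G x y = ∑ i, ∑ j, s (e.repr x i) * G (i, j) * e.repr y j := rfl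

lemma gramForm_basis (G : ι × ι → C) (i j : ι) : gramForm e s G (e i) (e j) = G (i, j) := by
  classical
  rw [gramForm_apply, Finset.sum_eq_single i, Finset.sum_eq_single j]
  · simp
  · intro k _ hk
    simp [hk]
  · simp
  · intro k _ hk
    simp [hk]
  · simp

lemma gramForm_gram (f : N →ₛₗ[s] N →ₗ[C] C) : gramForm e s (fun p => f (e p.1) (e p.2)) = f :=
  e.ext fun i => e.ext fun j => gramForm_basis e _ i j

/-- The hermitian form with given Gram matrix. -/
def hermOfGram (hs : ∀ c, s (s c) = c) (G : ι × ι → C) (hG : ∀ i j, G (j, i) = s (G (i, j))) :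
    HermForm s N where
  form := gramForm e s G
  symm x y := by
    simp only [gramForm_apply, map_sum, map_mul, hs]
    rw [Finset.sum_comm]
    refine Finset.sum_congr rfl fun i _ => Finset.sum_congr rfl fun j _ => ?_
    rw [hG i j]
    ring

namespace HermForm

/-- The sum of two hermitian forms. -/
def add (f g : HermForm s N) : HermForm s N where
  form := f.form + g.form
  symm x y := by
    simp only [LinearMap.add_apply, map_add, f.symm x y, g.symm x y]

/-- The difference of two hermitian forms. -/
def sub (f g : HermForm s N) : HermForm s N where
  form := f.form - g.form
  symm x y := by
    simp only [LinearMap.sub_apply, map_sub, f.symm x y, g.symm x y]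

lemma add_sub_self (f g : HermForm s N) : (f.add g).sub f = g := by
  ext x y
  exact add_sub_cancel_left _ _

end HermForm

end Gram

/-! ### Lattices of Gram matrices and their base change -/

section GramBaseChange

variable (A B L R F : Type*) [CommRing A] [CommRing B] [Algebra A B] [AddCommGroup L] [Module B L]
  [Module A L] [IsScalarTower A B L] [CommRing R] [Algebra A R] [Field F] [Algebra A F]
  {ι : Type*} [Fintype ι]

/-- Gram matrices over `R` are obtained by base change. -/
def equivGram (ι : Type*) [Fintype ι] : R ⊗[A] (ι × ι → B) ≃ₗ[A] (ι × ι → B ⊗[A] R) :=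
  haveI := Classical.decEq ι
  TensorProduct.piRight A A R (fun _ : ι × ι => B) ≪≫ₗ
    LinearEquiv.piCongrRight (fun _ => TensorProduct.comm A R B)

variable {A B L R F}

lemma equivGram_tmul (r : R) (G : ι × ι → B) (p : ι × ι) :
    equivGram A B R ι (r ⊗ₜ[A] G) p = G p ⊗ₜ[A] r := by
  simp [equivGram]

/-- Divisibility conditions are thereby membership in a base changed submodule, the form required by
the flatness arguments. -/
lemma comm_mem_iff_dvd (t : B) (w : R ⊗[A] B) :
    t ⊗ₜ[A] (1 : R) ∣ TensorProduct.comm A R B w ↔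
      w ∈ ((Ideal.span {t}).restrictScalars A).baseChange R := by
  constructor
  · rintro ⟨c, hc⟩
    have : w = (TensorProduct.comm A R B).symm (t ⊗ₜ[A] (1 : R) * c) := by
      rw [← hc, LinearEquiv.symm_apply_apply]
    rw [this]
    clear hc this
    induction c with
    | zero => simp
    | add c c' h h' =>
      rw [mul_add, map_add]
      exact add_mem h h'
    | tmul b r =>
      rw [Algebra.TensorProduct.tmul_mul_tmul, TensorProduct.comm_symm_tmul]
      exact Submodule.tmul_mem_baseChange_of_mem _
        (Ideal.mul_mem_right b _ (Ideal.mem_span_singleton_self t))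
  · rintro ⟨z, rfl⟩
    induction z with
    | zero => simp
    | add z z' h h' =>
      rw [map_add, map_add]
      exact dvd_add h h'
    | tmul r q =>
      obtain ⟨b, hb⟩ := Ideal.mem_span_singleton.1 q.2
      rw [LinearMap.baseChange_tmul, TensorProduct.comm_tmul, Submodule.subtype_apply, hb]
      exact ⟨b ⊗ₜ[A] r, by rw [Algebra.TensorProduct.tmul_mul_tmul, one_mul]⟩

variable (A B R F) in
/-- The isomorphism `r ⊗ (b ⊗ a) ↦ (b ⊗ r) ⊗ a`. -/
def equivER : R ⊗[A] (B ⊗[A] F) ≃ₗ[A] (B ⊗[A] R) ⊗[A] F :=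
  (TensorProduct.assoc A R B F).symm ≪≫ₗ
    TensorProduct.congr (TensorProduct.comm A R B) (LinearEquiv.refl A F)

lemma equivER_tmul (r : R) (b : B) (a : F) :
    equivER A B R F (r ⊗ₜ[A] (b ⊗ₜ[A] a)) = (b ⊗ₜ[A] r) ⊗ₜ[A] a := by
  simp [equivER]

variable (A B F) in
/-- The image of `B` in `E = B ⊗ F`. -/
def integersE : Submodule A (B ⊗[A] F) := LinearMap.range ((TensorProduct.mk A B F).flip 1)

lemma mem_integersE (z : B ⊗[A] F) : z ∈ integersE A B F ↔ ∃ c : B, z = c ⊗ₜ[A] (1 : F) :=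
  ⟨fun ⟨c, hc⟩ => ⟨c, hc.symm⟩, fun ⟨c, hc⟩ => ⟨c, hc.symm⟩⟩

lemma equivER_mem_iff (w : R ⊗[A] (B ⊗[A] F)) :
    (∃ c : B ⊗[A] R, equivER A B R F w = c ⊗ₜ[A] (1 : F)) ↔
      w ∈ (integersE A B F).baseChange R := by
  constructor
  · rintro ⟨c, hc⟩
    rw [← LinearEquiv.eq_symm_apply] at hc
    rw [hc]
    clear hc
    induction c with
    | zero => simp
    | add c c' h h' =>
      rw [TensorProduct.add_tmul, map_add]
      exact add_mem h h'
    | tmul b r =>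
      rw [← equivER_tmul, LinearEquiv.symm_apply_apply]
      exact Submodule.tmul_mem_baseChange_of_mem _ ⟨b, rfl⟩
  · rintro ⟨z, rfl⟩
    induction z with
    | zero => exact ⟨0, by simp⟩
    | add z z' h h' =>
      obtain ⟨c, hc⟩ := h
      obtain ⟨c', hc'⟩ := h'
      exact ⟨c + c', by rw [map_add, map_add, hc, hc', TensorProduct.add_tmul]⟩
    | tmul r q =>
      obtain ⟨b, hb⟩ := q.2
      refine ⟨b ⊗ₜ[A] r, ?_⟩
      rw [LinearMap.baseChange_tmul, Submodule.subtype_apply, ← hb]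
      exact equivER_tmul r b 1

variable (e : Module.Basis ι B L) (s : B →ₐ[A] B)

/-- The value at `(x, y)` of the form with a given Gram matrix. -/
def gramEval (x y : L) : (ι × ι → B) →ₗ[A] B where
  toFun G := gramForm e (s : B →+* B) G x y
  map_add' G G' := by
    simp only [gramForm_apply, Pi.add_apply, mul_add, add_mul, Finset.sum_add_distrib]
  map_smul' a G := by
    simp only [gramForm_apply, Pi.smul_apply, Finset.smul_sum, RingHom.id_apply,
      Algebra.mul_smul_comm, Algebra.smul_mul_assoc]

lemma gramEval_apply (x y : L) (G : ι × ι → B) :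
    gramEval e s x y G = gramForm e (s : B →+* B) G x y := rfl

/-- The value at `(x, y)`, for `y ∈ V`, of the form with a given Gram matrix. -/
def gramEvalV (x : L) (y : L ⊗[A] F) : (ι × ι → B) →ₗ[A] B ⊗[A] F where
  toFun G := ((gramForm e (s : B →+* B) G x).restrictScalars A).rTensor F y
  map_add' G G' := by
    rw [← LinearMap.add_apply, ← LinearMap.rTensor_add]
    congr 2
    ext z
    exact map_add (gramEval e s x z) G G'
  map_smul' a G := by
    rw [RingHom.id_apply, ← LinearMap.smul_apply, ← LinearMap.rTensor_smul]
    congr 2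
    ext z
    exact map_smul (gramEval e s x z) a G

lemma gramEvalV_apply (x : L) (y : L ⊗[A] F) (G : ι × ι → B) :
    gramEvalV e s x y G = ((gramForm e (s : B →+* B) G x).restrictScalars A).rTensor F y := rfl

variable (R) in
/-- The base change of an `A`-algebra endomorphism of `B`. -/
abbrev mapR : B ⊗[A] R →+* B ⊗[A] R :=
  (Algebra.TensorProduct.map s (AlgHom.id A R) : B ⊗[A] R →ₐ[A] B ⊗[A] R)

lemma gramForm_add {C : Type*} [CommRing C] {s : C →+* C} {N : Type*} [AddCommGroup N]
    [Module C N] (e : Module.Basis ι C N) (G G' : ι × ι → C) :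
    gramForm e s (G + G') = gramForm e s G + gramForm e s G' := by
  ext x y
  simp only [gramForm_apply, LinearMap.add_apply, Pi.add_apply, mul_add, add_mul,
    Finset.sum_add_distrib]

lemma gramForm_zero {C : Type*} [CommRing C] {s : C →+* C} {N : Type*} [AddCommGroup N]
    [Module C N] (e : Module.Basis ι C N) :
    gramForm e s (0 : ι × ι → C) = 0 := by
  ext x y
  simp [gramForm_apply]

/-- The value at a fixed pair of vectors is `A`-linear in the Gram matrix and commutes with base
change, so each divisibility condition is a preimage. -/
lemma gramForm_equivGram (y : R ⊗[A] (ι × ι → B)) (x a : L) :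
    gramForm (e.baseChange (B ⊗[A] R)) (mapR R s) (equivGram A B R ι y) (1 ⊗ₜ[B] x) (1 ⊗ₜ[B] a) =
      TensorProduct.comm A R B ((gramEval e s x a).lTensor R y) := by
  induction y with
  | zero => simp [gramForm_zero]
  | add y y' h h' =>
    rw [map_add, gramForm_add, LinearMap.add_apply, LinearMap.add_apply, h, h', map_add, map_add]
  | tmul r G =>
    rw [LinearMap.lTensor_tmul, TensorProduct.comm_tmul, gramEval_apply, gramForm_apply,
      gramForm_apply]
    simp only [TensorProduct.sum_tmul, equivGram_tmul]
    refine Finset.sum_congr rfl fun i _ => Finset.sum_congr rfl fun j _ => ?_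
    rw [Module.Basis.baseChange_repr_tmul, Module.Basis.baseChange_repr_tmul]
    simp [Algebra.smul_def]

lemma gramForm_equivGram_V (y : R ⊗[A] (ι × ι → B)) (x : L) (v : L ⊗[A] F) :
    ((gramForm (e.baseChange (B ⊗[A] R)) (mapR R s) (equivGram A B R ι y)
      (1 ⊗ₜ[B] x)).restrictScalars A).rTensor F (inclVR A B L R F v) =
      equivER A B R F ((gramEvalV e s x v).lTensor R y) := by
  induction v with
  | zero =>
    have : gramEvalV e s x (0 : L ⊗[A] F) = 0 := by
      ext1 G
      rw [gramEvalV_apply, map_zero, LinearMap.zero_apply]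
    rw [this]
    simp
  | add v v' h h' =>
    have : gramEvalV e s x (v + v') = gramEvalV e s x v + gramEvalV e s x v' := by
      ext1 G
      rw [LinearMap.add_apply, gramEvalV_apply, map_add]
      rfl
    rw [this, LinearMap.lTensor_add, LinearMap.add_apply, map_add, map_add, map_add, h, h']
  | tmul a f =>
    rw [LinearMap.rTensor_tmul, LinearMap.rTensor_tmul]
    have h1 := gramForm_equivGram e s y x a
    simp only [LinearMap.coe_restrictScalars, TensorProduct.mk_apply, h1]
    clear h1
    induction y with
    | zero => simp
    | add y y' h h' => rw [map_add, map_add, TensorProduct.add_tmul, h, h', map_add, map_add]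
    | tmul r G =>
      rw [LinearMap.lTensor_tmul, LinearMap.lTensor_tmul, TensorProduct.comm_tmul, gramEvalV_apply,
        LinearMap.rTensor_tmul, equivER_tmul]
      rfl

/-- The difference of the conjugate transpose of a matrix and the matrix itself. -/
def hermDefect (ι : Type*) : (ι × ι → B) →ₗ[A] (ι × ι → B) where
  toFun G p := G (p.2, p.1) - s (G p)
  map_add' G G' := by
    ext p
    simp only [Pi.add_apply, map_add]
    ring
  map_smul' a G := by
    ext p
    simp only [Pi.smul_apply, map_smul, smul_sub, RingHom.id_apply]

lemma equivGram_hermDefect (y : R ⊗[A] (ι × ι → B)) (p : ι × ι) :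
    equivGram A B R ι ((hermDefect s ι).lTensor R y) p =
      equivGram A B R ι y (p.2, p.1) - mapR R s (equivGram A B R ι y p) := by
  induction y with
  | zero => simp
  | add y y' h h' =>
    simp only [map_add, Pi.add_apply, h, h']
    ring
  | tmul r G =>
    rw [LinearMap.lTensor_tmul, equivGram_tmul, equivGram_tmul, equivGram_tmul]
    simp [hermDefect, TensorProduct.sub_tmul]

section Lattice

variable (T : Set (L × L × B)) (TV : Set (L × (L ⊗[A] F)))

/-- The Gram matrices of the hermitian forms on `L` whose value at `(x, y)` is divisible by `t`
for given triples `(x, y, t)`, and whose value at `(x, v)` is integral for given pairs `(x, v)`. -/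
def gramLattice : Submodule A (ι × ι → B) :=
  LinearMap.ker (hermDefect s ι) ⊓
    ⨅ j : T ⊕ TV, Sum.elim
      (fun j : T => ((Ideal.span {j.1.2.2}).restrictScalars A).comap (gramEval e s j.1.1 j.1.2.1))
      (fun j : TV => (integersE A B F).comap (gramEvalV e s j.1.1 j.1.2)) j

/-- The condition defining the base change of `gramLattice`. -/
structure GramCond (f : LR A B L R →ₛₗ[mapR R s] LR A B L R →ₗ[B ⊗[A] R] B ⊗[A] R) : Prop where
  dvd : ∀ x y t, (x, y, t) ∈ T → t ⊗ₜ[A] (1 : R) ∣ f (1 ⊗ₜ[B] x) (1 ⊗ₜ[B] y)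
  integral : ∀ x v, (x, v) ∈ TV → ∃ c : B ⊗[A] R,
    ((f (1 ⊗ₜ[B] x)).restrictScalars A).rTensor F (inclVR A B L R F v) = c ⊗ₜ[A] (1 : F)

variable [IsDomain A] [IsPrincipalIdealRing A] [Module.Finite A B]

/-- The argument is that of `endCond_iff`, except for hermitian symmetry: it is the kernel of an
`A`-linear map and need not contain multiples of all matrices. It is therefore kept apart from the
family bounded by `c`. -/
lemma gramCond_iff [Module.Flat A R] {c : A} (hc : c ≠ 0)
    (hT : ∀ x y t, (x, y, t) ∈ T → ∀ G, t ∣ c • gramForm e (s : B →+* B) G x y)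
    (hTV : ∀ x v, (x, v) ∈ TV → ∀ G, c • gramEvalV e s x v G ∈ integersE A B F)
    (y : R ⊗[A] (ι × ι → B)) :
    ((∀ i j, equivGram A B R ι y (j, i) = mapR R s (equivGram A B R ι y (i, j))) ∧
      GramCond s T TV (gramForm (e.baseChange (B ⊗[A] R)) (mapR R s) (equivGram A B R ι y))) ↔
    y ∈ (gramLattice e s T TV).baseChange R := by
  constructor
  · rintro ⟨hsymm, hcond⟩
    refine mem_baseChange_inf_iInf R _ _ hc ?_ ?_ ?_
    · rintro (⟨⟨x, z, t⟩, hj⟩ | ⟨⟨x, v⟩, hj⟩) G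
      · refine Ideal.mem_span_singleton.2 ?_
        rw [map_smul]
        exact hT x z t hj G
      · change gramEvalV e s x v (c • G) ∈ integersE A B F
        rw [map_smul]
        exact hTV x v hj G
    · refine mem_baseChange_comap R (hermDefect s ι) ⊥ ?_
      rw [Submodule.baseChange_bot, Submodule.mem_bot]
      refine (equivGram A B R ι).injective (funext fun p => ?_)
      rw [equivGram_hermDefect, map_zero, Pi.zero_apply, hsymm p.1 p.2, sub_self]
    · rintro (⟨⟨x, z, t⟩, hj⟩ | ⟨⟨x, v⟩, hj⟩)
      · refine mem_baseChange_comap R _ _ ?_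
        rw [← comm_mem_iff_dvd, ← gramForm_equivGram]
        exact hcond.dvd x z t hj
      · refine mem_baseChange_comap R _ _ ?_
        rw [← equivER_mem_iff, ← gramForm_equivGram_V]
        exact hcond.integral x v hj
  · intro h
    have hle (j : T ⊕ TV) := (inf_le_right : gramLattice e s T TV ≤ _).trans (iInf_le _ j)
    refine ⟨fun i j => ?_, fun x z t hj => ?_, fun x v hj => ?_⟩
    · have h1 := lTensor_mem_baseChange R (hermDefect s ι) (P := gramLattice e s T TV) (Q := ⊥)
        (fun G hG => hG.1) h
      rw [Submodule.baseChange_bot, Submodule.mem_bot] at h1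
      have h2 := equivGram_hermDefect s y (i, j)
      rw [h1, map_zero, Pi.zero_apply] at h2
      exact sub_eq_zero.1 h2.symm
    · rw [gramForm_equivGram, comm_mem_iff_dvd]
      exact lTensor_mem_baseChange R (gramEval e s x z) (P := gramLattice e s T TV)
        (Q := (Ideal.span {t}).restrictScalars A) (fun G hG => hle (.inl ⟨_, hj⟩) hG) h
    · rw [gramForm_equivGram_V, equivER_mem_iff]
      exact lTensor_mem_baseChange R (gramEvalV e s x v) (P := gramLattice e s T TV)
        (Q := integersE A B F) (fun G hG => hle (.inr ⟨_, hj⟩) hG) h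

end Lattice

end GramBaseChange

end

/-! ### Hermitian forms extended to `V` -/

section Extend

variable {A : Type*} [CommRing A] {F : Type*} [CommRing F] [Algebra A F] {C : Type*} [CommRing C]
  [Algebra A C] {s : C →ₐ[A] C} {N : Type*} [AddCommGroup N] [Module C N] [Module A N]
  [IsScalarTower A C N]

omit [Algebra A C] in
lemma HermForm.form_smul_left {s : C →+* C} (f : HermForm s N) (c : C) (x y : N) :
    f.form (c • x) y = s c * f.form x y := by
  rw [LinearMap.map_smulₛₗ, LinearMap.smul_apply, smul_eq_mul]

lemma rTensor_restrictScalars_smul (φ : N →ₗ[C] C) (c : C) (v : N ⊗[A] F) :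
    (φ.restrictScalars A).rTensor F (c • v) =
      (c ⊗ₜ[A] (1 : F)) * (φ.restrictScalars A).rTensor F v := by
  induction v with
  | zero => simp
  | add v v' hv hv' => rw [smul_add, map_add, hv, hv', map_add, mul_add]
  | tmul n a => simp [TensorProduct.smul_tmul']

lemma rTensor_restrictScalars_smul_left (φ : N →ₗ[C] C) (c : C) (v : N ⊗[A] F) :
    ((c • φ).restrictScalars A).rTensor F v =
      (c ⊗ₜ[A] (1 : F)) * (φ.restrictScalars A).rTensor F v := by
  induction v with
  | zero => simp
  | add v v' hv hv' => rw [map_add, hv, hv', map_add, mul_add]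
  | tmul n a => simp

lemma HermForm.extend_tmul_one (f : HermForm (s : C →+* C) N) (x : N) (v : N ⊗[A] F) :
    f.extend F (x ⊗ₜ[A] (1 : F)) v = ((f.form x).restrictScalars A).rTensor F v := by
  induction v with
  | zero => simp
  | add v v' hv hv' => rw [map_add, hv, hv', map_add]
  | tmul n a => simp [HermForm.extend]

lemma HermForm.extend_symm (f : HermForm (s : C →+* C) N) (x y : N ⊗[A] F) :
    f.extend F y x = s.toLinearMap.rTensor F (f.extend F x y) := by
  induction x with
  | zero => simp
  | add x x' hx hx' => rw [map_add, hx, hx', map_add, LinearMap.add_apply, map_add]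
  | tmul n a =>
    induction y with
    | zero => simp
    | add y y' hy hy' => rw [map_add, LinearMap.add_apply, hy, hy', map_add, map_add]
    | tmul n' a' =>
      have (x y : N) (b c : F) : f.extend F (x ⊗ₜ b) (y ⊗ₜ c) = f.form x y ⊗ₜ[A] (b * c) := by
        simp [HermForm.extend]
      rw [this, this, LinearMap.rTensor_tmul, f.symm n n', mul_comm]
      rfl

lemma HermForm.extend_sub (f g : HermForm (s : C →+* C) N) (x : N) (v : N ⊗[A] F) :
    (f.sub g).extend F (x ⊗ₜ[A] (1 : F)) v =
      f.extend F (x ⊗ₜ[A] (1 : F)) v - g.extend F (x ⊗ₜ[A] (1 : F)) v := by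
  rw [extend_tmul_one, extend_tmul_one, extend_tmul_one, ← LinearMap.sub_apply,
    ← LinearMap.rTensor_sub]
  rfl

end Extend

/-! ### Testing base changed forms on generators -/

section BaseChangedForms

variable {A B : Type*} [CommRing A] [CommRing B] [Algebra A B] {D : Case2 A B}
  {L : Type*} [AddCommGroup L] [Module B L]
  {R : Type*} [CommRing R] [Algebra A R]

lemma baseChange_induction {P : Submodule B L} {motive : LR A B L R → Prop}
    (tmul : ∀ p ∈ P, motive (1 ⊗ₜ[B] p)) (zero : motive 0)
    (add : ∀ x y, motive x → motive y → motive (x + y))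
    (smul : ∀ (c : B ⊗[A] R) x, motive x → motive (c • x)) {x : LR A B L R}
    (hx : x ∈ P.baseChange (B ⊗[A] R)) : motive x := by
  rw [Submodule.baseChange_eq_span] at hx
  induction hx using Submodule.span_induction with
  | mem x hx =>
    obtain ⟨p, hp, rfl⟩ := hx
    exact tmul p hp
  | zero => exact zero
  | add x y _ _ hx hy => exact add x y hx hy
  | smul c x _ hx => exact smul c x hx

lemma one_tmul_mem {P : Submodule B L} {p : L} (hp : p ∈ P) :
    (1 : B ⊗[A] R) ⊗ₜ[B] p ∈ P.baseChange (B ⊗[A] R) :=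
  Submodule.tmul_mem_baseChange_of_mem _ hp

variable (R) in
lemma tmul_dvd_tmul {t b : B} (hb : t ∣ b) (r : R) : t ⊗ₜ[A] (1 : R) ∣ b ⊗ₜ[A] r := by
  obtain ⟨c, rfl⟩ := hb
  exact ⟨c ⊗ₜ[A] r, by rw [Algebra.TensorProduct.tmul_mul_tmul, one_mul]⟩

lemma dvd_trace_tmul (i : ℕ) {z : B ⊗[A] R} (hz : (D.π ^ i) ⊗ₜ[A] (1 : R) ∣ z) :
    ((2 : B) ^ ((i + 1) / 2 + 1)) ⊗ₜ[A] (1 : R) ∣ z + D.conjR R z := by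
  obtain ⟨c, rfl⟩ := hz
  induction c with
  | zero => simp
  | add c c' h h' =>
    rw [mul_add, map_add, add_add_add_comm]
    exact dvd_add h h'
  | tmul b r =>
    rw [Algebra.TensorProduct.tmul_mul_tmul, one_mul, Case2.conjR,
      Algebra.TensorProduct.map_tmul, AlgHom.id_apply, ← TensorProduct.add_tmul]
    exact tmul_dvd_tmul R (D.dvd_trace i (dvd_mul_right _ _)) r

section

variable (g : HermForm (D.conjR R : B ⊗[A] R →+* B ⊗[A] R) (LR A B L R))

lemma dvd_form_of_generators {P Q : Submodule B L} {t : B ⊗[A] R}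
    (H : ∀ p ∈ P, ∀ q ∈ Q, t ∣ g.form (1 ⊗ₜ[B] p) (1 ⊗ₜ[B] q)) {x y : LR A B L R}
    (hx : x ∈ P.baseChange (B ⊗[A] R)) (hy : y ∈ Q.baseChange (B ⊗[A] R)) : t ∣ g.form x y := by
  refine baseChange_induction (motive := fun x => t ∣ g.form x y) (fun p hp => ?_) ?_ ?_ ?_ hx
  · refine baseChange_induction (motive := fun y => t ∣ g.form _ y) (H p hp) ?_ ?_ ?_ hy
    · simp
    · intro y y' h h'
      rw [map_add]
      exact dvd_add h h'
    · intro c y h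
      rw [map_smul, smul_eq_mul]
      exact h.mul_left c
  · simp
  · intro y y' h h'
    rw [map_add, LinearMap.add_apply]
    exact dvd_add h h'
  · intro c y h
    rw [HermForm.form_smul_left]
    exact h.mul_left _

lemma form_add_self_tmul (x y : LR A B L R) :
    g.form (x + y) (x + y) =
      g.form x x + g.form y y + (g.form x y + D.conjR R (g.form x y)) := by
  have : g.form y x = D.conjR R (g.form x y) := g.symm x y
  rw [← this]; simp only [map_add, LinearMap.add_apply]; ring

/-- The map `x ↦ g(x, x)` is additive up to the traces `g(x, y) + σ(g(x, y))`, and scaling `x` by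
`c` multiplies it by `σ(c) c`. Divisibility of these traces therefore reduces the diagonal condition
to generators. -/
lemma dvd_form_self_of_generators {P : Submodule B L} {t : B ⊗[A] R}
    (H : ∀ p ∈ P, t ∣ g.form (1 ⊗ₜ[B] p) (1 ⊗ₜ[B] p))
    (H' : ∀ x ∈ P.baseChange (B ⊗[A] R), ∀ y ∈ P.baseChange (B ⊗[A] R),
      t ∣ g.form x y + D.conjR R (g.form x y)) {x : LR A B L R}
    (hx : x ∈ P.baseChange (B ⊗[A] R)) : t ∣ g.form x x := by
  refine (baseChange_induction (P := P)
    (motive := fun x => x ∈ P.baseChange (B ⊗[A] R) ∧ t ∣ g.form x x)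
    (fun p hp => ⟨one_tmul_mem hp, H p hp⟩) ⟨zero_mem _, by simp⟩ ?_ ?_ hx).2
  · rintro x y ⟨hx, h⟩ ⟨hy, h'⟩
    refine ⟨add_mem hx hy, ?_⟩
    rw [form_add_self_tmul]
    exact dvd_add (dvd_add h h') (H' x hx y hy)
  · rintro c x ⟨hx, h⟩
    refine ⟨Submodule.smul_mem _ c hx, ?_⟩
    rw [HermForm.form_smul_left, map_smul, smul_eq_mul]
    exact (h.mul_left _).mul_left _

end

variable (h : HermForm (D.conj : B →+* B) L)

lemma formR_one_tmul (x y : L) :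
    (formR h R).form (1 ⊗ₜ[B] x) (1 ⊗ₜ[B] y) = h.form x y ⊗ₜ[A] (1 : R) := by
  rw [formR_tmul, map_one, one_mul, Algebra.smul_def, mul_one]
  rfl

lemma dvd_formR {P Q : Submodule B L} {t : B} (H : ∀ p ∈ P, ∀ q ∈ Q, t ∣ h.form p q)
    {x y : LR A B L R} (hx : x ∈ P.baseChange (B ⊗[A] R)) (hy : y ∈ Q.baseChange (B ⊗[A] R)) :
    t ⊗ₜ[A] (1 : R) ∣ (formR h R).form x y := by
  refine dvd_form_of_generators _ (fun p hp q hq => ?_) hx hy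
  rw [formR_one_tmul]
  exact tmul_dvd_tmul R (H p hp q hq) 1

variable [Module A L] [IsScalarTower A B L] (F : Type*) [Field F] [Algebra A F]

lemma integral_of_generators (g : HermForm (D.conjR R : B ⊗[A] R →+* B ⊗[A] R) (LR A B L R))
    {P : Submodule B L} {Q : Submodule B (L ⊗[A] F)}
    (H : ∀ p ∈ P, ∀ v ∈ Q, ∃ c : B ⊗[A] R,
      g.extend F ((1 ⊗ₜ[B] p) ⊗ₜ[A] (1 : F)) (inclVR A B L R F v) = c ⊗ₜ[A] (1 : F))
    {x : LR A B L R} (hx : x ∈ P.baseChange (B ⊗[A] R)) {v : LR A B L R ⊗[A] F}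
    (hv : v ∈ latVR F R Q) :
    ∃ c : B ⊗[A] R, g.extend F (x ⊗ₜ[A] (1 : F)) v = c ⊗ₜ[A] (1 : F) := by
  refine baseChange_induction (motive := fun x => ∃ c : B ⊗[A] R,
    g.extend F (x ⊗ₜ[A] (1 : F)) v = c ⊗ₜ[A] (1 : F)) (fun p hp => ?_) ?_ ?_ ?_ hx
  · induction hv using Submodule.span_induction with
    | mem v hv =>
      obtain ⟨q, hq, rfl⟩ := hv
      exact H p hp q hq
    | zero => exact ⟨0, by simp⟩
    | add v v' _ _ h h' =>
      obtain ⟨c, hc⟩ := h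
      obtain ⟨c', hc'⟩ := h'
      exact ⟨c + c', by rw [map_add, hc, hc', TensorProduct.add_tmul]⟩
    | smul b v _ h =>
      obtain ⟨c, hc⟩ := h
      refine ⟨b * c, ?_⟩
      rw [HermForm.extend_tmul_one] at hc ⊢
      rw [rTensor_restrictScalars_smul, hc, Algebra.TensorProduct.tmul_mul_tmul, one_mul]
  · exact ⟨0, by simp⟩
  · rintro x x' ⟨c, hc⟩ ⟨c', hc'⟩
    exact ⟨c + c', by
      rw [TensorProduct.add_tmul, map_add, LinearMap.add_apply, hc, hc', TensorProduct.add_tmul]⟩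
  · rintro b x ⟨c, hc⟩
    refine ⟨D.conjR R b * c, ?_⟩
    rw [HermForm.extend_tmul_one] at hc ⊢
    rw [LinearMap.map_smulₛₗ, rTensor_restrictScalars_smul_left, hc,
      Algebra.TensorProduct.tmul_mul_tmul, one_mul]
    rfl

lemma extend_formR (x : L) (v : L ⊗[A] F) :
    (formR h R).extend F ((1 ⊗ₜ[B] x) ⊗ₜ[A] (1 : F)) (inclVR A B L R F v) =
      ((Algebra.TensorProduct.includeLeft : B →ₐ[A] B ⊗[A] R).toLinearMap).rTensor F
        (h.extend F (x ⊗ₜ[A] (1 : F)) v) := by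
  induction v with
  | zero => simp
  | add v v' hv hv' => rw [map_add, map_add, hv, hv', map_add, map_add]
  | tmul l a =>
    rw [HermForm.extend_tmul_one, HermForm.extend_tmul_one, LinearMap.rTensor_tmul,
      LinearMap.rTensor_tmul, LinearMap.rTensor_tmul, LinearMap.rTensor_tmul]
    congr 1
    exact formR_one_tmul h x l

variable {F} in
-- The dual is defined with its element in the first variable, so the value with the variables
-- exchanged is integral by conjugation.
lemma integral_formR {N : Submodule B L} {x : LR A B L R} (hx : x ∈ N.baseChange (B ⊗[A] R))
    {v : LR A B L R ⊗[A] F} (hv : v ∈ latVR F R (dualLat h F N)) :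
    ∃ c : B ⊗[A] R, (formR h R).extend F (x ⊗ₜ[A] (1 : F)) v = c ⊗ₜ[A] (1 : F) := by
  refine integral_of_generators F _ (fun p hp v hv => ?_) hx hv
  obtain ⟨c, hc⟩ := hv p hp
  refine ⟨D.conj c ⊗ₜ[A] 1, ?_⟩
  rw [extend_formR, h.extend_symm, hc, LinearMap.rTensor_tmul, LinearMap.rTensor_tmul]
  rfl

end BaseChangedForms

/-! ### The conditions defining `H(R)` as linear conditions on `f - h` -/

section RepresentH

variable {A B : Type*} [CommRing A] [CommRing B] [Algebra A B] {D : Case2 A B}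
  {L : Type*} [AddCommGroup L] [Module B L] (h : HermForm (D.conj : B →+* B) L)

/-- The triples `(x, y, t)` such that `t` has to divide `f (x, y) - h (x, y)`. -/
inductive HTest : L × L × B → Prop
  | A (i : ℕ) (x a : L) (ha : a ∈ latA h i) : HTest (x, a, D.π ^ i)
  | B (i : ℕ) (a : L) (ha : a ∈ latA h i) : HTest (a, a, D.ξ ^ ((i + 1) / 2) * 2)
  | C (i : ℕ) (hi : Even i) (a w : L) (ha : a ∈ latA h i) (hw : w ∈ latW h i) :
    HTest (a, w, D.π ^ (i + 1))
  | D (i : ℕ) (hi : Even i) (w : L) (hw : w ∈ latW h i) : HTest (w, w, D.ξ ^ (i / 2) * 4)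

variable [Module A L] [IsScalarTower A B L] (F : Type*) [Field F] [Algebra A F]

/-- The pairs `(x, v)` such that `f (x, v) - h (x, v)` has to be integral. -/
inductive HTestV : L × (L ⊗[A] F) → Prop
  | E (i : ℕ) (hi : Odd i) (a : L) (ha : a ∈ latA h i) (v : L ⊗[A] F)
    (hv : v ∈ dualLat h F (latB h i)) : HTestV (a, v)

variable {R : Type*} [CommRing R] [Algebra A R]

/-- Condition (a) holds for `h`, so it may be imposed on `f - h`. The diagonal conditions (b) and
(d) extend from generators through the trace bounds supplied by (a) and (c). The first part of (e)
follows from the second, since `h(B_i, B_i^⊥)` is integral. -/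
lemma hCond_iff (hδ : IsUnit D.δ)
    (f : HermForm (D.conjR R : B ⊗[A] R →+* B ⊗[A] R) (LR A B L R)) :
    HCond h F R f ↔
      GramCond D.conj {j | HTest h j} {j | HTestV h F j} (f.sub (formR h R)).form := by
  constructor
  · intro hf
    refine ⟨?_, ?_⟩
    · rintro _ _ _ (⟨i, x, a, ha⟩ | ⟨i, a, ha⟩ | ⟨i, hi, a, w, ha, hw⟩ | ⟨i, hi, w, hw⟩)
      · refine dvd_sub (hf.condA i _ _ (one_tmul_mem ha)) ?_
        rw [formR_one_tmul]
        exact tmul_dvd_tmul R (π_pow_dvd_form_left h ha _) 1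
      · exact hf.condB i _ (one_tmul_mem ha)
      · exact hf.condC i hi _ (one_tmul_mem ha) _ (one_tmul_mem hw)
      · exact hf.condD i hi _ (one_tmul_mem hw)
    · rintro _ _ ⟨i, hi, a, ha, v, hv⟩
      obtain ⟨c, hc⟩ := hf.condE₂ i hi _ (one_tmul_mem ha) _ (Submodule.subset_span ⟨_, hv, rfl⟩)
      refine ⟨c, ?_⟩
      rw [← hc, ← HermForm.extend_sub, HermForm.extend_tmul_one]
      rfl
  · intro hg
    have hA (i : ℕ) {x a : LR A B L R} (ha : a ∈ (latA h i).baseChange (B ⊗[A] R)) :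
        (D.π ^ i) ⊗ₜ[A] (1 : R) ∣ (f.sub (formR h R)).form x a :=
      dvd_form_of_generators (P := ⊤) _ (fun x _ a ha => hg.dvd x a _ (.A i x a ha))
        (by rw [Submodule.baseChange_top]; trivial) ha
    have hC (i : ℕ) (hi : Even i) {a w : LR A B L R} (ha : a ∈ (latA h i).baseChange (B ⊗[A] R))
        (hw : w ∈ (latW h i).baseChange (B ⊗[A] R)) :
        (D.π ^ (i + 1)) ⊗ₜ[A] (1 : R) ∣ (f.sub (formR h R)).form a w :=
      dvd_form_of_generators _ (fun a ha w hw => hg.dvd a w _ (.C i hi a w ha hw)) ha hw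
    have hE (i : ℕ) (hi : Odd i) {a : LR A B L R} (ha : a ∈ (latA h i).baseChange (B ⊗[A] R))
        {v : LR A B L R ⊗[A] F} (hv : v ∈ latVR F R (dualLat h F (latB h i))) :
        ∃ c : B ⊗[A] R, (f.sub (formR h R)).extend F (a ⊗ₜ[A] (1 : F)) v = c ⊗ₜ[A] (1 : F) :=
      integral_of_generators F _ (fun a ha v hv => by
        rw [HermForm.extend_tmul_one]
        exact hg.integral a v (.E i hi a ha v hv)) ha hv
    refine ⟨fun i x a ha => ?_, fun i a ha => ?_, fun i hi a ha w hw => hC i hi ha hw,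
      fun i hi w hw => ?_, fun i hi b hb v hv => ?_, fun i hi a ha v hv => ?_⟩
    · refine (dvd_iff_dvd_of_dvd_sub (hA i (x := x) ha)).2 ?_
      exact dvd_formR h (P := ⊤) (fun x _ a ha => π_pow_dvd_form_left h ha x)
        (by rw [Submodule.baseChange_top]; trivial) ha
    · refine dvd_form_self_of_generators (f.sub (formR h R))
        (fun a ha => hg.dvd a a _ (.B i a ha)) (fun x hx y hy => ?_) ha
      exact (tmul_dvd_tmul R (D.ξ_pow_mul_two_dvd hδ _) 1).trans (dvd_trace_tmul i (hA i hy))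
    · refine dvd_form_self_of_generators (f.sub (formR h R))
        (fun w hw => hg.dvd w w _ (.D i hi w hw)) (fun x hx y hy => ?_) hw
      refine (tmul_dvd_tmul R (D.ξ_pow_mul_four_dvd hδ _) 1).trans ?_
      -- Condition (c) gives one more power of `π`; for `i = 2m` the trace bound at the odd index `i
      -- + 1` has exponent `m + 2`, as required modulo 4.
      have := dvd_trace_tmul (i + 1) (hC i hi (baseChange_mono R (latW_le_latA h i) hx) hy)
      obtain ⟨k, rfl⟩ := hi
      rwa [show (k + k + 1 + 1) / 2 + 1 = (k + k) / 2 + 2 by omega] at this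
    · obtain ⟨c, hc⟩ := hE i hi (baseChange_mono R (latB_le_latA h i) hb) hv
      obtain ⟨c', hc'⟩ := integral_formR h hb hv
      refine ⟨c + c', ?_⟩
      rw [TensorProduct.add_tmul, ← hc, ← hc', HermForm.extend_sub, sub_add_cancel]
    · rw [← HermForm.extend_sub]
      exact hE i hi ha hv

section Bounds

variable {h} {d : A} (hd : IsDualBound h d) (g : L →ₛₗ[(D.conj : B →+* B)] L →ₗ[B] B)
include hd

omit hd [Module A L] [IsScalarTower A B L] in
lemma sesquilinear_smul_left (b : B) (x y : L) : g (b • x) y = D.σ b * g x y := by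
  rw [LinearMap.map_smulₛₗ]
  rfl

lemma IsDualBound.smul_form_right {i : ℕ} {a : L} (ha : a ∈ latA h i) (x : L) :
    D.π ^ i ∣ d • g x a := by
  obtain ⟨z, hz⟩ := hd.exists_of_mem_latA ha
  rw [← algebraMap_smul B d, ← map_smul, algebraMap_smul, hz, map_smul, D.σ_π_pow, smul_eq_mul]
  exact (dvd_mul_left _ _).mul_right _

/-- One factor `d` for each variable: `d a = σ(π^i) z` turns `d² g(a, a)` into `ξ^i g(z, z)`. -/
lemma IsDualBound.sq_smul_form_self {i : ℕ} {a : L} (ha : a ∈ latA h i) :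
    D.ξ ^ i ∣ d ^ 2 • g a a := by
  obtain ⟨z, hz⟩ := hd.exists_of_mem_latA ha
  have h1 : d ^ 2 • g a a = g (d • a) (d • a) := by
    rw [← algebraMap_smul B d a, map_smul, sesquilinear_smul_left,
      AlgEquiv.commutes, Algebra.smul_def, smul_eq_mul, map_pow]
    ring
  rw [h1, hz, map_smul, sesquilinear_smul_left, smul_eq_mul, D.σ_σ, ← mul_assoc, D.σ_π_pow_mul]
  exact dvd_mul_right _ _

/-- Powers of `π` and `ξ` come from `d²`, and the residual factors 2, `π` or 4 divide 4. In the
diagonal cases the exponent `i` of `ξ` exceeds or equals the `(i + 1) / 2` or `i / 2` needed. -/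
lemma IsDualBound.dvd_smul_of_hTest (hδ : IsUnit D.δ) {x y : L} {t : B} (ht : HTest h (x, y, t)) :
    t ∣ (4 * d ^ 2) • g x y := by
  have h4 (b : B) : (4 * d ^ 2) • b = 4 * d ^ 2 • b := by
    rw [mul_smul, Algebra.smul_def, map_ofNat]
  have h4' (b : B) : (4 * d ^ 2) • b = 4 * d • d • b := by
    rw [h4, pow_two, mul_smul]
  rcases ht with (⟨i, x, a, ha⟩ | ⟨i, a, ha⟩ | ⟨i, hi, a, w, ha, hw⟩ | ⟨i, hi, w, hw⟩)
  · rw [h4', Algebra.smul_def]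
    exact ((hd.smul_form_right g ha _).mul_left _).mul_left _
  · rw [h4, show ∀ b : B, 4 * b = b * 2 * 2 from fun b => by ring]
    refine (mul_dvd_mul_right ?_ 2).trans (mul_dvd_mul_right (dvd_mul_right _ 2) 2)
    exact (pow_dvd_pow _ (by omega)).trans (hd.sq_smul_form_self g ha)
  · rw [h4', pow_succ', Algebra.smul_def]
    refine mul_dvd_mul ?_ ((hd.smul_form_right g (latW_le_latA h i hw) _).mul_left _)
    rw [show (4 : B) = 2 * 2 by norm_num]
    exact (D.π_dvd_two hδ).mul_left 2
  · rw [h4, mul_comm]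
    refine mul_dvd_mul_left 4 ((pow_dvd_pow _ ?_).trans
      (hd.sq_smul_form_self g (latW_le_latA h i hw)))
    omega

/-- From `d x = σ(π^i) z` one gets `4d² g(x, v) = g(z, 4d π^i v)`, and `4d π^i v` lies in `L`. -/
lemma IsDualBound.integral_smul_of_hTestV [IsDomain A] [IsFractionRing A F] [IsDomain B]
    [Module.Finite A B] [Module.Free A B] [Module.Free B L] (hδ : IsUnit D.δ) {x : L}
    {v : L ⊗[A] F} (hv : HTestV h F (x, v)) :
    (4 * d ^ 2) • ((g x).restrictScalars A).rTensor F v ∈ integersE A B F := by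
  obtain ⟨i, hi, a, ha, v, hv⟩ := hv
  obtain ⟨z, hz⟩ := hd.exists_of_mem_latA ha
  obtain ⟨y, hy⟩ := hd.exists_of_mem_dualLat F hδ hv
  refine (mem_integersE _).2 ⟨g z y, ?_⟩
  have h1 : (algebraMap A B d) • g x = D.π ^ i • g z := by
    ext l
    have := sesquilinear_smul_left g (algebraMap A B d) x l
    rw [algebraMap_smul, hz, sesquilinear_smul_left, D.σ_σ, AlgEquiv.commutes] at this
    exact this.symm
  have h2 : (4 * d ^ 2) • ((g x).restrictScalars A).rTensor F v =
      (algebraMap A B (4 * d) ⊗ₜ[A] (1 : F)) *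
        (((algebraMap A B d) • g x).restrictScalars A).rTensor F v := by
    rw [rTensor_restrictScalars_smul_left, ← mul_assoc, Algebra.TensorProduct.tmul_mul_tmul,
      ← map_mul, Algebra.smul_def, Algebra.TensorProduct.algebraMap_apply, one_mul,
      show 4 * d ^ 2 = 4 * d * d by ring]
  rw [h2, h1, rTensor_restrictScalars_smul_left, ← mul_assoc, Algebra.TensorProduct.tmul_mul_tmul,
    one_mul, ← rTensor_restrictScalars_smul, hy]
  rfl

end Bounds

end RepresentH

/-! ### Representability of `H` -/

section Representability

variable {A : Type u} {B : Type*} [CommRing A] [CommRing B] [Algebra A B] {D : Case2 A B}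
  {L : Type*} [AddCommGroup L] [Module B L] (h : HermForm (D.conj : B →+* B) L)
  [Module A L] [IsScalarTower A B L] (F : Type*) [Field F] [Algebra A F]

lemma mapLR_induction {R R' : Type*} [CommRing R] [Algebra A R] [CommRing R'] [Algebra A R']
    (φ : R →ₐ[A] R') (f : HermForm (D.conjR R : B ⊗[A] R →+* B ⊗[A] R) (LR A B L R))
    (f' : HermForm (D.conjR R' : B ⊗[A] R' →+* B ⊗[A] R') (LR A B L R'))
    (H : ∀ l l' : L, f'.form (1 ⊗ₜ[B] l) (1 ⊗ₜ[B] l') =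
      Algebra.TensorProduct.map (AlgHom.id A B) φ (f.form (1 ⊗ₜ[B] l) (1 ⊗ₜ[B] l')))
    (x y : LR A B L R) :
    f'.form (mapLR B L φ x) (mapLR B L φ y) =
      Algebra.TensorProduct.map (AlgHom.id A B) φ (f.form x y) := by
  have hφ (c : B ⊗[A] R) : Algebra.TensorProduct.map (AlgHom.id A B) φ (D.conjR R c) =
      D.conjR R' (Algebra.TensorProduct.map (AlgHom.id A B) φ c) := by
    induction c with
    | zero => simp
    | add c c' h h' => simp only [map_add, h, h']
    | tmul b r => rfl
  have hmul (c : B ⊗[A] R) (l : L) : c ⊗ₜ[B] l = c • ((1 : B ⊗[A] R) ⊗ₜ[B] l) := by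
    rw [TensorProduct.smul_tmul', smul_eq_mul, mul_one]
  have hmul' (c : B ⊗[A] R) (l : L) : mapLR B L φ (c ⊗ₜ[B] l) =
      (Algebra.TensorProduct.map (AlgHom.id A B) φ c) • ((1 : B ⊗[A] R') ⊗ₜ[B] l) := by
    rw [mapLR_tmul, TensorProduct.smul_tmul', smul_eq_mul, mul_one]
    rfl
  induction x using TensorProduct.induction_on with
  | zero => simp
  | add x x' hx hx' => simp only [map_add, LinearMap.add_apply, hx, hx']
  | tmul c l =>
    induction y using TensorProduct.induction_on with
    | zero => simp
    | add y y' hy hy' => simp only [map_add, hy, hy']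
    | tmul c' l' =>
      rw [hmul' c l, hmul' c' l', hmul c l, hmul c' l', HermForm.form_smul_left,
        HermForm.form_smul_left, map_smul, map_smul, smul_eq_mul, smul_eq_mul, H, map_mul, map_mul,
        RingHom.coe_coe, RingHom.coe_coe, hφ]

theorem nonempty_hModel [IsDomain A] [IsPrincipalIdealRing A] [IsFractionRing A F] [IsDomain B]
    [Module.Finite A B] [Module.Free A B] [Module.Free B L] [Module.Finite B L]
    {d : A} (hd : IsDualBound h d) (hδ : IsUnit D.δ) (h4 : (4 : A) ≠ 0) :
    Nonempty (HModel h F) := by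
  have hc : 4 * d ^ 2 ≠ 0 := mul_ne_zero h4 (pow_ne_zero 2 hd.ne_zero)
  let e := Module.Free.chooseBasis B L
  let ι := Module.Free.ChooseBasisIndex B L
  let S := gramLattice (F := F) e D.conj {j | HTest h j} {j | HTestV h F j}
  have hS (R : Type u) [CommRing R] [Algebra A R] [Module.Flat A R] (y : R ⊗[A] (ι × ι → B)) :=
    gramCond_iff e D.conj {j | HTest h j} {j | HTestV h F j} (F := F) (R := R) hc
      (fun x y t ht G => hd.dvd_smul_of_hTest _ hδ ht)
      (fun x v hv G => hd.integral_smul_of_hTestV F _ hδ hv) y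
  -- The coordinates of `f` are the Gram matrix of `f - h`, so `h` becomes the origin of the affine
  -- space.
  let c (R : Type u) [CommRing R] [Algebra A R] (f : H h F R) : R ⊗[A] (ι × ι → B) :=
    (equivGram A B R ι).symm fun p => (f.1.sub (formR h R)).form (e.baseChange (B ⊗[A] R) p.1)
      (e.baseChange (B ⊗[A] R) p.2)
  have hform (R : Type u) [CommRing R] [Algebra A R] (f : H h F R) :
      gramForm (e.baseChange (B ⊗[A] R)) (mapR R D.conj) (equivGram A B R ι (c R f)) =
        (f.1.sub (formR h R)).form := by
    rw [LinearEquiv.apply_symm_apply]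
    exact gramForm_gram _ _
  have hsub (R : Type u) [CommRing R] [Algebra A R] (f : H h F R) (x y : LR A B L R) :
      f.1.form x y = (formR h R).form x y + gramForm (e.baseChange (B ⊗[A] R)) (mapR R D.conj)
        (equivGram A B R ι (c R f)) x y := by
    rw [hform]
    exact (add_sub_cancel _ _).symm
  refine FlatModel.nonempty_of_submodule S (fun R _ _ _ f => c R f) ?_ ?_ ?_
  · intro R _ _ _ f f' (hff : c R f = c R f')
    refine Subtype.ext (HermForm.ext (LinearMap.ext₂ fun x y => ?_))
    rw [hsub, hsub, hff]
  · intro R _ _ _ y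
    rw [← hS]
    constructor
    · rintro ⟨f, rfl⟩
      refine ⟨fun i j => ?_, ?_⟩
      · rw [LinearEquiv.apply_symm_apply]
        exact (f.1.sub (formR h R)).symm _ _
      · rw [hform]
        exact (hCond_iff h F hδ f.1).1 f.2
    · rintro ⟨hsymm, hcond⟩
      let g : HermForm (D.conjR R : B ⊗[A] R →+* B ⊗[A] R) (LR A B L R) :=
        hermOfGram (e.baseChange (B ⊗[A] R)) (conjR_conjR R) _ hsymm
      have hg : ((formR h R).add g).sub (formR h R) = g := HermForm.add_sub_self _ _
      refine ⟨⟨(formR h R).add g, (hCond_iff h F hδ _).2 ?_⟩, ?_⟩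
      · rw [hg]
        exact hcond
      · refine (LinearEquiv.symm_apply_eq _).2 (funext fun p => ?_)
        rw [hg]
        exact gramForm_basis _ _ _ _
  · intro R R' _ _ _ _ _ _ φ f f' hff
    refine mapLR_induction φ f.1 f'.1 fun l l' => ?_
    have hcomm (w : R ⊗[A] B) : Algebra.TensorProduct.map (AlgHom.id A B) φ
        (TensorProduct.comm A R B w) =
        TensorProduct.comm A R' B (φ.toLinearMap.rTensor B w) := by
      induction w with
      | zero => simp
      | add w w' h h' => simp only [map_add, h, h']
      | tmul r b => rfl
    rw [hsub, hsub, gramForm_equivGram, gramForm_equivGram, map_add, formR_one_tmul,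
      formR_one_tmul, hcomm, Algebra.TensorProduct.map_tmul, map_one]
    congr 2
    rw [← LinearMap.comp_apply, LinearMap.rTensor_comp_lTensor, ← LinearMap.lTensor_comp_rTensor,
      LinearMap.comp_apply]
    exact congrArg _ hff

end Representability

/-! ### Stability of `H(R)` under `M(R)` -/

section Action

variable {A B : Type*} [CommRing A] [CommRing B] [Algebra A B] {D : Case2 A B}
  {L : Type*} [AddCommGroup L] [Module B L] (h : HermForm (D.conj : B →+* B) L)
  {R : Type*} [CommRing R] [Algebra A R] [Module A L] [IsScalarTower A B L]

lemma two_pow_dvd_formR_self {i : ℕ} {b : LR A B L R}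
    (hb : b ∈ (latB h i).baseChange (B ⊗[A] R)) :
    ((2 : B) ^ ((i + 1) / 2 + 1)) ⊗ₜ[A] (1 : R) ∣ (formR h R).form b b := by
  refine dvd_form_self_of_generators _ (fun p hp => ?_) (fun x hx y hy => ?_) hb
  · rw [formR_one_tmul]
    exact tmul_dvd_tmul R hp.2 1
  · exact dvd_trace_tmul i
      (dvd_formR h (P := latB h i) (Q := latB h i) (fun p hp q _ => hp.1 q) hx hy)

lemma π_pow_succ_dvd_formR_latX {i : ℕ} {a x : LR A B L R}
    (ha : a ∈ (latA h i).baseChange (B ⊗[A] R)) (hx : x ∈ (latX h i).baseChange (B ⊗[A] R)) :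
    (D.π ^ (i + 1)) ⊗ₜ[A] (1 : R) ∣ (formR h R).form a x := by
  refine dvd_formR h (fun p hp q hq => ?_) ha hx
  rw [form_symm h q p]
  exact D.π_pow_dvd_σ (hq.2 p hp)

lemma two_pow_dvd_trace {i : ℕ} (hi : Even i) {z : B ⊗[A] R}
    (hz : (D.π ^ (i + 1)) ⊗ₜ[A] (1 : R) ∣ z) :
    ((2 : B) ^ (i / 2 + 2)) ⊗ₜ[A] (1 : R) ∣ z + D.conjR R z := by
  have := dvd_trace_tmul (i + 1) hz
  obtain ⟨k, rfl⟩ := hi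
  rwa [show (k + k + 1 + 1) / 2 + 1 = (k + k) / 2 + 2 by omega] at this

/-- `Z_i` controls the values at generators, and `X_i` controls the traces of the cross terms. -/
lemma two_pow_dvd_formR_latZ {i : ℕ} (hi : Even i) {z : LR A B L R}
    (hz : z ∈ (latX h i ⊓ latZ h i).baseChange (B ⊗[A] R)) :
    ((2 : B) ^ (i / 2 + 2)) ⊗ₜ[A] (1 : R) ∣ (formR h R).form z z := by
  refine dvd_form_self_of_generators _ (fun p hp => ?_) (fun x hx y hy => ?_) hz
  · rw [formR_one_tmul]
    exact tmul_dvd_tmul R hp.2.2.2 1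
  · exact two_pow_dvd_trace hi (π_pow_succ_dvd_formR_latX h
      (baseChange_mono R (inf_le_left.trans (latX_le_latA h i)) hx)
      (baseChange_mono R inf_le_left hy))

lemma form_self_sub_form_self (g : HermForm (D.conjR R : B ⊗[A] R →+* B ⊗[A] R) (LR A B L R))
    (x y : LR A B L R) :
    g.form y y - g.form x x = g.form (y - x) (y - x) +
      (g.form x (y - x) + D.conjR R (g.form x (y - x))) := by
  have := form_add_self_tmul g x (y - x)
  rw [add_sub_cancel] at this
  rw [this]
  ring

lemma dvd_sub_right_of_dvd_sub {C : Type*} [CommRing C] {t x y z : C} (hxy : t ∣ x - y) :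
    t ∣ x - z ↔ t ∣ y - z := by
  rw [← sub_add_sub_cancel x y z, dvd_add_right hxy]

lemma form_sub_form (g : HermForm (D.conjR R : B ⊗[A] R →+* B ⊗[A] R) (LR A B L R))
    (x y x' y' : LR A B L R) :
    g.form x' y' - g.form x y = g.form (x' - x) y + g.form x' (y' - y) := by
  simp only [map_sub, LinearMap.sub_apply]
  ring

variable (F : Type*) [Field F] [Algebra A F]

lemma extend_comp (f : HermForm (D.conjR R : B ⊗[A] R →+* B ⊗[A] R) (LR A B L R))
    (m : Module.End (B ⊗[A] R) (LR A B L R)) (x : LR A B L R) (v : LR A B L R ⊗[A] F) :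
    (f.comp m).extend F (x ⊗ₜ[A] (1 : F)) v = f.extend F (m x ⊗ₜ[A] (1 : F)) (endV F R m v) := by
  rw [HermForm.extend_tmul_one, HermForm.extend_tmul_one]
  induction v with
  | zero => simp
  | add v v' hv hv' => rw [map_add, map_add, map_add, hv, hv']
  | tmul l a => rfl

variable {h F}

lemma MCond.endV_mem {m : Module.End (B ⊗[A] R) (LR A B L R)} (hm : MCond h F R m) {i : ℕ}
    (hi : Odd i) {v : LR A B L R ⊗[A] F} (hv : v ∈ latVR F R (dualLat h F (latB h i))) :
    endV F R m v ∈ latVR F R (dualLat h F (latB h i)) := by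
  have := add_mem (latVR_mono F R (dualLat_anti h F (latB_le_latA h i)) (hm.idDual i hi v hv)) hv
  rwa [sub_add_cancel] at this

/-- The conditions on `f` at the images under `m` reduce each congruence to a statement about `h`
and `m - 1`. -/
theorem HCond.comp [IsDomain B] [IsPrincipalIdealRing B] (hδ : IsUnit D.δ)
    {f : HermForm (D.conjR R : B ⊗[A] R →+* B ⊗[A] R) (LR A B L R)} (hf : HCond h F R f)
    {m : Module.End (B ⊗[A] R) (LR A B L R)} (hm : MCond h F R m) : HCond h F R (f.comp m) where
  condA i x a ha := hf.condA i (m x) (m a) (hm.stabA i a ha)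
  condB i a ha := by
    refine (dvd_sub_right_of_dvd_sub (hf.condB i (m a) (hm.stabA i a ha))).2 ?_
    rw [form_self_sub_form_self]
    refine (tmul_dvd_tmul R (D.ξ_pow_mul_two_dvd hδ _) 1).trans (dvd_add ?_ ?_)
    · exact two_pow_dvd_formR_self h (hm.idAB i a ha)
    · exact dvd_trace_tmul i
        (dvd_formR h (P := latA h i) (Q := latB h i) (fun p hp q _ => hp q) ha (hm.idAB i a ha))
  condC i hi a ha w hw := by
    refine (dvd_sub_right_of_dvd_sub (hf.condC i hi (m a) (hm.stabA i a ha) (m w)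
      (hm.stabW i w hw))).2 ?_
    rw [form_sub_form]
    refine dvd_add ?_ ?_
    -- `ma - a` lies in `B_i`, which pairs with `W_i` into `π^(i+1)`; the remaining term has `mw -
    -- w` in `X_i`.
    · exact dvd_formR h (fun b hb w hw => π_pow_dvd_form_latB_latW h hδ hi hb hw)
        (hm.idAB i a ha) hw
    · exact π_pow_succ_dvd_formR_latX h (hm.stabA i a ha)
        (baseChange_mono R inf_le_left (hm.idWXZ i hi w hw))
  condD i hi w hw := by
    refine (dvd_sub_right_of_dvd_sub (hf.condD i hi (m w) (hm.stabW i w hw))).2 ?_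
    rw [form_self_sub_form_self]
    refine (tmul_dvd_tmul R (D.ξ_pow_mul_four_dvd hδ _) 1).trans (dvd_add ?_ ?_)
    · exact two_pow_dvd_formR_latZ h hi (hm.idWXZ i hi w hw)
    · exact two_pow_dvd_trace hi (π_pow_succ_dvd_formR_latX h
        (baseChange_mono R (latW_le_latA h i) hw)
        (baseChange_mono R inf_le_left (hm.idWXZ i hi w hw)))
  condE₁ i hi b hb v hv := by
    rw [extend_comp]
    exact hf.condE₁ i hi _ (hm.stabB i b hb) _ (hm.endV_mem hi hv)
  condE₂ i hi a ha v hv := by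
    have hv' := hm.endV_mem hi hv
    -- Decomposition: `f(ma, mv) - h(a, v) = (f - h)(ma, mv) + h(ma - a, mv) + h(a, mv - v)`. The
    -- last two terms pair `B_i` with `B_i^⊥` and `A_i` with `A_i^⊥`.
    obtain ⟨c₁, h₁⟩ := hf.condE₂ i hi _ (hm.stabA i a ha) _ hv'
    obtain ⟨c₂, h₂⟩ := integral_formR h (hm.idAB i a ha) hv'
    obtain ⟨c₃, h₃⟩ := integral_formR h ha (hm.idDual i hi v hv)
    refine ⟨c₁ + (c₂ + c₃), ?_⟩
    rw [extend_comp, TensorProduct.add_tmul, TensorProduct.add_tmul, ← h₁, ← h₂, ← h₃,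
      TensorProduct.sub_tmul, map_sub, map_sub, LinearMap.sub_apply]
    ring

end Action

/-! ### The right action and its compatibility with restriction -/

section RightAction

variable {A : Type u} {B : Type*} [CommRing A] [CommRing B] [Algebra A B] {D : Case2 A B}
  {L : Type*} [AddCommGroup L] [Module B L] (h : HermForm (D.conj : B →+* B) L)
  [Module A L] [IsScalarTower A B L] (F : Type*) [Field F] [Algebra A F]

lemma mapLR_one_tmul {R R' : Type*} [CommRing R] [Algebra A R] [CommRing R'] [Algebra A R']
    (φ : R →ₐ[A] R') (l : L) : mapLR B L φ (1 ⊗ₜ[B] l) = 1 ⊗ₜ[B] l := by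
  rw [mapLR_tmul, map_one]

lemma linearMap_ext_one_tmul {R : Type*} [CommRing R] [Algebra A R] {N : Type*} [AddCommGroup N]
    [Module (B ⊗[A] R) N] {f g : LR A B L R →ₗ[B ⊗[A] R] N}
    (H : ∀ l : L, f (1 ⊗ₜ[B] l) = g (1 ⊗ₜ[B] l)) : f = g := by
  refine LinearMap.ext fun x => ?_
  refine baseChange_induction (P := ⊤) (motive := fun x => f x = g x) (fun l _ => H l) ?_ ?_ ?_
    (by rw [Submodule.baseChange_top]; trivial)
  · rw [map_zero, map_zero]
  · intro x y hx hy
    rw [map_add, map_add, hx, hy]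
  · intro c x hx
    rw [map_smul, map_smul, hx]

section Restriction

variable {R R' : Type u} [CommRing R] [Algebra A R] [CommRing R'] [Algebra A R'] {φ : R →ₐ[A] R'}
  {h F}

lemma MStarRes.unique {m : MStar h F R} {m' m'' : MStar h F R'} (h' : MStarRes h F φ m m')
    (h'' : MStarRes h F φ m m'') : m' = m'' := by
  refine Units.ext (Subtype.ext (linearMap_ext_one_tmul fun l => ?_))
  rw [← mapLR_one_tmul φ l]
  exact (h' _).trans (h'' _).symm

lemma MStarRes.mul {m n : MStar h F R} {m' n' : MStar h F R'} (hm : MStarRes h F φ m m')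
    (hn : MStarRes h F φ n n') : MStarRes h F φ (m * n) (m' * n') := fun x => by
  change m'.1.1 (n'.1.1 (mapLR B L φ x)) = mapLR B L φ (m.1.1 (n.1.1 x))
  rw [hn, hm]

lemma HRes.unique {f : H h F R} {f' f'' : H h F R'} (h' : HRes h F φ f f')
    (h'' : HRes h F φ f f'') : f' = f'' := by
  refine Subtype.ext (HermForm.ext (LinearMap.ext fun x => linearMap_ext_one_tmul fun l' => ?_))
  -- Linearity is available in the second variable only, so hermitian symmetry moves `x` there
  -- before reducing it to generators.
  rw [f'.1.symm (1 ⊗ₜ[B] l') x, f''.1.symm (1 ⊗ₜ[B] l') x]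
  congr 1
  refine LinearMap.congr_fun (linearMap_ext_one_tmul fun l => ?_) x
  rw [← mapLR_one_tmul φ l, ← mapLR_one_tmul φ l']
  exact (h' _ _).trans (h'' _ _).symm

end Restriction

variable [IsDomain B] [IsPrincipalIdealRing B]

variable {h F} in
/-- The form `f ∘ m` as an element of `H(R)`. -/
def H.act (hδ : IsUnit D.δ) {R : Type*} [CommRing R] [Algebra A R] (f : H h F R)
    (m : MStar h F R) : H h F R :=
  ⟨f.1.comp m.1.1, f.2.comp hδ m.1.2⟩

/-- The right action of `M*(R)` on `H(R)`. -/
@[reducible]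
def H.mulAction (hδ : IsUnit D.δ) (R : Type*) [CommRing R] [Algebra A R] :
    MulAction (MStar h F R)ᵐᵒᵖ (H h F R) where
  smul m f := f.act hδ m.unop
  one_smul _ := rfl
  mul_smul _ _ _ := rfl

variable {h F} in
lemma HRes.act (hδ : IsUnit D.δ) {R R' : Type u} [CommRing R] [Algebra A R] [CommRing R']
    [Algebra A R'] {φ : R →ₐ[A] R'} {f : H h F R} {f' : H h F R'} {m : MStar h F R}
    {m' : MStar h F R'} (hf : HRes h F φ f f') (hm : MStarRes h F φ m m') :
    HRes h F φ (f.act hδ m) (f'.act hδ m') := fun x y => by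
  change f'.1.form (m'.1.1 _) (m'.1.1 _) = _
  rw [hm, hm, hf]
  rfl

end RightAction

end RamifiedHermitian

/-! ### Proof of the theorem -/

open RamifiedHermitian in
theorem theorem3p4
    -- the ring of integers `A` of a finite unramified extension `F` of `ℚ₂`
    {A : Type u} {F : Type*} [CommRing A] [Field F] [Algebra ℚ_[2] F] [FiniteDimensional ℚ_[2] F]
    [Algebra ℤ_[2] F] [IsScalarTower ℤ_[2] ℚ_[2] F] [Algebra ℤ_[2] A] [Algebra A F]
    [IsScalarTower ℤ_[2] A F] [IsIntegralClosure A ℤ_[2] F] (unramified : Irreducible (2 : A))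
    -- the ring of integers `B` of a quadratic extension `E` of `F`, as in Case 2
    {B : Type*} {E : Type*} [CommRing B] [Field E] [Algebra F E] [Algebra A E]
    [IsScalarTower A F E] [Algebra A B] [Algebra B E] [IsScalarTower A B E]
    [IsIntegralClosure B A E] (quadratic : Module.finrank F E = 2) (D : Case2 A B)
    -- a nondegenerate hermitian lattice `(L, h)`
    {L : Type*} [AddCommGroup L] [Module B L] [Module.Finite B L] [Module.Free B L]
    [Module A L] [IsScalarTower A B L] (h : HermForm (D.conj : B →+* B) L)
    (nondegenerate : ∀ x : L ⊗[A] F, (∀ y, h.extend F x y = 0) → x = 0) :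
    -- for flat `R`, the group `M*(R)` acts on `H(R)` on the right by `f ∘ m`
    (∀ (R : Type u) [CommRing R] [Algebra A R] [Module.Flat A R],
      ∃ act : MulAction (MStar h F R)ᵐᵒᵖ (H h F R),
        ∀ (f : H h F R) (m : MStar h F R),
          (act.smul (MulOpposite.op m) f).1 = f.1.comp m.1.1) ∧
    -- the functors `H` and `M*` are represented by flat affine `A`-schemes
    Nonempty (HModel h F) ∧ Nonempty (MStarModel h F) ∧
    -- and the action is represented by a unique morphism, an action of the group scheme `M*`
    ∀ (XH : HModel h F) (XM : MStarModel h F),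
      ∃ G : GrpObj XM.X,
        (∀ (R : Type u) [CommRing R] [Algebra A R] [Module.Flat A R]
          (g g' : specOver A R ⟶ XM.X),
          XM.pts R (lift g g' ≫ G.mul) = XM.pts R g * XM.pts R g') ∧
        ∃ a : XH.X ⊗ XM.X ⟶ XH.X,
          (∀ (T : Over (Spec (.of A))) (p : T ⟶ XH.X) (g g' : T ⟶ XM.X),
            lift (lift p g ≫ a) g' ≫ a = lift p (lift g g' ≫ G.mul) ≫ a) ∧
          (∀ (T : Over (Spec (.of A))) (p : T ⟶ XH.X),
            lift p (toUnit T ≫ G.one) ≫ a = p) ∧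
          (∀ (R : Type u) [CommRing R] [Algebra A R] [Module.Flat A R]
            (p : specOver A R ⟶ XH.X) (g : specOver A R ⟶ XM.X),
            (XH.pts R (lift p g ≫ a)).1 = (XH.pts R p).1.comp (XM.pts R g).1.1) ∧
          ∀ a' : XH.X ⊗ XM.X ⟶ XH.X,
            (∀ (R : Type u) [CommRing R] [Algebra A R] [Module.Flat A R]
              (p : specOver A R ⟶ XH.X) (g : specOver A R ⟶ XM.X),
              (XH.pts R (lift p g ≫ a')).1 = (XH.pts R p).1.comp (XM.pts R g).1.1) →
            a' = a := by
  obtain ⟨_, _, _, _⟩ := integers_facts A F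
  have : FiniteDimensional F E := Module.finite_of_finrank_eq_succ quadratic
  obtain ⟨_, _, _, _, -⟩ := extension_facts A F B E
  have hδ : IsUnit D.δ := isUnit_of_two_dvd_sub_one D.δ_mod
  -- Needed for the common multiplier `4d²` to be nonzero.
  have h4 : (4 : A) ≠ 0 := by
    rw [show (4 : A) = 2 * 2 by norm_num]
    exact mul_ne_zero unramified.ne_zero unramified.ne_zero
  obtain ⟨d, hd⟩ := exists_isDualBound h F (IsFractionRing.injective A F) nondegenerate
  refine ⟨fun R _ _ _ => ⟨H.mulAction h F hδ R, fun f m => rfl⟩, nonempty_hModel h F hd hδ h4,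
    nonempty_mStarModel h F hd hδ h4, fun XH XM => ?_⟩
  obtain ⟨G, hG, a, h1, h2, h3, h4⟩ := FlatModel.exists_grpObj_action XM
    (fun φ m m' m'' => MStarRes.unique) (fun φ m n m' n' => MStarRes.mul) XH
    (fun φ f f' f'' => HRes.unique) (fun R _ _ f m => f.act hδ m)
    (fun φ f m f' m' => HRes.act hδ) (fun R _ _ f m m' => rfl) (fun R _ _ f => rfl)
  exact ⟨G, hG, a, h1, h2, fun R _ _ _ p g => congrArg Subtype.val (h3 R p g),
    fun a' ha' => h4 a' fun R _ _ _ p g => Subtype.ext (ha' R p g)⟩
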